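/- Let $(M,\omega)$ be a compact Kähler manifold of dimension $n$ (no polarization is assumed), $\omega=i g_{j\bar k}dz^j\wedge d\bar z^k$, $V=\int_M\omega^n/n!$, and let $\mathcal K_\omega=\{\varphi\in C^\infty(M,\mathbb R):\ \omega_\varphi:=\omega+i\partial\bar\partial\varphi>0\}$. Let $\Delta f=g^{k\bar l}\partial_k\partial_{\bar l}f$, let $R=\bar\partial(\partial g\,g^{-1})=(R_p{}^q{}_{j\bar k}dz^j\wedge d\bar z^k)$ be the Chern curvature form of $T^{1,0}M$, $R_{p\bar q j\bar k}=R_p{}^r{}_{j\bar k}g_{r\bar q}$, $\mathrm{Ric}_{j\bar k}=R_p{}^p{}_{j\bar k}$ with Ricci form $\mathrm{Ric}=i\,\mathrm{Ric}_{j\bar k}dz^j\wedge d\bar z^k$, $S=g^{j\bar k}\mathrm{Ric}_{j\bar k}$, and for $\alpha=i\alpha_{j\bar k}dz^j\wedge d\bar z^k$, $\beta=i\beta_{j\bar k}dz^j\wedge d\bar z^k$ put $\langle\alpha,\beta\rangle=g^{j\bar k}g^{r\bar l}\alpha_{j\bar l}\beta_{r\bar k}$; $|\mathrm{Ric}|^2=\langle\mathrm{Ric},\mathrm{Ric}\rangle$,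 and $|R|^2$ is the full Hermitian norm of $R_{p\bar q j\bar k}$. Put $$a_2=\tfrac13\Delta S+\tfrac1{24}\left(|R|^2-4|\mathrm{Ric}|^2+3S^2\right),\qquad \widehat{a_2}=\frac1V\int_M a_2\,\frac{\omega^n}{n!}.$$ Let $\mathrm{Td}_2$ be the degree two part of $\mathrm{Td}(A)=\det\frac{iA}{1-e^{-iA}}$, and denote its polarization by the same symbol; let $BC(\mathrm{Td}_2;\omega_\varphi,\omega)=\int_0^1 2\,\mathrm{Td}_2(R(h_s),\dot h_sh_s^{-1})\,ds$ be the Bott–Chern form, computed along the segment $h_s$ of Hermitian metrics on $T^{1,0}M$ from the metric of $\omega$ to the metric of $\omega_\varphi$. The generalized Liouville action is $$\begin{aligned}S_2[\omega_\varphi,\omega]=&-i\int_M\left( BC(\mathrm{Td}_2;\omega_\varphi,\omega)\wedge\frac{\omega^{n-1}}{(n-1)!}+\mathrm{Td}_2(R_\varphi)\wedge\frac{-i}{(n-1)!}\sum_{s=0}^{n-2}\varphi\,\omega_\varphi^s\wedge\omega^{n-2-s}\right)\\&+\frac iV\left(\int_M\mathrm{Td}_2(R)\wedge\frac{\omega^{n-2}}{(n-2)!}\right)\int_M\frac{-i}{(n+1)!}\sum_{s=0}^n\varphi\,\omega_\varphi^s\wedge\omega^{n-s}.\end{aligned}$$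 (Here $R_\varphi$ is the curvature form of $\omega_\varphi$; terms containing $\omega^{m}/m!$ with $m<0$, and empty sums, are zero.) Let $\varphi_t$ be a smooth path in $\mathcal K_\omega$, defined for $t$ in an open interval around $0$, with $\varphi_0=0$; write $\omega_t=\omega_{\varphi_t}$ and let $\dot\varphi,\ddot\varphi$ be its first and second $t$-derivatives at $t=0$. Then $t\mapsto S_2[\omega_t,\omega]$ is twice differentiable at $t=0$ and $$\begin{aligned} \left.\frac{d^2}{dt^2}\right|_{t=0}&S_2[\omega_t,\omega]=\int_M\Big\{\ddot\varphi\Big(\widehat{a_2}+\frac16\Delta S-\frac1{24}\big(|R|^2-4|\mathrm{Ric}|^2+3S^2\big)\Big)\frac{\omega^n}{n!}+\widehat{a_2}\,\dot\varphi\,\Delta\dot\varphi\,\frac{\omega^n}{n!}\\ &+\frac i6\,\partial\Delta\dot\varphi\wedge\bar\partial\Delta\dot\varphi\wedge\frac{\omega^{n-1}}{(n-1)!}-\frac i6\,\partial\dot\varphi\wedge\bar\partial\dot\varphi\wedge i\partial\bar\partial S\wedge\frac{\omega^{n-2}}{(n-2)!}\\ &+\frac14(\Delta\dot\varphi)^2S\,\frac{\omega^n}{n!}+\frac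 i8\,\partial\dot\varphi\wedge\bar\partial\dot\varphi\wedge\mathrm{Ric}^2\wedge\frac{\omega^{n-3}}{(n-3)!}+\frac i{24}\,\partial\dot\varphi\wedge\bar\partial\dot\varphi\wedge\mathrm{Tr}(R^2)\wedge\frac{\omega^{n-3}}{(n-3)!}\\ &-\frac12\Delta\dot\varphi\,\langle i\partial\bar\partial\dot\varphi,\mathrm{Ric}\rangle\frac{\omega^n}{n!}+\frac1{12}\,g^{i\bar q}g^{p\bar j}g^{r\bar l}g^{k\bar s}R_{p\bar q r\bar s}\,\partial_i\partial_{\bar j}\dot\varphi\,\partial_k\partial_{\bar l}\dot\varphi\,\frac{\omega^n}{n!}\Big\}. \end{aligned}$$ -/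

import Mathlib

open scoped ContDiff Manifold Topology ComplexOrder

noncomputable section

namespace Kahler

/-! ### Pointwise multilinear algebra: complex-valued forms in coordinates -/

/-- The model space `ℂⁿ`. -/
abbrev Cn (n : ℕ) : Type := Fin n → ℂ

/-- Complex-valued exterior forms at a point of a coordinate chart: the complex exterior algebra on
the covectors `dz^1, dz̄^1, …, dz^n, dz̄^n`; the product is the wedge product. -/
abbrev Form (n : ℕ) : Type := ExteriorAlgebra ℂ (Fin n × Fin 2 → ℂ)

/-- The covector `dz^j`. -/
def dz {n : ℕ} (j : Fin n) : Form n := ExteriorAlgebra.ι ℂ (Pi.single (j, 0) 1)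

/-- The covector `dz̄^j`. -/
def dzb {n : ℕ} (j : Fin n) : Form n := ExteriorAlgebra.ι ℂ (Pi.single (j, 1) 1)

/-- The `(1,1)`-form `∑ A_{jk̄} dz^j ∧ dz̄^k`. -/
def form11 {n : ℕ} (A : Matrix (Fin n) (Fin n) ℂ) : Form n :=
  ∑ j, ∑ k, A j k • (dz j * dzb k)

/-- The alternating `2n`-linear map taking the value `1` on
`(dz^1, dz̄^1, dz^2, dz̄^2, …, dz^n, dz̄^n)`. -/
def topAlternating (n : ℕ) : (Fin n × Fin 2 → ℂ) [⋀^Fin (n * 2)]→ₗ[ℂ] ℂ :=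
  Matrix.detRowAlternating.compLinearMap (LinearMap.funLeft ℂ ℂ finProdFinEquiv.symm)

/-- The density of the degree `2n` component of a form with respect to
`dx^1 ∧ dy^1 ∧ ⋯ ∧ dx^n ∧ dy^n`, where `z^j = x^j + i y^j`, so that `dx ∧ dy = (i/2) dz ∧ dz̄`,
that is `dz ∧ dz̄ = (2/i) dx ∧ dy`. -/
def topDensity {n : ℕ} (η : Form n) : ℂ :=
  (2 / Complex.I) ^ n * ExteriorAlgebra.liftAlternating (Pi.single (n * 2) (topAlternating n)) η

/-- `η^{n-k} / (n-k)!`, understood as zero when `k > n`. -/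
def powFact {n : ℕ} (η : Form n) (k : ℕ) : Form n :=
  if k ≤ n then (Nat.factorial (n - k) : ℂ)⁻¹ • η ^ (n - k) else 0

/-! ### The Todd polynomial -/

/-- The power series `det (iτA / (1 - exp (-iτA)))` in `τ`; recall
`x / (1 - exp (-x)) = ∑ B'_k x^k / k!` with the Bernoulli numbers for which `B'_1 = 1/2`. -/
def toddSeries {n : ℕ} (A : Matrix (Fin n) (Fin n) ℂ) : PowerSeries ℂ :=
  Matrix.det (Matrix.of fun p q : Fin n =>
    PowerSeries.mk fun k : ℕ =>
      (((bernoulli' k : ℚ) : ℂ) / (Nat.factorial k : ℂ)) * ((Complex.I • A) ^ k) p q)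

/-- The invariant quadratic polynomial `Td₂`. -/
def td2 {n : ℕ} (A : Matrix (Fin n) (Fin n) ℂ) : ℂ := PowerSeries.coeff 2 (toddSeries A)

/-- The symmetric bilinear function obtained from `Td₂` by polarization. -/
def td2Polar {n : ℕ} (A B : Matrix (Fin n) (Fin n) ℂ) : ℂ :=
  (td2 (A + B) - td2 A - td2 B) / 2

/-- The symmetric bilinear function `Tr(AB)`, polarizing `Tr(A²)`. -/
def trace2 {n : ℕ} (A B : Matrix (Fin n) (Fin n) ℂ) : ℂ := Matrix.trace (A * B)

/-! ### Local Kähler geometry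

Below, `G w` is the matrix `(g_{jk̄}(w))` of a Hermitian metric in a coordinate chart. -/

/-- `∂f/∂z^j`. -/
def pz {n : ℕ} (j : Fin n) (f : Cn n → ℂ) (z : Cn n) : ℂ :=
  (1 / 2) * (fderiv ℝ f z (Pi.single j 1) - Complex.I * fderiv ℝ f z (Pi.single j Complex.I))

/-- `∂f/∂z̄^j`. -/
def pzb {n : ℕ} (j : Fin n) (f : Cn n → ℂ) (z : Cn n) : ℂ :=
  (1 / 2) * (fderiv ℝ f z (Pi.single j 1) + Complex.I * fderiv ℝ f z (Pi.single j Complex.I))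

/-- The `(1,0)`-form `∂f`. -/
def del {n : ℕ} (f : Cn n → ℂ) (z : Cn n) : Form n := ∑ j, pz j f z • dz j

/-- The `(0,1)`-form `∂̄f`. -/
def delbar {n : ℕ} (f : Cn n → ℂ) (z : Cn n) : Form n := ∑ j, pzb j f z • dzb j

/-- The complex Hessian `(∂_j ∂_k̄ f)`. -/
def hess {n : ℕ} (f : Cn n → ℂ) (z : Cn n) : Matrix (Fin n) (Fin n) ℂ :=
  Matrix.of fun j k => pz j (pzb k f) z

/-- The `(1,1)`-form `i∂∂̄f`. -/
def iddbar {n : ℕ} (f : Cn n → ℂ) (z : Cn n) : Form n := Complex.I • form11 (hess f z)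

/-- The fundamental form `ω = i g_{jk̄} dz^j ∧ dz̄^k`. -/
def omega {n : ℕ} (G : Cn n → Matrix (Fin n) (Fin n) ℂ) (z : Cn n) : Form n :=
  Complex.I • form11 (G z)

/-- `g^{jk̄}`, normalized by `∑_k g_{lk̄} g^{jk̄} = δ_l^j`. -/
def gInv {n : ℕ} (G : Cn n → Matrix (Fin n) (Fin n) ℂ) (z : Cn n) (j k : Fin n) : ℂ :=
  (G z)⁻¹ k j

/-- The Laplacian `Δf = g^{kl̄} ∂_k ∂_l̄ f`. -/
def lap {n : ℕ} (G : Cn n → Matrix (Fin n) (Fin n) ℂ) (f : Cn n → ℂ) (z : Cn n) : ℂ :=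
  ∑ k, ∑ l, gInv G z k l * hess f z k l

/-- The matrix `(R_p{}^q{}_{jk̄})_{p,q}` of coefficients of `dz^j ∧ dz̄^k` in the Chern curvature
form `R = ∂̄(∂h h⁻¹)` of the Hermitian metric with matrix `h = G`. -/
def curv {n : ℕ} (G : Cn n → Matrix (Fin n) (Fin n) ℂ) (z : Cn n) (j k : Fin n) :
    Matrix (Fin n) (Fin n) ℂ :=
  Matrix.of fun p q => -pzb k (fun w => ∑ s, pz j (fun u => G u p s) w * (G w)⁻¹ s q) z

/-- The curvature tensor `R_{pq̄jk̄} = R_p{}^r{}_{jk̄} g_{rq̄}`. -/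
def riem {n : ℕ} (G : Cn n → Matrix (Fin n) (Fin n) ℂ) (z : Cn n) (p q j k : Fin n) : ℂ :=
  ∑ r, curv G z j k p r * G z r q

/-- The Ricci curvature `Ric_{jk̄} = R_p{}^p{}_{jk̄}`. -/
def ric {n : ℕ} (G : Cn n → Matrix (Fin n) (Fin n) ℂ) (z : Cn n) : Matrix (Fin n) (Fin n) ℂ :=
  Matrix.of fun j k => Matrix.trace (curv G z j k)

/-- The Ricci form `i Ric_{jk̄} dz^j ∧ dz̄^k`. -/
def ricForm {n : ℕ} (G : Cn n → Matrix (Fin n) (Fin n) ℂ) (z : Cn n) : Form n :=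
  Complex.I • form11 (ric G z)

/-- The scalar curvature `S = g^{jk̄} Ric_{jk̄}`. -/
def scal {n : ℕ} (G : Cn n → Matrix (Fin n) (Fin n) ℂ) (z : Cn n) : ℂ :=
  ∑ j, ∑ k, gInv G z j k * ric G z j k

/-- `⟨α,β⟩ = g^{jk̄} g^{rl̄} α_{jl̄} β_{rk̄}` for `α = i α_{jk̄} dz^j ∧ dz̄^k`,
`β = i β_{jk̄} dz^j ∧ dz̄^k`. -/
def inner11 {n : ℕ} (G : Cn n → Matrix (Fin n) (Fin n) ℂ) (z : Cn n)
    (α β : Matrix (Fin n) (Fin n) ℂ) : ℂ :=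
  ∑ j, ∑ k, ∑ r, ∑ l, gInv G z j k * gInv G z r l * α j l * β r k

/-- `|Ric|²`. -/
def ricSq {n : ℕ} (G : Cn n → Matrix (Fin n) (Fin n) ℂ) (z : Cn n) : ℂ :=
  inner11 G z (ric G z) (ric G z)

/-- `|R|² = g^{pb̄} g^{aq̄} g^{jd̄} g^{ck̄} R_{pq̄jk̄} \overline{R_{bādc̄}}`. -/
def riemSq {n : ℕ} (G : Cn n → Matrix (Fin n) (Fin n) ℂ) (z : Cn n) : ℂ :=
  ∑ p, ∑ q, ∑ j, ∑ k, ∑ a, ∑ b, ∑ c, ∑ d,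
    gInv G z p b * gInv G z a q * gInv G z j d * gInv G z c k *
      riem G z p q j k * (starRingEnd ℂ) (riem G z b a d c)

/-- `|R|² - 4|Ric|² + 3S²`. -/
def quadCurv {n : ℕ} (G : Cn n → Matrix (Fin n) (Fin n) ℂ) (z : Cn n) : ℂ :=
  riemSq G z - 4 * ricSq G z + 3 * scal G z ^ 2

/-- The Bergman kernel coefficient `a₂ = ΔS/3 + (|R|² - 4|Ric|² + 3S²)/24`. -/
def a2 {n : ℕ} (G : Cn n → Matrix (Fin n) (Fin n) ℂ) (z : Cn n) : ℂ :=
  (1 / 3) * lap G (scal G) z + (1 / 24) * quadCurv G z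

/-- The contraction
`g^{iq̄} g^{pj̄} g^{rl̄} g^{ks̄} R_{pq̄rs̄} ∂_i∂_j̄ψ ∂_k∂_l̄ψ`. -/
def riemHessHess {n : ℕ} (G : Cn n → Matrix (Fin n) (Fin n) ℂ) (ψ : Cn n → ℂ) (z : Cn n) : ℂ :=
  ∑ i, ∑ j, ∑ k, ∑ l, ∑ p, ∑ q, ∑ r, ∑ s,
    gInv G z i q * gInv G z p j * gInv G z r l * gInv G z k s *
      riem G z p q r s * hess ψ z i j * hess ψ z k l

/-- The Chern-Weil form `Φ(R, R)` of a symmetric bilinear invariant function `Φ`. -/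
def chernWeil {n : ℕ} (Φ : Matrix (Fin n) (Fin n) ℂ → Matrix (Fin n) (Fin n) ℂ → ℂ)
    (G : Cn n → Matrix (Fin n) (Fin n) ℂ) (z : Cn n) : Form n :=
  ∑ j, ∑ k, ∑ r, ∑ s, Φ (curv G z j k) (curv G z r s) • (dz j * dzb k * dz r * dzb s)

/-- The Bott-Chern form `BC(Φ; h₁, h₀) = ∫₀¹ Φ'(R(h_s); ḣ_s h_s⁻¹) ds`, where
`Φ'(A; B) = Φ(B, A) + Φ(A, B)`, along the path of Hermitian metrics `h_s = (1-s) h₀ + s h₁`. -/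
def bottChern {n : ℕ} (Φ : Matrix (Fin n) (Fin n) ℂ → Matrix (Fin n) (Fin n) ℂ → ℂ)
    (G₁ G₀ : Cn n → Matrix (Fin n) (Fin n) ℂ) (z : Cn n) : Form n :=
  form11 (Matrix.of fun j k =>
    ∫ s in (0 : ℝ)..1,
      (Φ ((G₁ z - G₀ z) * ((1 - s) • G₀ z + s • G₁ z)⁻¹)
          (curv (fun w => (1 - s) • G₀ w + s • G₁ w) z j k) +
        Φ (curv (fun w => (1 - s) • G₀ w + s • G₁ w) z j k)
          ((G₁ z - G₀ z) * ((1 - s) • G₀ z + s • G₁ z)⁻¹)))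

/-! ### Complex manifolds and integration -/

/-- The real smooth manifold underlying a complex manifold. -/
theorem isManifold_real {n : ℕ} (M : Type*) [TopologicalSpace M] [ChartedSpace (Cn n) M]
    [IsManifold 𝓘(ℂ, Cn n) ω M] : IsManifold 𝓘(ℝ, Cn n) ∞ M := by
  apply isManifold_of_contDiffOn
  intro e e' he he'
  have h0 := StructureGroupoid.compatible (contDiffGroupoid ω 𝓘(ℂ, Cn n)) he he'
  rw [contDiffGroupoid, mem_groupoid_of_pregroupoid] at h0
  have h : ContDiffOn ℂ ω (𝓘(ℂ, Cn n) ∘ (e.symm.trans e') ∘ 𝓘(ℂ, Cn n).symm)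
      (𝓘(ℂ, Cn n).symm ⁻¹' (e.symm.trans e').source ∩ Set.range 𝓘(ℂ, Cn n)) := h0.1
  exact (h.restrict_scalars ℝ).of_le le_top

/-- A smooth partition of unity `(ρ_x)` indexed by the points `x` of a compact complex manifold,
with `ρ_x` supported in the domain of the preferred chart at `x`. -/
def pou (n : ℕ) (M : Type*) [TopologicalSpace M] [ChartedSpace (Cn n) M]
    [IsManifold 𝓘(ℂ, Cn n) ω M] [CompactSpace M] [T2Space M] :
    SmoothPartitionOfUnity M 𝓘(ℝ, Cn n) M Set.univ :=
  haveI := isManifold_real (n := n) M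
  (SmoothPartitionOfUnity.exists_isSubordinate_chartAt_source 𝓘(ℝ, Cn n) M).choose

/-- The integral over `M` (with its complex orientation) of a differential form, given by its
expression `η e` in each chart `e`. -/
def integral {n : ℕ} {M : Type*} [TopologicalSpace M] [ChartedSpace (Cn n) M]
    [IsManifold 𝓘(ℂ, Cn n) ω M] [CompactSpace M] [T2Space M]
    (η : OpenPartialHomeomorph M (Cn n) → Cn n → Form n) : ℂ :=
  ∑ᶠ x : M, ∫ z in (chartAt (Cn n) x).target,
    ((pou n M x ((chartAt (Cn n) x).symm z) : ℝ) : ℂ) * topDensity (η (chartAt (Cn n) x) z)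

/-- The expression of a real function on `M` in a chart. -/
def read {n : ℕ} {M : Type*} [TopologicalSpace M]
    (f : M → ℝ) (e : OpenPartialHomeomorph M (Cn n)) (z : Cn n) : ℂ :=
  ((f (e.symm z) : ℝ) : ℂ)

/-- The coordinate vector field `∂/∂z^j` of the chart `e`, at the point with coordinate `z`. -/
def coordVec {n : ℕ} {M : Type*} [TopologicalSpace M] [ChartedSpace (Cn n) M]
    (e : OpenPartialHomeomorph M (Cn n)) (z : Cn n) (j : Fin n) :
    TangentSpace 𝓘(ℂ, Cn n) (e.symm z) :=
  mfderiv 𝓘(ℂ, Cn n) 𝓘(ℂ, Cn n) e.symm z (Pi.single j 1 : Cn n)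

/-- A Kähler metric: a smooth positive definite Hermitian form on the holomorphic tangent bundle
whose fundamental form `ω = i g_{jk̄} dz^j ∧ dz̄^k` is closed. -/
structure Metric (n : ℕ) (M : Type*) [TopologicalSpace M] [ChartedSpace (Cn n) M] where
  /-- the Hermitian form, linear in the first and conjugate-linear in the second argument -/
  herm : ∀ p : M, TangentSpace 𝓘(ℂ, Cn n) p →ₗ[ℂ]
    TangentSpace 𝓘(ℂ, Cn n) p →ₛₗ[starRingEnd ℂ] ℂ
  symm : ∀ (p : M) (v w : TangentSpace 𝓘(ℂ, Cn n) p),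
    herm p v w = (starRingEnd ℂ) (herm p w v)
  pos : ∀ (p : M) (v : TangentSpace 𝓘(ℂ, Cn n) p), v ≠ 0 → 0 < (herm p v v).re
  smooth : ∀ e ∈ atlas (Cn n) M, ∀ j k : Fin n,
    ContDiffOn ℝ ∞ (fun z => herm (e.symm z) (coordVec e z j) (coordVec e z k)) e.target
  closed : ∀ e ∈ atlas (Cn n) M, ∀ z ∈ e.target, ∀ i j k : Fin n,
    pz i (fun w => herm (e.symm w) (coordVec e w j) (coordVec e w k)) z =
      pz j (fun w => herm (e.symm w) (coordVec e w i) (coordVec e w k)) z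

/-- The matrix `(g_{jk̄})` of the metric in the chart `e`. -/
def Metric.mat {n : ℕ} {M : Type*} [TopologicalSpace M] [ChartedSpace (Cn n) M]
    (g : Metric n M) (e : OpenPartialHomeomorph M (Cn n)) (z : Cn n) : Matrix (Fin n) (Fin n) ℂ :=
  Matrix.of fun j k => g.herm (e.symm z) (coordVec e z j) (coordVec e z k)

/-- The matrix of `ω_φ = ω + i∂∂̄φ` in the chart `e`. -/
def Metric.matPot {n : ℕ} {M : Type*} [TopologicalSpace M] [ChartedSpace (Cn n) M]
    (g : Metric n M) (φ : M → ℝ) (e : OpenPartialHomeomorph M (Cn n)) (z : Cn n) :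
    Matrix (Fin n) (Fin n) ℂ :=
  g.mat e z + hess (read φ e) z

/-- `φ` is a Kähler potential: `φ` is smooth and `ω + i∂∂̄φ > 0`. -/
def Metric.IsPotential {n : ℕ} {M : Type*} [TopologicalSpace M] [ChartedSpace (Cn n) M]
    (g : Metric n M) (φ : M → ℝ) : Prop :=
  ContMDiff 𝓘(ℝ, Cn n) 𝓘(ℝ, ℝ) ∞ φ ∧
    ∀ e ∈ atlas (Cn n) M, ∀ z ∈ e.target, (g.matPot φ e z).PosDef

/-- The volume `V = ∫_M ω^n/n!`. -/
def Metric.vol {n : ℕ} {M : Type*} [TopologicalSpace M] [ChartedSpace (Cn n) M]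
    [IsManifold 𝓘(ℂ, Cn n) ω M] [CompactSpace M] [T2Space M] (g : Metric n M) : ℂ :=
  integral (M := M) fun e z => powFact (omega (g.mat e) z) 0

/-- The average of `a₂`: `(1/V) ∫_M a₂ ω^n/n!`. -/
def Metric.a2Avg {n : ℕ} {M : Type*} [TopologicalSpace M] [ChartedSpace (Cn n) M]
    [IsManifold 𝓘(ℂ, Cn n) ω M] [CompactSpace M] [T2Space M] (g : Metric n M) : ℂ :=
  (1 / g.vol) * integral (M := M) fun e z => a2 (g.mat e) z • powFact (omega (g.mat e) z) 0

/-- The generalized Liouville action `S₂[ω_φ, ω]`: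
`-i ∫ ( BC(Td₂; ω_φ, ω) ∧ ω^{n-1}/(n-1)!
        + Td₂(R_φ) ∧ (-i)/(n-1)! ∑_{s=0}^{n-2} φ ω_φ^s ∧ ω^{n-2-s} )
 + (i/V) (∫ Td₂(R) ∧ ω^{n-2}/(n-2)!) ∫ (-i)/(n+1)! ∑_{s=0}^{n} φ ω_φ^s ∧ ω^{n-s}`. -/
def Metric.liouville {n : ℕ} {M : Type*} [TopologicalSpace M] [ChartedSpace (Cn n) M]
    [IsManifold 𝓘(ℂ, Cn n) ω M] [CompactSpace M] [T2Space M] (g : Metric n M) (φ : M → ℝ) : ℂ :=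
  -Complex.I * integral (M := M) (fun e z =>
      bottChern td2Polar (g.matPot φ e) (g.mat e) z * powFact (omega (g.mat e) z) 1 +
      chernWeil td2Polar (g.matPot φ e) z *
        ((-Complex.I / (Nat.factorial (n - 1) : ℂ)) • ∑ s ∈ Finset.range (n - 1),
          read φ e z • (omega (g.matPot φ e) z ^ s * omega (g.mat e) z ^ (n - 2 - s)))) +
  (Complex.I / g.vol) *
    integral (M := M) (fun e z =>
      chernWeil td2Polar (g.mat e) z * powFact (omega (g.mat e) z) 2) *
    integral (M := M) (fun e z =>
      (-Complex.I / (Nat.factorial (n + 1) : ℂ)) • ∑ s ∈ Finset.range (n + 1),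
        read φ e z • (omega (g.matPot φ e) z ^ s * omega (g.mat e) z ^ (n - s)))

end Kahler

end

open scoped ContDiff Manifold Topology ComplexOrder
noncomputable section
namespace Kahler
variable {n : ℕ}

/-! ### Wirtinger derivatives -/

/-! The action is differentiated twice directly at the base metric; no first variation formula at a
general time is needed. Every integrand of S₂ carries a factor that vanishes at t = 0: the potential
φ_t itself, or, in the Bott–Chern form, the difference of the two metrics, which is the complex
Hessian of φ_t. If p(0) = 0 then (pQ)'' = p''Q + 2p'Q' at 0, so only first derivatives of the
curvature, of the inverse metric and of the mixed powers of ω_t enter. Along the segment g + s∂∂̄φ_t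
the second t-derivative of the Bott–Chern integrand is affine in s, and the s-integral halves its
slope. This is `HasSecondDeriv.mul`, `HasDerivF.geomPow`, `PotPath.hasSecondDeriv_bcEntry` and
`Metric.hasSecondDeriv_liouville`.

There remains an identity between integrals at one fixed metric. Write u, f for the first and second
derivatives of the potential and v = (∂∂̄u)g⁻¹. By `td2_eq`, Td₂(A) = -(tr A)²/8 + tr(A²)/24.
Products of (1,1)-forms with ω^m/m! are evaluated by differentiating the determinant (`topL_one`,
`topL_two`, `topL_three`). The Kähler symmetries identify g^{jk̄}R_{jk̄} with the Ricci endomorphism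
(`sum_inv_curv`). Differentiating this identity along a line of Kähler metrics gives the contracted
variation R' of the curvature (`sum_inv_dcurv`), and tr R' = -∂∂̄Δu (`trace_dcurv`). Moreover Td₂(R)
∧ ω^{n-2}/(n-2)! is a₂ - ΔS/3 times the volume form, so its integral equals that of a₂
(`integral_td2_eq`).

The computed and the desired integrand differ by a combination of ten forms of integral zero
(`exists_null_ddAction`). Nine come from Stokes' theorem for F ∂̄h ∧ Θ and h ∂F ∧ Θ with Θ closed.
The other one concerns u Tr(R' ∧ R). Here R' is -∂̄ of the covariant derivative Dv, and ∂ Tr(vR) =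
Tr(Dv ∧ R) by the Bianchi identity, so two integrations by parts trade this form for -∂∂̄u ∧ Tr(vR)
(`Metric.Regular.integral_dcurv_curv`).

Forms on M are families of coordinate expressions. Stokes' theorem (`integral_eq_zero_of_div`) is
proved with a partition of unity and the change of variables formula, and for this every primitive
that is used must transform correctly between charts. -/

/-- The unit `i` or `-i`, distinguishing `∂` from `∂̄`. -/
def wsign : Fin 2 → ℂ := ![Complex.I, -Complex.I]

/-- The Wirtinger derivative, `∂/∂z^j` for `τ = 0` and `∂/∂z̄^j` for `τ = 1`. -/
def wd (τ : Fin 2) (j : Fin n) (f : Cn n → ℂ) (z : Cn n) : ℂ :=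
  (1 / 2) * (fderiv ℝ f z (Pi.single j 1) - wsign τ * fderiv ℝ f z (Pi.single j Complex.I))

theorem pzb_eq_wd (j : Fin n) (f : Cn n → ℂ) (z : Cn n) : pzb j f z = wd 1 j f z := by
  simp [pzb, wd, wsign]

section Algebra

variable {τ : Fin 2} {j : Fin n} {f g : Cn n → ℂ} {z : Cn n}

theorem wd_congr (h : f =ᶠ[𝓝 z] g) : wd τ j f z = wd τ j g z := by
  rw [wd, wd, h.fderiv_eq]

theorem wd_congr_on {U : Set (Cn n)} (hU : IsOpen U) (hz : z ∈ U) (h : ∀ w ∈ U, f w = g w) :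
    wd τ j f z = wd τ j g z :=
  wd_congr (Filter.eventually_of_mem (hU.mem_nhds hz) h)

@[simp] theorem wd_const (c : ℂ) : wd τ j (fun _ => c) z = 0 := by
  simp [wd]

theorem wd_add (hf : DifferentiableAt ℝ f z) (hg : DifferentiableAt ℝ g z) :
    wd τ j (fun w => f w + g w) z = wd τ j f z + wd τ j g z := by
  have : fderiv ℝ (fun w => f w + g w) z = fderiv ℝ f z + fderiv ℝ g z := fderiv_fun_add hf hg
  simp only [wd, this, add_apply]; ring

theorem wd_neg : wd τ j (fun w => -f w) z = -wd τ j f z := by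
  have : fderiv ℝ (fun w => -f w) z = -fderiv ℝ f z := fderiv_fun_neg
  simp only [wd, this, neg_apply]; ring

theorem wd_mul (hf : DifferentiableAt ℝ f z) (hg : DifferentiableAt ℝ g z) :
    wd τ j (fun w => f w * g w) z = wd τ j f z * g z + f z * wd τ j g z := by
  have : fderiv ℝ (fun w => f w * g w) z = f z • fderiv ℝ g z + g z • fderiv ℝ f z :=
    fderiv_fun_mul hf hg
  simp only [wd, this, add_apply, smul_apply, smul_eq_mul]
  ring

theorem wd_const_mul (c : ℂ) (hf : DifferentiableAt ℝ f z) :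
    wd τ j (fun w => c * f w) z = c * wd τ j f z := by
  rw [wd_mul (differentiableAt_const c) hf]; simp

theorem wd_mul_const (c : ℂ) (hf : DifferentiableAt ℝ f z) :
    wd τ j (fun w => f w * c) z = wd τ j f z * c := by
  rw [wd_mul hf (differentiableAt_const c)]; simp

theorem wd_sum {ι : Type*} (s : Finset ι) {f : ι → Cn n → ℂ}
    (hf : ∀ i ∈ s, DifferentiableAt ℝ (f i) z) :
    wd τ j (fun w => ∑ i ∈ s, f i w) z = ∑ i ∈ s, wd τ j (f i) z := by
  have : fderiv ℝ (fun w => ∑ i ∈ s, f i w) z = ∑ i ∈ s, fderiv ℝ (f i) z := fderiv_fun_sum hf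
  simp only [wd, this, sum_apply, Finset.mul_sum, ← Finset.sum_sub_distrib]

end Algebra

/-! ### Wirtinger derivatives of functions depending on parameters. -/

section Smooth

variable {P : Type*} [NormedAddCommGroup P] [NormedSpace ℝ P]

theorem fderiv_slice {Ω : Set (P × Cn n)} (hΩ : IsOpen Ω) {f : P × Cn n → ℂ}
    (hf : ContDiffOn ℝ ∞ f Ω) {q : P × Cn n} (hq : q ∈ Ω) (v : Cn n) :
    fderiv ℝ (fun w => f (q.1, w)) q.2 v = fderiv ℝ f q (0, v) := by
  have h1 : HasFDerivAt f (fderiv ℝ f q) (q.1, q.2) :=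
    ((hf.contDiffAt (hΩ.mem_nhds hq)).differentiableAt (by simp)).hasFDerivAt
  have h2 : HasFDerivAt (fun w : Cn n => (q.1, w)) (ContinuousLinearMap.inr ℝ P (Cn n)) q.2 :=
    hasFDerivAt_prodMk_right q.1 q.2
  have h3 : HasFDerivAt (fun w : Cn n => f (q.1, w))
      ((fderiv ℝ f q).comp (ContinuousLinearMap.inr ℝ P (Cn n))) q.2 := h1.comp q.2 h2
  rw [h3.fderiv]; rfl

theorem contDiffOn_fderiv_apply {X : Type*} [NormedAddCommGroup X] [NormedSpace ℝ X] {Ω : Set X}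
    (hΩ : IsOpen Ω) {f : X → ℂ} (hf : ContDiffOn ℝ ∞ f Ω) (v : X) :
    ContDiffOn ℝ ∞ (fun q => fderiv ℝ f q v) Ω :=
  (hf.fderiv_of_isOpen hΩ (by simp)).clm_apply contDiffOn_const

/-- A derivative of a slice is the full derivative in a direction (0, v), so it stays jointly
smooth. The parameter space P is the time line, or the plane of time and segment parameter. -/
theorem contDiffOn_wd_slice {Ω : Set (P × Cn n)} (hΩ : IsOpen Ω) {f : P × Cn n → ℂ}
    (hf : ContDiffOn ℝ ∞ f Ω) (τ : Fin 2) (j : Fin n) :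
    ContDiffOn ℝ ∞ (fun q : P × Cn n => wd τ j (fun w => f (q.1, w)) q.2) Ω := by
  have h : ContDiffOn ℝ ∞ (fun q : P × Cn n => (1 / 2) * (fderiv ℝ f q (0, Pi.single j 1) -
      wsign τ * fderiv ℝ f q (0, Pi.single j Complex.I))) Ω :=
    contDiffOn_const.mul ((contDiffOn_fderiv_apply hΩ hf _).sub
      (contDiffOn_const.mul (contDiffOn_fderiv_apply hΩ hf _)))
  refine h.congr fun q hq => ?_
  rw [wd, fderiv_slice hΩ hf hq, fderiv_slice hΩ hf hq]

theorem contDiffOn_wd {U : Set (Cn n)} (hU : IsOpen U) {f : Cn n → ℂ} (hf : ContDiffOn ℝ ∞ f U)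
    (τ : Fin 2) (j : Fin n) : ContDiffOn ℝ ∞ (wd τ j f) U :=
  contDiffOn_const.mul ((contDiffOn_fderiv_apply hU hf _).sub
      (contDiffOn_const.mul (contDiffOn_fderiv_apply hU hf _)))

theorem fderiv_fderiv_apply {X : Type*} [NormedAddCommGroup X] [NormedSpace ℝ X] {Ω : Set X}
    (hΩ : IsOpen Ω) {f : X → ℂ} (hf : ContDiffOn ℝ ∞ f Ω) {q : X} (hq : q ∈ Ω) (u v : X) :
    HasFDerivAt (fun y => fderiv ℝ f y v) ((fderiv ℝ (fderiv ℝ f) q).flip v) q ∧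
      fderiv ℝ (fderiv ℝ f) q u v = fderiv ℝ (fderiv ℝ f) q v u := by
  have h1 : DifferentiableAt ℝ (fderiv ℝ f) q :=
    ((hf.fderiv_of_isOpen (m := ∞) hΩ (by simp)).contDiffAt (hΩ.mem_nhds hq)).differentiableAt
      (by simp)
  refine ⟨?_, ?_⟩
  · have := h1.hasFDerivAt.clm_apply (hasFDerivAt_const v q)
    simpa using this
  · have h2 : IsSymmSndFDerivAt ℝ f q :=
      (hf.contDiffAt (hΩ.mem_nhds hq)).isSymmSndFDerivAt (by simpa using (mod_cast le_top : ((2 : ℕ∞) : WithTop ℕ∞) ≤ ∞))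
    exact h2 u v

theorem wd_comm {U : Set (Cn n)} (hU : IsOpen U) {f : Cn n → ℂ} (hf : ContDiffOn ℝ ∞ f U)
    {z : Cn n} (hz : z ∈ U) (τ τ' : Fin 2) (j k : Fin n) :
    wd τ j (wd τ' k f) z = wd τ' k (wd τ j f) z := by
  have key : ∀ (τ : Fin 2) (j : Fin n) (u : Cn n), fderiv ℝ (wd τ j f) z u =
      (1 / 2) * (fderiv ℝ (fderiv ℝ f) z u (Pi.single j 1) -
        wsign τ * fderiv ℝ (fderiv ℝ f) z u (Pi.single j Complex.I)) := by
    intro τ j u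
    have h := (((fderiv_fderiv_apply hU hf hz 0 (Pi.single j 1)).1).sub
      (((fderiv_fderiv_apply hU hf hz 0 (Pi.single j Complex.I)).1).const_mul (wsign τ))).const_mul
        (1 / 2 : ℂ)
    have : wd τ j f = fun y => (1 / 2 : ℂ) * (fderiv ℝ f y (Pi.single j 1) -
      wsign τ * fderiv ℝ f y (Pi.single j Complex.I)) := rfl
    rw [this]
    erw [h.fderiv]
    simp
  have sy := fun u v => (fderiv_fderiv_apply hU hf hz u v).2
  rw [wd, key, key, wd, key, key, sy (Pi.single j 1) (Pi.single k 1),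
    sy (Pi.single j 1) (Pi.single k Complex.I), sy (Pi.single j Complex.I) (Pi.single k 1),
    sy (Pi.single j Complex.I) (Pi.single k Complex.I)]
  ring

/-- Both orders of differentiation are values of the symmetric second derivative on the pair (1, 0),
(0, v). -/
theorem hasDerivAt_wd_slice {Ω : Set (ℝ × Cn n)} (hΩ : IsOpen Ω) {f : ℝ × Cn n → ℂ}
    (hf : ContDiffOn ℝ ∞ f Ω) {t : ℝ} {z : Cn n} (hq : (t, z) ∈ Ω) (τ : Fin 2) (j : Fin n) :
    HasDerivAt (fun s => wd τ j (fun w => f (s, w)) z)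
      (wd τ j (fun w => deriv (fun s => f (s, w)) t) z) t := by
  have hslice : ∀ q ∈ Ω, deriv (fun s => f (s, q.2)) q.1 = fderiv ℝ f q (1, 0) := by
    intro q hq
    have h1 : HasFDerivAt f (fderiv ℝ f q) (q.1, q.2) :=
      ((hf.contDiffAt (hΩ.mem_nhds hq)).differentiableAt (by simp)).hasFDerivAt
    have h2 : HasDerivAt (fun s : ℝ => (s, q.2)) (1, 0) q.1 :=
      (hasDerivAt_id q.1).prodMk (hasDerivAt_const q.1 q.2)
    exact (h1.comp_hasDerivAt q.1 h2).deriv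
  have ht : ∀ᶠ s in 𝓝 t, (s, z) ∈ Ω :=
    (Continuous.prodMk_left z).continuousAt.preimage_mem_nhds (hΩ.mem_nhds hq)
  have hz : ∀ᶠ w in 𝓝 z, (t, w) ∈ Ω :=
    (Continuous.prodMk_right t).continuousAt.preimage_mem_nhds (hΩ.mem_nhds hq)
  have h2 : HasDerivAt (fun s : ℝ => (s, z)) (1, 0) t :=
    (hasDerivAt_id t).prodMk (hasDerivAt_const t z)
  have h3 : HasFDerivAt (fun w : Cn n => (t, w)) (ContinuousLinearMap.inr ℝ ℝ (Cn n)) z :=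
    hasFDerivAt_prodMk_right t z
  have key : ∀ v : Cn n, HasDerivAt (fun s => fderiv ℝ (fun w => f (s, w)) z v)
      (fderiv ℝ (fun w => deriv (fun s => f (s, w)) t) z v) t := by
    intro v
    have hd := ((fderiv_fderiv_apply hΩ hf hq 0 (0, v)).1).comp_hasDerivAt t h2
    have e1 : (fun s => fderiv ℝ (fun w => f (s, w)) z v) =ᶠ[𝓝 t]
        ((fun y => fderiv ℝ f y (0, v)) ∘ fun s : ℝ => (s, z)) := by
      filter_upwards [ht] with s hs
      exact fderiv_slice hΩ hf hs v
    have e2 : (fun w => deriv (fun s => f (s, w)) t) =ᶠ[𝓝 z]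
        ((fun y => fderiv ℝ f y (1, 0)) ∘ fun w : Cn n => (t, w)) := by
      filter_upwards [hz] with w hw
      exact hslice _ hw
    have hd2 := (((fderiv_fderiv_apply hΩ hf hq 0 (1, 0)).1).comp z h3)
    refine (hd.congr_of_eventuallyEq e1).congr_deriv ?_
    rw [e2.fderiv_eq, hd2.fderiv]
    exact (fderiv_fderiv_apply hΩ hf hq (1, 0) (0, v)).2
  exact ((key _).sub ((key _).const_mul _)).const_mul _

end Smooth

/-! ### Calculus of matrix-valued functions -/

/-- Smoothness of all entries of a matrix-valued function. -/
def SmM {X : Type*} [NormedAddCommGroup X] [NormedSpace ℝ X]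
    (A : X → Matrix (Fin n) (Fin n) ℂ) (Ω : Set X) : Prop :=
  ∀ p q, ContDiffOn ℝ ∞ (fun x => A x p q) Ω

/-- Differentiability of all entries of a matrix-valued function. -/
def DiffM (A : Cn n → Matrix (Fin n) (Fin n) ℂ) (z : Cn n) : Prop :=
  ∀ p q, DifferentiableAt ℝ (fun x => A x p q) z

/-- The entrywise derivative of a matrix-valued function of a real variable. -/
def HasDerivM (A : ℝ → Matrix (Fin n) (Fin n) ℂ) (A' : Matrix (Fin n) (Fin n) ℂ) (t : ℝ) : Prop :=
  ∀ p q, HasDerivAt (fun s => A s p q) (A' p q) t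

/-- The entrywise Wirtinger derivative. -/
def wdM (τ : Fin 2) (j : Fin n) (A : Cn n → Matrix (Fin n) (Fin n) ℂ) (z : Cn n) :
    Matrix (Fin n) (Fin n) ℂ :=
  Matrix.of fun p q => wd τ j (fun w => A w p q) z

@[simp] theorem wdM_apply (τ : Fin 2) (j : Fin n) (A : Cn n → Matrix (Fin n) (Fin n) ℂ) (z : Cn n)
    (p q : Fin n) : wdM τ j A z p q = wd τ j (fun w => A w p q) z := rfl

namespace SmM

variable {X : Type*} [NormedAddCommGroup X] [NormedSpace ℝ X] {Ω : Set X}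
  {A B : X → Matrix (Fin n) (Fin n) ℂ}

theorem congr (hA : SmM A Ω) (h : ∀ x ∈ Ω, B x = A x) : SmM B Ω :=
  fun p q => (hA p q).congr fun x hx => by rw [h x hx]

theorem mono (hA : SmM A Ω) {Ω' : Set X} (h : Ω' ⊆ Ω) : SmM A Ω' := fun p q => (hA p q).mono h

theorem add (hA : SmM A Ω) (hB : SmM B Ω) : SmM (fun x => A x + B x) Ω :=
  fun p q => (hA p q).add (hB p q)

theorem sub (hA : SmM A Ω) (hB : SmM B Ω) : SmM (fun x => A x - B x) Ω :=
  fun p q => (hA p q).sub (hB p q)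

theorem neg (hA : SmM A Ω) : SmM (fun x => -A x) Ω := fun p q => (hA p q).neg

theorem smul (hA : SmM A Ω) {f : X → ℂ} (hf : ContDiffOn ℝ ∞ f Ω) :
    SmM (fun x => f x • A x) Ω := fun p q => hf.mul (hA p q)

theorem mul (hA : SmM A Ω) (hB : SmM B Ω) : SmM (fun x => A x * B x) Ω := fun p q => by
  simp only [Matrix.mul_apply]
  exact ContDiffOn.sum fun s _ => (hA p s).mul (hB s q)

theorem trace (hA : SmM A Ω) : ContDiffOn ℝ ∞ (fun x => (A x).trace) Ω :=
  ContDiffOn.sum fun s _ => hA s s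

theorem det (hA : SmM A Ω) : ContDiffOn ℝ ∞ (fun x => (A x).det) Ω := by
  simp only [Matrix.det_apply']
  exact ContDiffOn.sum fun s _ => contDiffOn_const.mul (contDiffOn_prod fun i _ => hA _ _)

theorem inv (hA : SmM A Ω) (h : ∀ x ∈ Ω, IsUnit (A x).det) : SmM (fun x => (A x)⁻¹) Ω := by
  intro p q
  simp only [Matrix.inv_def, Ring.inverse_eq_inv', Matrix.smul_apply, smul_eq_mul,
    Matrix.adjugate_apply]
  refine (hA.det.inv fun x hx => (h x hx).ne_zero).mul (SmM.det fun i j => ?_)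
  by_cases hi : i = q
  · simp only [Matrix.updateRow_apply, hi, if_true]; exact contDiffOn_const
  · simp only [Matrix.updateRow_apply, hi, if_false]; exact hA i j

theorem diff {U : Set (Cn n)} (hU : IsOpen U) {A : Cn n → Matrix (Fin n) (Fin n) ℂ}
    (hA : SmM A U) {z : Cn n} (hz : z ∈ U) : DiffM A z :=
  fun p q => ((hA p q).contDiffAt (hU.mem_nhds hz)).differentiableAt (by simp)

theorem wdM {U : Set (Cn n)} (hU : IsOpen U) {A : Cn n → Matrix (Fin n) (Fin n) ℂ}
    (hA : SmM A U) (τ : Fin 2) (j : Fin n) : SmM (wdM τ j A) U :=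
  fun p q => contDiffOn_wd hU (hA p q) τ j

theorem wdM_slice {P : Type*} [NormedAddCommGroup P] [NormedSpace ℝ P] {Ω : Set (P × Cn n)}
    (hΩ : IsOpen Ω) {A : P × Cn n → Matrix (Fin n) (Fin n) ℂ} (hA : SmM A Ω)
    (τ : Fin 2) (j : Fin n) :
    SmM (fun q : P × Cn n => Kahler.wdM τ j (fun w => A (q.1, w)) q.2) Ω :=
  fun p q => contDiffOn_wd_slice hΩ (hA p q) τ j

end SmM

section wdM

variable {τ : Fin 2} {j : Fin n} {A B : Cn n → Matrix (Fin n) (Fin n) ℂ} {z : Cn n}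

theorem wdM_congr_on {U : Set (Cn n)} (hU : IsOpen U) (hz : z ∈ U) (h : ∀ w ∈ U, A w = B w) :
    wdM τ j A z = wdM τ j B z := by
  ext p q
  exact wd_congr_on hU hz fun w hw => by rw [h w hw]

theorem wdM_add (hA : DiffM A z) (hB : DiffM B z) :
    wdM τ j (fun w => A w + B w) z = wdM τ j A z + wdM τ j B z := by
  ext p q; exact wd_add (hA p q) (hB p q)

theorem wdM_neg : wdM τ j (fun w => -A w) z = -wdM τ j A z := by
  ext p q; exact wd_neg

theorem DiffM.mul (hA : DiffM A z) (hB : DiffM B z) : DiffM (fun w => A w * B w) z := fun p q => by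
  simp only [Matrix.mul_apply]
  exact DifferentiableAt.fun_sum fun s _ => (hA p s).mul (hB s q)

theorem wdM_mul (hA : DiffM A z) (hB : DiffM B z) :
    wdM τ j (fun w => A w * B w) z = wdM τ j A z * B z + A z * wdM τ j B z := by
  ext p q
  simp only [wdM_apply, Matrix.mul_apply, Matrix.add_apply]
  refine (wd_sum (f := fun s w => A w p s * B w s q) _ fun s _ => (hA p s).mul (hB s q)).trans ?_
  rw [← Finset.sum_add_distrib]
  exact Finset.sum_congr rfl fun s _ => wd_mul (hA p s) (hB s q)

theorem wd_trace (hA : DiffM A z) :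
    wd τ j (fun w => (A w).trace) z = (wdM τ j A z).trace := by
  simp only [Matrix.trace, Matrix.diag]
  rw [wd_sum _ fun s _ => hA s s]; rfl

theorem wdM_inv {U : Set (Cn n)} (hU : IsOpen U) (hA : SmM A U) (h : ∀ x ∈ U, IsUnit (A x).det)
    (hz : z ∈ U) : wdM τ j (fun w => (A w)⁻¹) z = -((A z)⁻¹ * wdM τ j A z * (A z)⁻¹) := by
  have h1 : wdM τ j (fun w => A w * (A w)⁻¹) z = 0 := by
    rw [wdM_congr_on (B := fun _ => 1) hU hz fun w hw => Matrix.mul_nonsing_inv _ (h w hw)]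
    ext p q; exact wd_const _
  rw [wdM_mul (hA.diff hU hz) ((hA.inv h).diff hU hz)] at h1
  have h2 := congrArg (fun M => (A z)⁻¹ * M) (eq_neg_of_add_eq_zero_right h1)
  rw [Matrix.nonsing_inv_mul_cancel_left _ _ (h z hz)] at h2
  rw [h2, Matrix.mul_neg, Matrix.mul_assoc]

theorem wdM_comm {U : Set (Cn n)} (hU : IsOpen U) (hA : SmM A U) (hz : z ∈ U) (τ τ' : Fin 2)
    (j k : Fin n) : wdM τ j (wdM τ' k A) z = wdM τ' k (wdM τ j A) z := by
  ext p q; exact wd_comm hU (hA p q) hz τ τ' j k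

end wdM

namespace HasDerivM

variable {A B : ℝ → Matrix (Fin n) (Fin n) ℂ} {A' B' : Matrix (Fin n) (Fin n) ℂ} {t : ℝ}

theorem const (C : Matrix (Fin n) (Fin n) ℂ) : HasDerivM (fun _ => C) 0 t :=
  fun _ _ => hasDerivAt_const _ _

theorem add (hA : HasDerivM A A' t) (hB : HasDerivM B B' t) :
    HasDerivM (fun s => A s + B s) (A' + B') t := fun p q => (hA p q).add (hB p q)

theorem mul (hA : HasDerivM A A' t) (hB : HasDerivM B B' t) :
    HasDerivM (fun s => A s * B s) (A' * B t + A t * B') t := fun p q => by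
  simp only [Matrix.mul_apply, Matrix.add_apply, ← Finset.sum_add_distrib]
  exact HasDerivAt.fun_sum fun i _ => (hA p i).mul (hB i q)

theorem trace (hA : HasDerivM A A' t) : HasDerivAt (fun s => (A s).trace) A'.trace t :=
  HasDerivAt.fun_sum fun i _ => hA i i

theorem const_smul (c : ℂ) (hA : HasDerivM A A' t) : HasDerivM (fun s => c • A s) (c • A') t :=
  fun p q => (hA p q).const_mul c

theorem congr (hA : HasDerivM A A' t) (h : B =ᶠ[𝓝 t] A) : HasDerivM B A' t :=
  fun p q => (hA p q).congr_of_eventuallyEq (h.mono fun x hx => by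
    show B x p q = A x p q; rw [hx])

theorem isUnit_eventually (hA : HasDerivM A A' t) (h : IsUnit (A t).det) :
    ∀ᶠ s in 𝓝 t, IsUnit (A s).det := by
  have : ContinuousAt A t := continuousAt_pi.2 fun p => continuousAt_pi.2 fun q =>
    (hA p q).continuousAt
  have h2 : ContinuousAt (fun s => (A s).det) t := Continuous.matrix_det continuous_id |>.continuousAt.comp this
  filter_upwards [h2.eventually_ne h.ne_zero] with s hs using isUnit_iff_ne_zero.2 hs

/-- Cramer's rule (`SmM.inv`) gives differentiability of the inverse; its derivative is then forced
by differentiating A A⁻¹ = 1. -/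
theorem inv (hA : HasDerivM A A' t) (h : IsUnit (A t).det) :
    HasDerivM (fun s => (A s)⁻¹) (-((A t)⁻¹ * A' * (A t)⁻¹)) t := by
  let Ω : Set (Fin n → Fin n → ℂ) := {M | IsUnit (Matrix.of M).det}
  have hΩ : IsOpen Ω := by
    have : Ω = {M | (Matrix.of M).det ≠ 0} := by ext M; exact isUnit_iff_ne_zero
    rw [this]
    exact isOpen_ne_fun (Continuous.matrix_det continuous_id) continuous_const
  have hs : SmM (fun M : Fin n → Fin n → ℂ => (Matrix.of M)⁻¹) Ω :=
    SmM.inv (fun p q => (contDiff_apply_apply ℝ ℂ p q).contDiffOn) fun x hx => hx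
  have hAd : DifferentiableAt ℝ (fun s => (fun p q => A s p q : Fin n → Fin n → ℂ)) t :=
    differentiableAt_pi.2 fun p => differentiableAt_pi.2 fun q => (hA p q).differentiableAt
  have hd : ∀ p q, DifferentiableAt ℝ (fun s => (A s)⁻¹ p q) t := fun p q =>
    (((hs p q).contDiffAt (hΩ.mem_nhds h)).differentiableAt (by simp)).comp t hAd
  have hB : HasDerivM (fun s => (A s)⁻¹) (Matrix.of fun p q => deriv (fun s => (A s)⁻¹ p q) t) t :=
    fun p q => (hd p q).hasDerivAt
  have h1 := hA.mul hB
  have h2 : HasDerivM (fun s => A s * (A s)⁻¹) 0 t :=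
    (const 1).congr ((hA.isUnit_eventually h).mono fun s hs => Matrix.mul_nonsing_inv _ hs)
  have h3 : A' * (A t)⁻¹ + A t * (Matrix.of fun p q => deriv (fun s => (A s)⁻¹ p q) t) = 0 := by
    ext p q; exact (h1 p q).unique (h2 p q)
  have h4 := congrArg (fun M => (A t)⁻¹ * M) (eq_neg_of_add_eq_zero_right h3)
  rw [Matrix.nonsing_inv_mul_cancel_left _ _ h] at h4
  rw [h4] at hB
  rwa [Matrix.mul_assoc, ← Matrix.mul_neg]

end HasDerivM

/-! ### The exterior algebra -/

/-- The covectors `dz^j` (for `τ = 0`) and `dz̄^j` (for `τ = 1`). -/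
def dw (τ : Fin 2) (j : Fin n) : Form n := ExteriorAlgebra.ι ℂ (Pi.single (j, τ) 1)

theorem dz_eq_dw (j : Fin n) : dz j = dw 0 j := rfl
theorem dzb_eq_dw (j : Fin n) : dzb j = dw 1 j := rfl

theorem dw_anticomm (τ τ' : Fin 2) (j k : Fin n) : dw τ j * dw τ' k = -(dw τ' k * dw τ j) :=
  eq_neg_of_add_eq_zero_left (ExteriorAlgebra.ι_add_mul_swap _ _)

/-- The basis of covectors, indexed in a linear order. -/
def covBasis (n : ℕ) : Module.Basis (Fin (n * 2)) ℂ (Fin n × Fin 2 → ℂ) :=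
  (Pi.basisFun ℂ (Fin n × Fin 2)).reindex finProdFinEquiv

/-- A finite basis of the space of forms. -/
def formBasis (n : ℕ) : Module.Basis (Finset (Fin (n * 2))) ℂ (Form n) :=
  (covBasis n).ExteriorAlgebra

/-- Calculus of form-valued functions is tested on linear functionals. This expansion makes l(ab) a
finite sum of products of scalars, so the product rules for forms reduce to the scalar ones. -/
theorem lin_mul_eq (l : Form n →ₗ[ℂ] ℂ) (a b : Form n) :
    l (a * b) = ∑ i, ∑ j, (formBasis n).coord i a * (formBasis n).coord j b *
      l (formBasis n i * formBasis n j) := by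
  conv_lhs => rw [← (formBasis n).sum_repr a, ← (formBasis n).sum_repr b]
  simp only [Finset.sum_mul_sum, map_sum, smul_mul_smul_comm, map_smul, smul_eq_mul,
    Module.Basis.coord_apply]

/-- `topDensity` as a linear functional. -/
def topL (n : ℕ) : Form n →ₗ[ℂ] ℂ :=
  (2 / Complex.I) ^ n • ExteriorAlgebra.liftAlternating (Pi.single (n * 2) (topAlternating n))

/-! ### Forms of even degree -/

/-- A covector passing through a product of two covectors changes sign twice. Hence (1,1)- and
(2,2)-forms behave as commuting variables. -/
theorem dz_mul_dzb_mem_center (j k : Fin n) : dz j * dzb k ∈ Subalgebra.center ℂ (Form n) := by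
  rw [Subalgebra.mem_center_iff]
  intro b
  induction b using ExteriorAlgebra.induction with
  | algebraMap r => exact Algebra.commutes r _
  | ι x =>
    have h : ∀ y, ExteriorAlgebra.ι ℂ x * ExteriorAlgebra.ι ℂ y =
        -((ExteriorAlgebra.ι ℂ y : Form n) * ExteriorAlgebra.ι ℂ x) :=
      fun y => eq_neg_of_add_eq_zero_left (ExteriorAlgebra.ι_add_mul_swap _ _)
    rw [dz, dzb, ← mul_assoc, h, neg_mul, mul_assoc, h, mul_neg, neg_neg, mul_assoc]
  | mul a b ha hb => rw [mul_assoc, hb, ← mul_assoc, ha, mul_assoc]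
  | add a b ha hb => rw [add_mul, mul_add, ha, hb]

theorem form11_mem_center (A : Matrix (Fin n) (Fin n) ℂ) :
    form11 A ∈ Subalgebra.center ℂ (Form n) :=
  sum_mem fun j _ => sum_mem fun k _ => Subalgebra.smul_mem _ (dz_mul_dzb_mem_center j k) _

/-- The form `∑ Φ_{jkrs} dz^j ∧ dz̄^k ∧ dz^r ∧ dz̄^s`. -/
def form22 (Φ : Fin n → Fin n → Fin n → Fin n → ℂ) : Form n :=
  ∑ j, ∑ k, ∑ r, ∑ s, Φ j k r s • (dz j * dzb k * dz r * dzb s)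

theorem chernWeil_eq (Φ : Matrix (Fin n) (Fin n) ℂ → Matrix (Fin n) (Fin n) ℂ → ℂ)
    (G : Cn n → Matrix (Fin n) (Fin n) ℂ) (z : Cn n) :
    chernWeil Φ G z = form22 fun j k r s => Φ (curv G z j k) (curv G z r s) := rfl

theorem form22_mem_center (Φ : Fin n → Fin n → Fin n → Fin n → ℂ) :
    form22 Φ ∈ Subalgebra.center ℂ (Form n) :=
  sum_mem fun j _ => sum_mem fun k _ => sum_mem fun r _ => sum_mem fun s _ =>
    Subalgebra.smul_mem _ (by
      rw [mul_assoc (dz j * dzb k)]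
      exact mul_mem (dz_mul_dzb_mem_center j k) (dz_mul_dzb_mem_center r s)) _

theorem powFact_mem_center {η : Form n} (h : η ∈ Subalgebra.center ℂ (Form n)) (k : ℕ) :
    powFact η k ∈ Subalgebra.center ℂ (Form n) := by
  unfold powFact
  split_ifs
  · exact Subalgebra.smul_mem _ (pow_mem h _) _
  · exact zero_mem _

theorem center_comm {η : Form n} (h : η ∈ Subalgebra.center ℂ (Form n)) (a : Form n) :
    a * η = η * a := Subalgebra.mem_center_iff.1 h a

theorem form11_add (A B : Matrix (Fin n) (Fin n) ℂ) : form11 (A + B) = form11 A + form11 B := by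
  simp only [form11, Matrix.add_apply, add_smul, Finset.sum_add_distrib]

theorem form11_smul (c : ℂ) (A : Matrix (Fin n) (Fin n) ℂ) : form11 (c • A) = c • form11 A := by
  simp only [form11, Matrix.smul_apply, smul_eq_mul, mul_smul, Finset.smul_sum]

/-- `form11` as a linear map. -/
def form11L (n : ℕ) : Matrix (Fin n) (Fin n) ℂ →ₗ[ℂ] Form n where
  toFun := form11
  map_add' := form11_add
  map_smul' := form11_smul

theorem form11_single (j k : Fin n) : form11 (Matrix.single j k 1) = dz j * dzb k := by
  rw [form11, Finset.sum_eq_single j, Finset.sum_eq_single k]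
  · simp
  · intro b _ hb; simp [hb.symm]
  · simp
  · intro b _ hb; simp [hb.symm]
  · simp

theorem form22_mul (A B : Matrix (Fin n) (Fin n) ℂ) :
    (form22 fun j k r s => A j k * B r s) = form11 A * form11 B := by
  simp only [form22, form11, ← Fintype.sum_prod_type', Finset.sum_mul_sum, smul_mul_smul_comm,
    mul_assoc]
  simp only [Fintype.sum_prod_type]

theorem form22_add (Φ Ψ : Fin n → Fin n → Fin n → Fin n → ℂ) :
    (form22 fun j k r s => Φ j k r s + Ψ j k r s) = form22 Φ + form22 Ψ := by
  simp only [form22, add_smul, Finset.sum_add_distrib]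

theorem form22_smul (c : ℂ) (Φ : Fin n → Fin n → Fin n → Fin n → ℂ) :
    (form22 fun j k r s => c * Φ j k r s) = c • form22 Φ := by
  simp only [form22, mul_smul, Finset.smul_sum]

theorem form22_swap (Φ : Fin n → Fin n → Fin n → Fin n → ℂ) :
    (form22 fun j k r s => Φ r s j k) = form22 Φ := by
  have h : ∀ (Ψ : Fin n → Fin n → Fin n → Fin n → ℂ), form22 Ψ =
      ∑ x : (Fin n × Fin n) × (Fin n × Fin n), Ψ x.1.1 x.1.2 x.2.1 x.2.2 •
        ((dz x.1.1 * dzb x.1.2) * (dz x.2.1 * dzb x.2.2)) := fun Ψ => by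
    simp only [form22, Fintype.sum_prod_type, mul_assoc]
  rw [h, h, ← (Equiv.prodComm _ _).sum_comp]
  refine Finset.sum_congr rfl fun x _ => ?_
  simp only [Equiv.prodComm_apply, Prod.fst_swap, Prod.snd_swap]
  rw [center_comm (dz_mul_dzb_mem_center _ _)]

/-! ### Pullback of forms -/

/-- The pullback of forms under a linear map acting by `P` on the `dz^j` and `Q` on the `dz̄^k`. -/
def pull (P Q : Matrix (Fin n) (Fin n) ℂ) : Form n →ₐ[ℂ] Form n :=
  ExteriorAlgebra.map (Matrix.vecMulLinear (Matrix.blockDiagonal ![P, Q]))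

theorem pull_dw (P Q : Matrix (Fin n) (Fin n) ℂ) (τ : Fin 2) (a : Fin n) :
    pull P Q (dw τ a) = ∑ j, (![P, Q] τ) a j • dw τ j := by
  rw [pull, dw, ExteriorAlgebra.map_apply_ι]
  simp only [dw, ← map_smul, ← map_sum]
  congr 1
  ext ⟨j, τ'⟩
  simp only [Matrix.vecMulLinear_apply, Matrix.single_one_vecMul, Finset.sum_apply, Pi.smul_apply,
    smul_eq_mul, Matrix.row_apply, Matrix.blockDiagonal_apply, Pi.single_apply, Prod.mk.injEq]
  by_cases h : τ = τ'
  · subst h; simp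
  · simp [h, Ne.symm h]

theorem pull_dz (P Q : Matrix (Fin n) (Fin n) ℂ) (a : Fin n) :
    pull P Q (dz a) = ∑ j, P a j • dz j := pull_dw P Q 0 a

theorem pull_dzb (P Q : Matrix (Fin n) (Fin n) ℂ) (a : Fin n) :
    pull P Q (dzb a) = ∑ j, Q a j • dzb j := pull_dw P Q 1 a

theorem form11_vecMulVec (x y : Fin n → ℂ) :
    form11 (Matrix.vecMulVec x y) = (∑ j, x j • dz j) * ∑ k, y k • dzb k := by
  simp only [form11, Finset.sum_mul_sum, smul_mul_smul_comm, Matrix.vecMulVec_apply]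

theorem pull_form11 (P Q A : Matrix (Fin n) (Fin n) ℂ) :
    pull P Q (form11 A) = form11 (P.transpose * A * Q) := by
  have h : P.transpose * A * Q = ∑ a, ∑ b, A a b • Matrix.vecMulVec (P a) (Q b) := by
    ext j k
    simp only [Matrix.mul_apply, Matrix.transpose_apply, Matrix.sum_apply, Matrix.smul_apply,
      Matrix.vecMulVec_apply, Finset.sum_mul, smul_eq_mul]
    rw [Finset.sum_comm]
    exact Finset.sum_congr rfl fun a _ => Finset.sum_congr rfl fun b _ => by ring
  have h2 : ∀ B, form11L n B = form11 B := fun _ => rfl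
  have h3 : form11L n (∑ a, ∑ b, A a b • Matrix.vecMulVec (P a) (Q b)) = pull P Q (form11 A) := by
    simp only [map_sum, map_smul]
    simp only [h2, form11_vecMulVec]
    simp only [form11, map_sum, map_smul, map_mul, pull_dz, pull_dzb]
  rw [h, ← h3, h2]

theorem form22_sum {ι : Type*} (t : Finset ι) (Φ : ι → Fin n → Fin n → Fin n → Fin n → ℂ) :
    (form22 fun j k r s => ∑ i ∈ t, Φ i j k r s) = ∑ i ∈ t, form22 (Φ i) := by
  classical
  induction t using Finset.induction_on with
  | empty => simp [form22]
  | insert a t ha ih =>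
    simp only [Finset.sum_insert ha]
    rw [form22_add, ih]

theorem pull_form22 (P Q : Matrix (Fin n) (Fin n) ℂ) (Φ : Fin n → Fin n → Fin n → Fin n → ℂ) :
    pull P Q (form22 Φ) = form22 fun j k r s => ∑ a, ∑ b, ∑ c, ∑ d,
      Φ a b c d * ((P a j * Q b k) * (P c r * Q d s)) := by
  simp only [form22_sum, form22_smul]
  have h : ∀ a b c d, (form22 fun j k r s => (P a j * Q b k) * (P c r * Q d s)) =
      pull P Q (dz a * dzb b * dz c * dzb d) := by
    intro a b c d
    have := form22_mul (Matrix.vecMulVec (P a) (Q b)) (Matrix.vecMulVec (P c) (Q d))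
    simp only [Matrix.vecMulVec_apply, form11_vecMulVec] at this
    rw [this]
    simp only [map_mul, pull_dz, pull_dzb, mul_assoc]
  simp only [h]
  simp only [form22, map_sum, map_smul]

/-- On a list of 2n covectors the top functional is a determinant, and pulling back multiplies the
coefficient matrix by a block matrix of determinant det P · det Q. This serves both for the volume
density and for the transformation of integrands between charts. -/
theorem topL_pull (P Q : Matrix (Fin n) (Fin n) ℂ) (η : Form n) :
    topL n (pull P Q η) = P.det * Q.det * topL n η := by
  have h : ∀ η, ExteriorAlgebra.liftAlternating (R := ℂ) (Pi.single (n * 2) (topAlternating n)) (pull P Q η) =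
      P.det * Q.det * ExteriorAlgebra.liftAlternating (R := ℂ) (Pi.single (n * 2) (topAlternating n)) η := by
    intro η
    have : (ExteriorAlgebra.liftAlternating (R := ℂ) (Pi.single (n * 2) (topAlternating n))) ∘ₗ
        (pull P Q).toLinearMap = (P.det * Q.det) •
          ExteriorAlgebra.liftAlternating (R := ℂ) (Pi.single (n * 2) (topAlternating n)) := by
      apply ExteriorAlgebra.lhom_ext
      intro i
      ext v
      simp only [LinearMap.compAlternatingMap_apply, LinearMap.comp_apply, LinearMap.smul_apply,
        AlgHom.toLinearMap_apply, pull, ExteriorAlgebra.map_apply_ιMulti,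
        ExteriorAlgebra.liftAlternating_apply_ιMulti]
      by_cases hi : i = n * 2
      · subst hi
        simp only [Pi.single_eq_same, topAlternating, AlternatingMap.compLinearMap_apply,
          smul_eq_mul]
        -- The rows of `V` are the given covectors in the linear order of the basis; the pullback
        -- multiplies `V` on the right.
        let V : Matrix (Fin (n * 2)) (Fin (n * 2)) ℂ := fun i c => v i (finProdFinEquiv.symm c)
        have e : (fun (i c : Fin (n * 2)) => (Matrix.vecMulLinear (Matrix.blockDiagonal ![P, Q])
            (v i)) (finProdFinEquiv.symm c)) =
            V * (Matrix.blockDiagonal ![P, Q]).submatrix finProdFinEquiv.symm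
              finProdFinEquiv.symm := by
          ext i c
          simp only [Matrix.vecMulLinear_apply,
            Matrix.mul_apply, Matrix.submatrix_apply, Matrix.vecMul, dotProduct]
          exact (finProdFinEquiv.symm.sum_comp fun x => v i x * Matrix.blockDiagonal ![P, Q] x
            (finProdFinEquiv.symm c)).symm
        have e2 : Matrix.det _ = Matrix.det _ := congrArg Matrix.det e
        have e3 : ((Matrix.blockDiagonal ![P, Q]).submatrix finProdFinEquiv.symm
              finProdFinEquiv.symm : Matrix (Fin (n * 2)) (Fin (n * 2)) ℂ).det = P.det * Q.det := by
          rw [Matrix.det_submatrix_equiv_self, Matrix.det_blockDiagonal, Fin.prod_univ_two]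
          rfl
        rw [Matrix.det_mul, e3, mul_comm V.det] at e2
        exact e2
      · simp [Pi.single_eq_of_ne hi]
    exact LinearMap.congr_fun this η
  simp only [topL, LinearMap.smul_apply, h, smul_eq_mul]
  ring

theorem pull_powFact (P Q : Matrix (Fin n) (Fin n) ℂ) (η : Form n) (k : ℕ) :
    pull P Q (powFact η k) = powFact (pull P Q η) k := by
  unfold powFact; split_ifs <;> simp

/-! ### Form-valued functions -/

/-- Differentiability of a form-valued function of a real variable, tested on functionals. -/
def HasDerivF (η : ℝ → Form n) (η' : Form n) (t : ℝ) : Prop :=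
  ∀ l : Form n →ₗ[ℂ] ℂ, HasDerivAt (fun s => l (η s)) (l η') t

/-- Smoothness of a form-valued function, tested on functionals. -/
def SmF {X : Type*} [NormedAddCommGroup X] [NormedSpace ℝ X] (η : X → Form n) (Ω : Set X) : Prop :=
  ∀ l : Form n →ₗ[ℂ] ℂ, ContDiffOn ℝ ∞ (fun x => l (η x)) Ω

namespace HasDerivF

variable {η ξ : ℝ → Form n} {η' ξ' : Form n} {t : ℝ}

theorem const (η : Form n) : HasDerivF (fun _ => η) 0 t := fun l => by
  simpa using hasDerivAt_const t (l η)

theorem smul {f : ℝ → ℂ} {f' : ℂ} (hf : HasDerivAt f f' t) (hη : HasDerivF η η' t) :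
    HasDerivF (fun s => f s • η s) (f' • η t + f t • η') t := fun l => by
  simp only [map_add, map_smul, smul_eq_mul]; exact hf.mul (hη l)

theorem const_smul (c : ℂ) (hη : HasDerivF η η' t) :
    HasDerivF (fun s => c • η s) (c • η') t := fun l => by
  simp only [map_smul, smul_eq_mul]; exact (hη l).const_mul c

theorem sum {ι : Type*} (u : Finset ι) {η : ι → ℝ → Form n} {η' : ι → Form n}
    (h : ∀ i ∈ u, HasDerivF (η i) (η' i) t) :
    HasDerivF (fun s => ∑ i ∈ u, η i s) (∑ i ∈ u, η' i) t := fun l => by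
  simp only [map_sum]; exact HasDerivAt.fun_sum fun i hi => h i hi l

theorem mul (hη : HasDerivF η η' t) (hξ : HasDerivF ξ ξ' t) :
    HasDerivF (fun s => η s * ξ s) (η' * ξ t + η t * ξ') t := fun l => by
  rw [map_add, lin_mul_eq l η', lin_mul_eq l (η t)]
  simp only [fun s => lin_mul_eq l (η s) (ξ s), ← Finset.sum_add_distrib, ← add_mul]
  exact HasDerivAt.fun_sum fun i _ => HasDerivAt.fun_sum fun j _ =>
    ((hη _).mul (hξ _)).mul_const _

theorem congr_deriv (hη : HasDerivF η η' t) {η'' : Form n} (h : η' = η'') : HasDerivF η η'' t :=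
  h ▸ hη

theorem pow (hη : HasDerivF η η' t) (hc : ∀ s, η s ∈ Subalgebra.center ℂ (Form n)) (m : ℕ) :
    HasDerivF (fun s => η s ^ m) ((m : ℂ) • (η' * η t ^ (m - 1))) t := by
  induction m with
  | zero => simpa using const 1
  | succ m ih =>
    simp only [pow_succ]
    refine (ih.mul hη).congr_deriv ?_
    rw [smul_mul_assoc, mul_assoc, ← center_comm (pow_mem (hc t) m), Nat.add_sub_cancel]
    rcases m with _ | m
    · simp
    · rw [Nat.add_sub_cancel, ← pow_succ]
      push_cast
      module

theorem powFact (hη : HasDerivF η η' t) (hc : ∀ s, η s ∈ Subalgebra.center ℂ (Form n)) (k : ℕ) :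
    HasDerivF (fun s => powFact (η s) k) (η' * Kahler.powFact (η t) (k + 1)) t := by
  unfold Kahler.powFact
  by_cases h : k ≤ n
  · simp only [h, if_true]
    refine ((hη.pow hc (n - k)).const_smul _).congr_deriv ?_
    by_cases h1 : k + 1 ≤ n
    · obtain ⟨m, hm⟩ : ∃ m, n - k = m + 1 := ⟨n - k - 1, by omega⟩
      have h2 : n - (k + 1) = m := by omega
      rw [if_pos h1, hm, h2, Nat.factorial_succ, Nat.add_sub_cancel, smul_smul, mul_smul_comm]
      congr 1
      have : (m + 1 : ℂ) ≠ 0 := by exact_mod_cast Nat.succ_ne_zero m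
      have : (m.factorial : ℂ) ≠ 0 := by exact_mod_cast m.factorial_ne_zero
      push_cast
      field_simp
    · have : n - k = 0 := by omega
      rw [if_neg h1, this]; simp
  · have h1 : ¬ k + 1 ≤ n := by omega
    simp only [h, h1, if_false]
    simpa using const 0

theorem form11 {A : ℝ → Matrix (Fin n) (Fin n) ℂ} {A' : Matrix (Fin n) (Fin n) ℂ}
    (hA : HasDerivM A A' t) : HasDerivF (fun s => form11 (A s)) (Kahler.form11 A') t := by
  unfold Kahler.form11
  refine sum _ fun j _ => sum _ fun k _ => ?_
  simpa using smul (hA j k) (const (dz j * dzb k))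

theorem form22 {Φ : ℝ → Fin n → Fin n → Fin n → Fin n → ℂ}
    {Φ' : Fin n → Fin n → Fin n → Fin n → ℂ}
    (h : ∀ j k r s, HasDerivAt (fun x => Φ x j k r s) (Φ' j k r s) t) :
    HasDerivF (fun s => form22 (Φ s)) (Kahler.form22 Φ') t := by
  unfold Kahler.form22
  refine sum _ fun j _ => sum _ fun k _ => sum _ fun r _ => sum _ fun s _ => ?_
  simpa using smul (h j k r s) (const (dz j * dzb k * dz r * dzb s))

end HasDerivF

namespace SmF

variable {X : Type*} [NormedAddCommGroup X] [NormedSpace ℝ X] {Ω : Set X} {η ξ : X → Form n}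

theorem congr (hη : SmF η Ω) (h : ∀ x ∈ Ω, ξ x = η x) : SmF ξ Ω :=
  fun l => (hη l).congr fun x hx => by rw [h x hx]

theorem const (η : Form n) : SmF (fun _ : X => η) Ω := fun _ => contDiffOn_const

theorem add (hη : SmF η Ω) (hξ : SmF ξ Ω) : SmF (fun x => η x + ξ x) Ω := fun l => by
  simp only [map_add]; exact (hη l).add (hξ l)

theorem sub (hη : SmF η Ω) (hξ : SmF ξ Ω) : SmF (fun x => η x - ξ x) Ω := fun l => by
  simp only [map_sub]; exact (hη l).sub (hξ l)

theorem smul {f : X → ℂ} (hf : ContDiffOn ℝ ∞ f Ω) (hη : SmF η Ω) :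
    SmF (fun x => f x • η x) Ω := fun l => by
  simp only [map_smul, smul_eq_mul]; exact hf.mul (hη l)

theorem const_smul (c : ℂ) (hη : SmF η Ω) : SmF (fun x => c • η x) Ω :=
  smul contDiffOn_const hη

theorem sum {ι : Type*} (u : Finset ι) {η : ι → X → Form n} (h : ∀ i ∈ u, SmF (η i) Ω) :
    SmF (fun x => ∑ i ∈ u, η i x) Ω := fun l => by
  simp only [map_sum]; exact ContDiffOn.sum fun i hi => h i hi l

theorem mul (hη : SmF η Ω) (hξ : SmF ξ Ω) : SmF (fun x => η x * ξ x) Ω := fun l => by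
  simp only [fun x => lin_mul_eq l (η x) (ξ x)]
  exact ContDiffOn.sum fun i _ => ContDiffOn.sum fun j _ =>
    ((hη _).mul (hξ _)).mul contDiffOn_const

theorem pow (hη : SmF η Ω) (m : ℕ) : SmF (fun x => η x ^ m) Ω := by
  induction m with
  | zero => simpa using const 1
  | succ m ih => simp only [pow_succ]; exact ih.mul hη

theorem powFact (hη : SmF η Ω) (k : ℕ) : SmF (fun x => powFact (η x) k) Ω := by
  unfold Kahler.powFact
  split_ifs
  · exact const_smul _ (hη.pow _)
  · exact const 0

theorem form11 {A : X → Matrix (Fin n) (Fin n) ℂ} (hA : SmM A Ω) :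
    SmF (fun x => form11 (A x)) Ω :=
  sum _ fun j _ => sum _ fun k _ => smul (hA j k) (const (dz j * dzb k))

theorem form22 {Φ : X → Fin n → Fin n → Fin n → Fin n → ℂ}
    (h : ∀ j k r s, ContDiffOn ℝ ∞ (fun x => Φ x j k r s) Ω) :
    SmF (fun x => form22 (Φ x)) Ω :=
  sum _ fun j _ => sum _ fun k _ => sum _ fun r _ => sum _ fun s _ =>
    smul (h j k r s) (const (dz j * dzb k * dz r * dzb s))

end SmF

/-! ### Top densities of products of `(1,1)`-forms -/

/-- The `(1,1)`-form `i ∑ A_{jk̄} dz^j ∧ dz̄^k`. -/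
def kf (A : Matrix (Fin n) (Fin n) ℂ) : Form n := Complex.I • form11 A

theorem omega_eq (G : Cn n → Matrix (Fin n) (Fin n) ℂ) (z : Cn n) : omega G z = kf (G z) := rfl

theorem kf_mem_center (A : Matrix (Fin n) (Fin n) ℂ) : kf A ∈ Subalgebra.center ℂ (Form n) :=
  Subalgebra.smul_mem _ (form11_mem_center A) _

theorem HasDerivF.kf {A : ℝ → Matrix (Fin n) (Fin n) ℂ} {A' : Matrix (Fin n) (Fin n) ℂ} {t : ℝ}
    (hA : HasDerivM A A' t) : HasDerivF (fun s => kf (A s)) (Kahler.kf A') t :=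
  (HasDerivF.form11 hA).const_smul _

/-- The volume density of the metric with matrix `G`. -/
def vd (G : Matrix (Fin n) (Fin n) ℂ) : ℂ := topL n (powFact (kf G) 0)

/-- The form of G is the pullback of the standard one under the transpose of G on the dz and the
identity on the dz̄. The value of `vd 1` is never needed, only the proportionality to det G. -/
theorem vd_eq (G : Matrix (Fin n) (Fin n) ℂ) : vd G = vd (1 : Matrix (Fin n) (Fin n) ℂ) * G.det := by
  have h : kf G = pull G.transpose 1 (kf 1) := by
    simp [kf, pull_form11]
  rw [vd, h, ← pull_powFact, topL_pull, Matrix.det_transpose, Matrix.det_one, vd]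
  ring

theorem hasDerivM_line (G A : Matrix (Fin n) (Fin n) ℂ) (t : ℝ) :
    HasDerivM (fun s : ℝ => G + (s : ℂ) • A) A t := fun p q => by
  have := ((Complex.ofRealCLM.hasDerivAt (x := t)).mul_const (A p q)).const_add (G p q)
  simpa using this

theorem hasDerivAt_det_line {G : Matrix (Fin n) (Fin n) ℂ} (hG : IsUnit G.det)
    (A : Matrix (Fin n) (Fin n) ℂ) :
    HasDerivAt (fun s : ℝ => (G + (s : ℂ) • A).det) (G.det * (A * G⁻¹).trace) 0 := by
  -- det(1 + sN) is a polynomial in s with constant term 1 and linear coefficient tr N; the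
  -- remainder carries s² and does not contribute at 0.
  have h1 : ∀ s : ℝ, (G + (s : ℂ) • A).det =
      G.det * (1 + (A * G⁻¹).trace * s + (Matrix.det (1 + (Polynomial.X : Polynomial ℂ) •
        (A * G⁻¹).map Polynomial.C)).divX.divX.eval (s : ℂ) * (s : ℂ) ^ 2) := by
    intro s
    rw [← Matrix.det_one_add_smul, mul_comm G.det, ← Matrix.det_mul,
      add_mul, one_mul, smul_mul_assoc, Matrix.nonsing_inv_mul_cancel_right _ _ hG]
  simp only [h1]
  have h2 : HasDerivAt (fun s : ℝ => (s : ℂ)) 1 0 := Complex.ofRealCLM.hasDerivAt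
  have h3 := (Polynomial.hasDerivAt (Matrix.det (1 + (Polynomial.X : Polynomial ℂ) •
        (A * G⁻¹).map Polynomial.C)).divX.divX ((0 : ℝ) : ℂ)).comp (0 : ℝ) h2
  have h4 := (((h2.const_mul (A * G⁻¹).trace).const_add 1).add (h3.mul (h2.pow 2))).const_mul G.det
  refine h4.congr_deriv ?_
  simp

theorem hasDerivAt_vd_line {G : Matrix (Fin n) (Fin n) ℂ} (hG : IsUnit G.det)
    (A : Matrix (Fin n) (Fin n) ℂ) :
    HasDerivAt (fun s : ℝ => vd (G + (s : ℂ) • A)) (vd G * (A * G⁻¹).trace) 0 := by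
  have h := (hasDerivAt_det_line hG A).const_mul (vd (1 : Matrix (Fin n) (Fin n) ℂ))
  rw [vd_eq G, mul_assoc]
  exact h.congr_of_eventuallyEq (Filter.Eventually.of_forall fun s => vd_eq _)

theorem isUnit_line {G : Matrix (Fin n) (Fin n) ℂ} (hG : IsUnit G.det)
    (A : Matrix (Fin n) (Fin n) ℂ) : ∀ᶠ s : ℝ in 𝓝 0, IsUnit (G + (s : ℂ) • A).det :=
  (hasDerivM_line G A 0).isUnit_eventually (by simpa using hG)

/-- Moving the metric in the direction A turns ω^m/m! into A ∧ ω^{m-1}/(m-1)!, because (1,1)-forms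
commute. This is the polarization device for the three evaluations of `topL` below. -/
theorem hasDerivF_powFact_line (G A : Matrix (Fin n) (Fin n) ℂ) (x : Form n) (k : ℕ) :
    HasDerivAt (fun s : ℝ => topL n (x * powFact (kf (G + (s : ℂ) • A)) k))
      (topL n (x * kf A * powFact (kf G) (k + 1))) 0 := by
  have := ((HasDerivF.const x (t := 0)).mul
    ((HasDerivF.kf (hasDerivM_line G A 0)).powFact (fun s => kf_mem_center _) k)) (topL n)
  simpa [mul_assoc] using this

theorem hasDerivM_mul_inv_line {G : Matrix (Fin n) (Fin n) ℂ} (hG : IsUnit G.det)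
    (A B : Matrix (Fin n) (Fin n) ℂ) :
    HasDerivM (fun s : ℝ => B * (G + (s : ℂ) • A)⁻¹) (-(B * G⁻¹ * (A * G⁻¹))) 0 := by
  have h := (HasDerivM.const B (t := 0)).mul ((hasDerivM_line G A 0).inv (by simpa using hG))
  simpa [Matrix.mul_assoc] using h

/-- Two computations of the derivative of the volume density along G + sA, by forms and by Jacobi's
formula, must agree. Differentiating the resulting identity again in further directions gives
`topL_two` and `topL_three`. -/
theorem topL_one {G : Matrix (Fin n) (Fin n) ℂ} (hG : IsUnit G.det)
    (A : Matrix (Fin n) (Fin n) ℂ) :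
    topL n (kf A * powFact (kf G) 1) = vd G * (A * G⁻¹).trace := by
  have h1 := hasDerivF_powFact_line G A 1 0
  simp only [one_mul] at h1
  exact h1.unique (hasDerivAt_vd_line hG A)

theorem topL_two {G : Matrix (Fin n) (Fin n) ℂ} (hG : IsUnit G.det)
    (A B : Matrix (Fin n) (Fin n) ℂ) :
    topL n (kf A * kf B * powFact (kf G) 2) =
      vd G * ((A * G⁻¹).trace * (B * G⁻¹).trace - (A * G⁻¹ * (B * G⁻¹)).trace) := by
  have h1 := hasDerivF_powFact_line G B (kf A) 1
  have h2 := (hasDerivAt_vd_line hG B).mul (hasDerivM_mul_inv_line hG B A).trace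
  have h3 := h1.unique (h2.congr_of_eventuallyEq ((isUnit_line hG B).mono fun s hs =>
    topL_one hs A))
  rw [h3]
  simp
  ring

theorem topL_three {G : Matrix (Fin n) (Fin n) ℂ} (hG : IsUnit G.det)
    (A B C : Matrix (Fin n) (Fin n) ℂ) :
    topL n (kf A * kf B * kf C * powFact (kf G) 3) =
      vd G * ((C * G⁻¹).trace * ((A * G⁻¹).trace * (B * G⁻¹).trace
          - (A * G⁻¹ * (B * G⁻¹)).trace)
        - (A * G⁻¹ * (C * G⁻¹)).trace * (B * G⁻¹).trace
        - (A * G⁻¹).trace * (B * G⁻¹ * (C * G⁻¹)).trace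
        + (A * G⁻¹ * (C * G⁻¹) * (B * G⁻¹)).trace + (A * G⁻¹ * (B * G⁻¹) * (C * G⁻¹)).trace) := by
  have h1 := hasDerivF_powFact_line G C (kf A * kf B) 2
  have hA := hasDerivM_mul_inv_line hG C A
  have hB := hasDerivM_mul_inv_line hG C B
  have h2 := (hasDerivAt_vd_line hG C).mul ((hA.trace.mul hB.trace).sub (hA.mul hB).trace)
  have h3 := h1.unique (h2.congr_of_eventuallyEq ((isUnit_line hG C).mono fun s hs =>
    topL_two hs A B))
  rw [h3]
  simp [Matrix.mul_assoc]
  ring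

/-- The top density of `form22` against `ω^{n-2}/(n-2)!`. -/
theorem topL_form22 {G : Matrix (Fin n) (Fin n) ℂ} (hG : IsUnit G.det)
    (Φ : Fin n → Fin n → Fin n → Fin n → ℂ) :
    topL n (form22 Φ * powFact (kf G) 2) =
      -(vd G * ∑ j, ∑ k, ∑ r, ∑ s, Φ j k r s * (G⁻¹ k j * G⁻¹ s r - G⁻¹ k r * G⁻¹ s j)) := by
  have h : ∀ j k r s, topL n (dz j * dzb k * dz r * dzb s * powFact (kf G) 2) =
      -(vd G * (G⁻¹ k j * G⁻¹ s r - G⁻¹ k r * G⁻¹ s j)) := by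
    intro j k r s
    -- A product dz^j ∧ dz̄^k is the (1,1)-form of an elementary matrix; the two factors i in `kf`
    -- account for the minus sign.
    have h1 := topL_two hG (Matrix.single j k 1) (Matrix.single r s 1)
    simp only [kf, form11_single, smul_mul_assoc, mul_smul_comm, map_smul, smul_smul,
      Complex.I_mul_I, smul_eq_mul, ← mul_assoc] at h1
    have e1 : ∀ j k : Fin n, (Matrix.single j k 1 * G⁻¹).trace = G⁻¹ k j := by
      intro j k; simp [Matrix.trace_single_mul]
    have e2 : (Matrix.single j k 1 * G⁻¹ * Matrix.single r s 1 * G⁻¹).trace =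
        G⁻¹ k r * G⁻¹ s j := by
      rw [Matrix.mul_assoc, Matrix.mul_assoc, Matrix.trace_single_mul]
      simp [Matrix.mul_apply, Matrix.single_apply, ite_and]
    rw [e1, e1, e2] at h1
    simp only [kf]
    linear_combination -h1
  simp only [form22, Finset.sum_mul, map_sum, smul_mul_assoc, map_smul, h, smul_eq_mul,
    Finset.mul_sum, ← Finset.sum_neg_distrib]
  refine Finset.sum_congr rfl fun j _ => Finset.sum_congr rfl fun k _ =>
    Finset.sum_congr rfl fun r _ => Finset.sum_congr rfl fun s _ => ?_
  ring

/-! ### The Todd polynomial in terms of traces -/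

/-- The coefficient is half the second derivative at 0 of det(1 + sN), whose first derivative is
det(1 + sN) · tr(N(1 + sN)⁻¹) near 0. -/
theorem coeff_two_det_one_add_X (N : Matrix (Fin n) (Fin n) ℂ) :
    (Matrix.det (1 + (Polynomial.X : Polynomial ℂ) • N.map Polynomial.C)).coeff 2 =
      (N.trace ^ 2 - (N * N).trace) / 2 := by
  set p := Matrix.det (1 + (Polynomial.X : Polynomial ℂ) • N.map Polynomial.C) with hp
  have hev : ∀ s : ℝ, p.eval (s : ℂ) = (1 + (s : ℂ) • N).det := by
    intro s
    rw [hp, ← Polynomial.coe_evalRingHom, RingHom.map_det]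
    congr 1
    ext i j
    simp [Matrix.one_apply, apply_ite]
    ring
  have hof : ∀ s : ℝ, HasDerivAt (fun s : ℝ => (s : ℂ)) 1 s := fun s =>
    Complex.ofRealCLM.hasDerivAt
  have hd : ∀ (q : Polynomial ℂ) (s : ℝ), HasDerivAt (fun s : ℝ => q.eval (s : ℂ))
      (q.derivative.eval (s : ℂ)) s := fun q s => by
    have h := (Polynomial.hasDerivAt q (s : ℂ)).comp s (hof s)
    rw [mul_one] at h
    exact h
  have h1 : ∀ᶠ s : ℝ in 𝓝 0, p.derivative.eval (s : ℂ) =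
      (1 + (s : ℂ) • N).det * (N * (1 + (s : ℂ) • N)⁻¹).trace := by
    filter_upwards [isUnit_line (G := (1 : Matrix (Fin n) (Fin n) ℂ)) (by simp) N] with s hs
    have h2 := hasDerivAt_det_line hs N
    have h3 : HasDerivAt (fun x : ℝ => p.eval ((s + x : ℝ) : ℂ)) (p.derivative.eval (s : ℂ)) 0 := by
      have := (hd p (s + 0)).comp_const_add s 0
      simpa using this
    refine h3.unique (h2.congr_of_eventuallyEq (Filter.Eventually.of_forall fun x => ?_))
    show p.eval ((s + x : ℝ) : ℂ) = _
    rw [hev]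
    push_cast
    rw [add_smul, add_assoc]
  have h4 := (hasDerivAt_det_line (G := (1 : Matrix (Fin n) (Fin n) ℂ)) (by simp) N).mul
    (hasDerivM_mul_inv_line (G := (1 : Matrix (Fin n) (Fin n) ℂ)) (by simp) N N).trace
  have h5 := (hd p.derivative 0).unique (h4.congr_of_eventuallyEq h1)
  have h6 : (p.derivative.derivative).eval ((0 : ℝ) : ℂ) = 2 * p.coeff 2 := by
    rw [Complex.ofReal_zero, ← Polynomial.coeff_zero_eq_eval_zero, Polynomial.coeff_derivative,
      Polynomial.coeff_derivative]
    push_cast; ring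
  rw [h6] at h5
  simp at h5
  rw [eq_div_iff two_ne_zero, mul_comm, h5]
  ring

/-- The Todd matrix is 1 + XN with N = (i/2)A - (1/12)A² X + ⋯. The X² coefficient of det(1 + XN) is
the X-coefficient of tr N plus the second elementary symmetric function of N(0) = (i/2)A, which
gives -(tr A)²/8 + (1/8 - 1/12) tr A². -/
theorem td2_eq (A : Matrix (Fin n) (Fin n) ℂ) :
    td2 A = -(1 / 8) * A.trace ^ 2 + (1 / 24) * (A * A).trace := by
  set N : Matrix (Fin n) (Fin n) (PowerSeries ℂ) := Matrix.of fun p q => PowerSeries.mk fun k =>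
    (((bernoulli' (k + 1) : ℚ) : ℂ) / (Nat.factorial (k + 1) : ℂ)) *
      ((Complex.I • A) ^ (k + 1)) p q with hN
  have h1 : toddSeries A = Matrix.det (1 + (PowerSeries.X : PowerSeries ℂ) • N) := by
    rw [toddSeries]
    congr 1
    ext p q k
    rcases k with _ | k
    · by_cases h : p = q <;> simp [h, hN]
    · by_cases h : p = q <;>
        simp [h, hN, PowerSeries.coeff_succ_X_mul, PowerSeries.coeff_one]
  set Q := (Matrix.det (1 + (Polynomial.X : Polynomial (PowerSeries ℂ)) • N.map Polynomial.C))
    with hQ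
  -- The part of the determinant beyond the linear term is X² times a polynomial evaluated at X. Its
  -- constant term sees only the constant terms of the entries of N.
  have h2 : (Q.divX.divX.eval PowerSeries.X).constantCoeff =
      ((Matrix.det (1 + (Polynomial.X : Polynomial ℂ) •
        (N.map (PowerSeries.constantCoeff (R := ℂ))).map Polynomial.C)).coeff 2) := by
    have e : ∀ q : Polynomial (PowerSeries ℂ), (q.eval PowerSeries.X).constantCoeff =
        (q.coeff 0).constantCoeff := by
      intro q
      rw [← Polynomial.eval₂_hom, PowerSeries.constantCoeff_X, Polynomial.eval₂_at_zero]
    rw [e, Polynomial.coeff_divX, Polynomial.coeff_divX, ← Polynomial.coeff_map]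
    congr 1
    rw [← Polynomial.coe_mapRingHom, hQ, RingHom.map_det]
    congr 1
    ext i j : 2
    simp [Matrix.one_apply, apply_ite]
  have h3 : N.map (PowerSeries.constantCoeff (R := ℂ)) = (Complex.I / 2) • A := by
    ext p q
    simp [hN]
    ring
  have h4 : PowerSeries.coeff 1 N.trace = -(1 / 12) * (A * A).trace := by
    simp only [Matrix.trace, Matrix.diag, map_sum, hN, Matrix.of_apply, PowerSeries.coeff_mk,
      Finset.mul_sum]
    refine Finset.sum_congr rfl fun i _ => ?_
    have : (Complex.I • A) ^ (1 + 1) = -(A * A) := by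
      rw [pow_succ, pow_one, smul_mul_smul_comm, Complex.I_mul_I, neg_one_smul]
    rw [this]
    norm_num [Nat.factorial, bernoulli'_two]
  rw [td2, h1, Matrix.det_one_add_smul, map_add, map_add, ← pow_one (PowerSeries.X : PowerSeries ℂ),
    PowerSeries.coeff_mul_X_pow', ← pow_mul, PowerSeries.coeff_mul_X_pow']
  simp only [pow_one, Nat.reduceLeDiff, if_true, Nat.reduceSub, one_mul, le_refl]
  rw [h4, PowerSeries.coeff_zero_eq_constantCoeff_apply, h2, coeff_two_det_one_add_X, h3]
  simp [PowerSeries.coeff_one, Matrix.trace_smul]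
  linear_combination ((1 / 8) * A.trace ^ 2 - (1 / 8) * (A * A).trace) * Complex.I_sq

theorem td2Polar_eq (A B : Matrix (Fin n) (Fin n) ℂ) :
    td2Polar A B = -(1 / 8) * (A.trace * B.trace) + (1 / 24) * (A * B).trace := by
  simp only [td2Polar, td2_eq, Matrix.trace_add, add_mul, mul_add, Matrix.trace_mul_comm B A]
  ring

theorem td2Polar_comm (A B : Matrix (Fin n) (Fin n) ℂ) : td2Polar A B = td2Polar B A := by
  simp only [td2Polar_eq, Matrix.trace_mul_comm B A]; ring

/-! ### Local Kähler geometry -/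

/-- The coefficients of a smooth closed `(1,1)`-form. -/
structure Closed11 (U : Set (Cn n)) (A : Cn n → Matrix (Fin n) (Fin n) ℂ) : Prop where
  smooth : SmM A U
  closed0 : ∀ z ∈ U, ∀ i j k, wd 0 i (fun w => A w j k) z = wd 0 j (fun w => A w i k) z
  closed1 : ∀ z ∈ U, ∀ l j k, wd 1 l (fun w => A w j k) z = wd 1 k (fun w => A w j l) z

theorem Closed11.mono {U U' : Set (Cn n)} {A : Cn n → Matrix (Fin n) (Fin n) ℂ}
    (h : Closed11 U A) (hU : U' ⊆ U) : Closed11 U' A :=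
  ⟨h.smooth.mono hU, fun z hz => h.closed0 z (hU hz), fun z hz => h.closed1 z (hU hz)⟩

theorem Closed11.add {U : Set (Cn n)} (hU : IsOpen U) {A B : Cn n → Matrix (Fin n) (Fin n) ℂ}
    (hA : Closed11 U A) (hB : Closed11 U B) : Closed11 U fun w => A w + B w := by
  refine ⟨hA.smooth.add hB.smooth, fun z hz i j k => ?_, fun z hz i j k => ?_⟩ <;>
  · simp only [Matrix.add_apply]
    rw [wd_add (hA.smooth.diff hU hz _ _) (hB.smooth.diff hU hz _ _),
      wd_add (hA.smooth.diff hU hz _ _) (hB.smooth.diff hU hz _ _)]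
    first
    | rw [hA.closed0 z hz, hB.closed0 z hz]
    | rw [hA.closed1 z hz i, hB.closed1 z hz i]

theorem Closed11.smul {U : Set (Cn n)} (hU : IsOpen U) {A : Cn n → Matrix (Fin n) (Fin n) ℂ}
    (hA : Closed11 U A) (c : ℂ) : Closed11 U fun w => c • A w := by
  refine ⟨hA.smooth.smul contDiffOn_const, fun z hz i j k => ?_, fun z hz i j k => ?_⟩ <;>
  · simp only [Matrix.smul_apply, smul_eq_mul]
    rw [wd_const_mul _ (hA.smooth.diff hU hz _ _), wd_const_mul _ (hA.smooth.diff hU hz _ _)]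
    first
    | rw [hA.closed0 z hz]
    | rw [hA.closed1 z hz i]

theorem hess_apply (f : Cn n → ℂ) (z : Cn n) (j k : Fin n) :
    hess f z j k = wd 0 j (wd 1 k f) z := by
  have : pzb k f = wd 1 k f := funext fun w => pzb_eq_wd k f w
  show pz j (pzb k f) z = _
  rw [this]; rfl

theorem closed11_hess {U : Set (Cn n)} (hU : IsOpen U) {f : Cn n → ℂ} (hf : ContDiffOn ℝ ∞ f U) :
    Closed11 U (hess f) := by
  have h1 := fun τ k => contDiffOn_wd hU hf τ k
  refine ⟨fun p q => ?_, fun z hz i j k => ?_, fun z hz l j k => ?_⟩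
  · simp only [hess_apply]; exact contDiffOn_wd hU (h1 1 q) 0 p
  · simp only [hess_apply]
    exact wd_comm hU (h1 1 k) hz 0 0 i j
  · simp only [hess_apply]
    rw [wd_congr_on hU hz fun w hw => wd_comm hU hf hw 0 1 j k,
      wd_congr_on hU hz fun w hw => wd_comm hU hf hw 0 1 j l]
    exact wd_comm hU (h1 0 j) hz 1 1 l k

/-- The connection matrices `∂_j h h⁻¹` of the metric with matrix `h = G`. -/
def gam (G : Cn n → Matrix (Fin n) (Fin n) ℂ) (j : Fin n) (z : Cn n) : Matrix (Fin n) (Fin n) ℂ :=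
  wdM 0 j G z * (G z)⁻¹

theorem curv_eq (G : Cn n → Matrix (Fin n) (Fin n) ℂ) (z : Cn n) (j k : Fin n) :
    curv G z j k = -wdM 1 k (gam G j) z := by
  ext p q
  show -pzb k _ z = -wd 1 k _ z
  rw [pzb_eq_wd]; rfl

/-! ### Curvature and Bianchi identities of a Hermitian metric. -/

section Metric

variable {U : Set (Cn n)} (hU : IsOpen U) {G : Cn n → Matrix (Fin n) (Fin n) ℂ}
  (hG : SmM G U) (hu : ∀ w ∈ U, IsUnit (G w).det)

include hU hG hu

theorem smM_gam (j : Fin n) : SmM (gam G j) U := (hG.wdM hU 0 j).mul (hG.inv hu)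

theorem smM_curv (j k : Fin n) : SmM (fun z => curv G z j k) U :=
  (((smM_gam hU hG hu j).wdM hU 1 k).neg).congr fun z _ => curv_eq G z j k

theorem smM_ric : SmM (ric G) U := fun j k => (smM_curv hU hG hu j k).trace

/-- With the index lowered, the curvature is expressed through derivatives of G and G⁻¹ in a form
from which the Kähler and Hermitian symmetries can be read off. -/
theorem curv_mul {z : Cn n} (hz : z ∈ U) (j k : Fin n) :
    curv G z j k * G z = -wdM 1 k (wdM 0 j G) z + wdM 0 j G z * (G z)⁻¹ * wdM 1 k G z := by
  have h1 : wdM 1 k (gam G j) z = wdM 1 k (fun w => wdM 0 j G w * (G w)⁻¹) z := rfl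
  rw [curv_eq, h1, wdM_mul ((hG.wdM hU 0 j).diff hU hz) ((hG.inv hu).diff hU hz),
    wdM_inv hU hG hu hz]
  have h2 : (G z)⁻¹ * G z = 1 := Matrix.nonsing_inv_mul _ (hu z hz)
  simp only [neg_mul, add_mul, mul_neg, neg_add, neg_neg, Matrix.mul_assoc, h2, Matrix.mul_one]

/-- The expression ∂_iΓ_j + Γ_jΓ_i equals (∂_i∂_j G)G⁻¹ and is therefore symmetric in i and j.
Applying ∂̄_k to this symmetry yields the second Bianchi identity, in which the commutators with Γ
make the derivative covariant. -/
theorem bianchi0 {z : Cn n} (hz : z ∈ U) (i j k : Fin n) :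
    wdM 0 i (fun w => curv G w j k) z + curv G z j k * gam G i z - gam G i z * curv G z j k =
      wdM 0 j (fun w => curv G w i k) z + curv G z i k * gam G j z
        - gam G j z * curv G z i k := by
  have hs := fun j => smM_gam hU hG hu j
  have h1 : ∀ i j, ∀ w ∈ U, wdM 0 i (gam G j) w + gam G j w * gam G i w =
      wdM 0 i (wdM 0 j G) w * (G w)⁻¹ := by
    intro i j w hw
    have h1 : wdM 0 i (gam G j) w = wdM 0 i (fun w => wdM 0 j G w * (G w)⁻¹) w := rfl
    rw [h1, wdM_mul ((hG.wdM hU 0 j).diff hU hw) ((hG.inv hu).diff hU hw),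
      wdM_inv hU hG hu hw]
    simp only [gam, mul_neg, Matrix.mul_assoc, neg_add_cancel_right]
  have h2 : ∀ i j, wdM 1 k (fun w => wdM 0 i (gam G j) w + gam G j w * gam G i w) z =
      -wdM 0 i (fun w => curv G w j k) z - curv G z j k * gam G i z
        - gam G j z * curv G z i k := by
    intro i j
    rw [wdM_add (((hs j).wdM hU 0 i).diff hU hz) (((hs j).mul (hs i)).diff hU hz),
      wdM_mul ((hs j).diff hU hz) ((hs i).diff hU hz), wdM_comm hU (hs j) hz]
    have e : ∀ j, wdM 1 k (gam G j) = fun w => -curv G w j k := fun j => by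
      funext w; rw [curv_eq, neg_neg]
    simp only [e, wdM_neg, neg_mul, mul_neg]
    abel
  have h3 := h2 i j
  rw [wdM_congr_on (B := fun w => wdM 0 j (gam G i) w + gam G i w * gam G j w) hU hz
    (fun w hw => by rw [h1 i j w hw, h1 j i w hw, wdM_comm hU hG hw]), h2 j i] at h3
  rw [← sub_eq_zero] at h3 ⊢
  refine Eq.trans ?_ h3
  abel

/-- Since R is -∂̄Γ, this is the commutation of antiholomorphic derivatives; no connection term
appears in these directions. -/
theorem bianchi1 {z : Cn n} (hz : z ∈ U) (j k l : Fin n) :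
    wdM 1 l (fun w => curv G w j k) z = wdM 1 k (fun w => curv G w j l) z := by
  simp only [curv_eq, wdM_neg]
  rw [wdM_comm hU (smM_gam hU hG hu j) hz]

/-- The trace of the Bianchi identities: the commutators with the connection matrices have trace
zero. -/
theorem closed11_ric : Closed11 U (ric G) := by
  have hs := fun j k => smM_curv hU hG hu j k
  have e : ∀ τ i j k z, z ∈ U → wd τ i (fun w => ric G w j k) z =
      (wdM τ i (fun w => curv G w j k) z).trace := fun τ i j k z hz =>
    wd_trace ((hs j k).diff hU hz)
  refine ⟨smM_ric hU hG hu, fun z hz i j k => ?_, fun z hz l j k => ?_⟩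
  · rw [e _ _ _ _ _ hz, e _ _ _ _ _ hz]
    have := congrArg Matrix.trace (bianchi0 hU hG hu hz i j k)
    simp only [Matrix.trace_add, Matrix.trace_sub, Matrix.trace_mul_comm (curv G z j k),
      Matrix.trace_mul_comm (curv G z i k), add_sub_cancel_right] at this
    exact this
  · rw [e _ _ _ _ _ hz, e _ _ _ _ _ hz, bianchi1 hU hG hu hz]

end Metric

/-! ### Symmetries of the curvature of a Kähler metric. -/

section Kahler

variable {U : Set (Cn n)} (hU : IsOpen U) {G : Cn n → Matrix (Fin n) (Fin n) ℂ}
  (hG : Closed11 U G) (hu : ∀ w ∈ U, IsUnit (G w).det)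

include hU hG hu

/-- In `curv_mul` the indices p and j enter through ∂_j g_{ps̄} and its ∂̄-derivative, which are
symmetric because ω is closed. -/
theorem riem_symm0 {z : Cn n} (hz : z ∈ U) (p q j k : Fin n) :
    riem G z p q j k = riem G z j q p k := by
  have e : ∀ p q j k, riem G z p q j k = (curv G z j k * G z) p q := fun _ _ _ _ => rfl
  rw [e, e, curv_mul hU hG.smooth hu hz, curv_mul hU hG.smooth hu hz]
  have h1 : ∀ w ∈ U, ∀ s, wdM 0 j G w p s = wdM 0 p G w j s := fun w hw s => hG.closed0 w hw j p s
  simp only [Matrix.add_apply, Matrix.neg_apply, Matrix.mul_apply, h1 z hz]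
  congr 2
  exact wd_congr_on hU hz fun w hw => h1 w hw q

theorem riem_symm1 {z : Cn n} (hz : z ∈ U) (p q j k : Fin n) :
    riem G z p q j k = riem G z p k j q := by
  have e : ∀ p q j k, riem G z p q j k = (curv G z j k * G z) p q := fun _ _ _ _ => rfl
  rw [e, e, curv_mul hU hG.smooth hu hz, curv_mul hU hG.smooth hu hz]
  have h1 : ∀ w ∈ U, ∀ s, wdM 1 k G w s q = wdM 1 q G w s k := fun w hw s => hG.closed1 w hw k s q
  rw [wdM_comm hU hG.smooth hz 1 0 k j, wdM_comm hU hG.smooth hz 1 0 q j]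
  simp only [Matrix.add_apply, Matrix.neg_apply]
  rw [Matrix.mul_apply, Matrix.mul_apply]
  simp only [h1 z hz]
  congr 2
  exact wd_congr_on hU hz fun w hw => h1 w hw p

/-- `g^{jk̄} R_p{}^q{}_{jk̄}` is the Ricci endomorphism. -/
theorem sum_inv_curv {z : Cn n} (hz : z ∈ U) :
    ∑ j, ∑ k, (G z)⁻¹ k j • curv G z j k = ric G z * (G z)⁻¹ := by
  have hi : G z * (G z)⁻¹ = 1 := Matrix.mul_nonsing_inv _ (hu z hz)
  have h1 : ∀ p q, ∑ j, ∑ k, (G z)⁻¹ k j * riem G z p q j k = ric G z p q := by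
    intro p q
    -- The two symmetries together exchange the endomorphism indices with the form indices, so the
    -- contraction over j, k becomes the trace defining the Ricci curvature.
    have h2 : ∀ j k, riem G z p q j k = (curv G z p q * G z) j k := fun j k => by
      rw [riem_symm0 hU hG hu hz, riem_symm1 hU hG hu hz]; rfl
    simp only [h2]
    have h3 : ((curv G z p q * G z) * (G z)⁻¹).trace = ric G z p q := by
      rw [Matrix.mul_assoc, hi, Matrix.mul_one]; rfl
    rw [← h3]
    simp only [Matrix.trace, Matrix.diag, Matrix.mul_apply (M := curv G z p q * G z), mul_comm]
  have h4 : (∑ j, ∑ k, (G z)⁻¹ k j • curv G z j k) * G z = ric G z := by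
    ext p q
    simp only [Finset.sum_mul, smul_mul_assoc, Matrix.sum_apply, Matrix.smul_apply, smul_eq_mul]
    exact h1 p q
  rw [← h4, Matrix.mul_assoc, hi, Matrix.mul_one]

end Kahler

/-! ### Variation of the curvature -/

/-- The variation of the connection matrices under a variation `H` of the metric. -/
def dgam (G H : Cn n → Matrix (Fin n) (Fin n) ℂ) (j : Fin n) (z : Cn n) :
    Matrix (Fin n) (Fin n) ℂ :=
  wdM 0 j H z * (G z)⁻¹ - gam G j z * H z * (G z)⁻¹

/-- The variation of the curvature under a variation `H` of the metric. -/
def dcurv (G H : Cn n → Matrix (Fin n) (Fin n) ℂ) (z : Cn n) (j k : Fin n) :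
    Matrix (Fin n) (Fin n) ℂ :=
  -wdM 1 k (dgam G H j) z

/-- The t-derivative commutes with the Wirtinger derivatives, so the connection and then the
curvature can be differentiated term by term. The set Ω is where the matrices of the family are
smooth and invertible. -/
theorem hasDerivM_curv {Ω : Set (ℝ × Cn n)} (hΩ : IsOpen Ω)
    {A : ℝ × Cn n → Matrix (Fin n) (Fin n) ℂ} (hA : SmM A Ω) (hu : ∀ q ∈ Ω, IsUnit (A q).det)
    {t : ℝ} {z : Cn n} (hz : (t, z) ∈ Ω) {A' : Cn n → Matrix (Fin n) (Fin n) ℂ}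
    (hA' : ∀ w, (t, w) ∈ Ω → HasDerivM (fun s => A (s, w)) (A' w) t) (j k : Fin n) :
    HasDerivM (fun s => curv (fun w => A (s, w)) z j k) (dcurv (fun w => A (t, w)) A' z j k) t := by
  have hsm : SmM (fun q : ℝ × Cn n => gam (fun w => A (q.1, w)) j q.2) Ω :=
    (hA.wdM_slice hΩ 0 j).mul (hA.inv hu)
  have hU : IsOpen {w : Cn n | (t, w) ∈ Ω} := hΩ.preimage (Continuous.prodMk_right t)
  have hg : ∀ w, (t, w) ∈ Ω → HasDerivM (fun s => gam (fun w => A (s, w)) j w)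
      (dgam (fun w => A (t, w)) A' j w) t := by
    intro w hw
    have h1 : HasDerivM (fun s => wdM 0 j (fun w => A (s, w)) w) (wdM 0 j A' w) t := by
      intro p q
      have := hasDerivAt_wd_slice hΩ (hA p q) hw 0 j
      refine this.congr_deriv (wd_congr_on hU hw fun x hx => ?_)
      exact (hA' x hx p q).deriv
    have h2 := h1.mul ((hA' w hw).inv (hu _ hw))
    intro p q
    refine (h2 p q).congr_deriv ?_
    show (_ : Matrix (Fin n) (Fin n) ℂ) p q = (_ : Matrix (Fin n) (Fin n) ℂ) p q
    simp only [dgam, gam, mul_neg, Matrix.mul_assoc, sub_eq_add_neg]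
  intro p q
  have h3 := (hasDerivAt_wd_slice hΩ (hsm p q) hz 1 k).neg
  have e : ∀ s, curv (fun w => A (s, w)) z j k p q =
      -wd 1 k (fun w => gam (fun w => A (s, w)) j w p q) z := fun s => by
    rw [curv_eq]; rfl
  simp only [e]
  refine h3.congr_deriv ?_
  show -_ = -_
  congr 1
  exact wd_congr_on hU hz fun w hw => (hg w hw p q).deriv

section Metric

variable {U : Set (Cn n)} (hU : IsOpen U) {G H : Cn n → Matrix (Fin n) (Fin n) ℂ}
  (hG : SmM G U) (hu : ∀ w ∈ U, IsUnit (G w).det) (hH : SmM H U)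

include hU hG hu hH

theorem smM_dgam (j : Fin n) : SmM (dgam G H j) U :=
  ((hH.wdM hU 0 j).mul (hG.inv hu)).sub (((smM_gam hU hG hu j).mul hH).mul (hG.inv hu))

theorem smM_dcurv (j k : Fin n) : SmM (fun z => dcurv G H z j k) U :=
  ((smM_dgam hU hG hu hH j).wdM hU 1 k).neg

/-- The variation of the connection is the covariant derivative of the endomorphism v = HG⁻¹. -/
theorem dgam_eq {z : Cn n} (hz : z ∈ U) (j : Fin n) :
    dgam G H j z = wdM 0 j (fun w => H w * (G w)⁻¹) z + H z * (G z)⁻¹ * gam G j z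
      - gam G j z * (H z * (G z)⁻¹) := by
  rw [wdM_mul (hH.diff hU hz) ((hG.inv hu).diff hU hz), wdM_inv hU hG hu hz]
  simp only [dgam, gam, mul_neg, Matrix.mul_assoc, neg_add_cancel_right]

/-- Under the trace the commutator in `dgam_eq` disappears and only ∂̄∂ tr v is left. -/
theorem trace_dcurv {z : Cn n} (hz : z ∈ U) (j k : Fin n) :
    (dcurv G H z j k).trace = -hess (fun w => (H w * (G w)⁻¹).trace) z j k := by
  rw [dcurv, Matrix.trace_neg, ← wd_trace ((smM_dgam hU hG hu hH j).diff hU hz), hess_apply,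
    wd_comm hU (hH.mul (hG.inv hu)).trace hz]
  congr 1
  refine wd_congr_on hU hz fun w hw => ?_
  rw [dgam_eq hU hG hu hH hw, Matrix.trace_sub, Matrix.trace_add, Matrix.trace_mul_comm (gam G j w),
    add_sub_cancel_right, wd_trace ((hH.mul (hG.inv hu)).diff hU hw)]

end Metric

theorem lap_eq (G : Cn n → Matrix (Fin n) (Fin n) ℂ) (f : Cn n → ℂ) (z : Cn n) :
    lap G f z = (hess f z * (G z)⁻¹).trace := by
  simp only [lap, gInv, Matrix.trace, Matrix.diag, Matrix.mul_apply, mul_comm]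

theorem scal_eq (G : Cn n → Matrix (Fin n) (Fin n) ℂ) (z : Cn n) :
    scal G z = (ric G z * (G z)⁻¹).trace := by
  simp only [scal, gInv, Matrix.trace, Matrix.diag, Matrix.mul_apply, mul_comm]

/-- The contracted variation of the curvature of a Kähler metric under a closed variation. -/
theorem sum_inv_dcurv {U : Set (Cn n)} (hU : IsOpen U) {G H : Cn n → Matrix (Fin n) (Fin n) ℂ}
    (hG : Closed11 U G) (hu : ∀ w ∈ U, IsUnit (G w).det) (hH : Closed11 U H)
    {z : Cn n} (hz : z ∈ U) :
    ∑ j, ∑ k, (G z)⁻¹ k j • dcurv G H z j k =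
      ∑ j, ∑ k, ((G z)⁻¹ * H z * (G z)⁻¹) k j • curv G z j k
        - hess (fun w => (H w * (G w)⁻¹).trace) z * (G z)⁻¹
        - ric G z * (G z)⁻¹ * (H z * (G z)⁻¹) := by
  -- The line G + sH consists of closed tensors, so `sum_inv_curv` holds for every s near 0 at the
  -- point z; its derivative at s = 0 is the claim. `Ω` restricts to the points where the line is
  -- nondegenerate.
  let A : ℝ × Cn n → Matrix (Fin n) (Fin n) ℂ := fun q => G q.2 + (q.1 : ℂ) • H q.2
  let Ω₁ : Set (ℝ × Cn n) := Set.univ ×ˢ U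
  have hA : SmM A Ω₁ := by
    have h2 : ContDiffOn ℝ ∞ (fun q : ℝ × Cn n => q.2) Ω₁ := contDiffOn_snd
    have h3 : ContDiffOn ℝ ∞ (fun q : ℝ × Cn n => (q.1 : ℂ)) Ω₁ :=
      Complex.ofRealCLM.contDiff.comp_contDiffOn contDiffOn_fst
    intro p q
    exact ((hG.smooth p q).comp h2 fun x hx => hx.2).add
      (h3.mul ((hH.smooth p q).comp h2 fun x hx => hx.2))
  let Ω : Set (ℝ × Cn n) := Ω₁ ∩ {q | (A q).det ≠ 0}
  have hΩ : IsOpen Ω := hA.det.continuousOn.isOpen_inter_preimage (isOpen_univ.prod hU)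
    isOpen_compl_singleton
  have hAΩ : SmM A Ω := hA.mono Set.inter_subset_left
  have huΩ : ∀ q ∈ Ω, IsUnit (A q).det := fun q hq => isUnit_iff_ne_zero.2 hq.2
  have hA0 : ∀ w, A (0, w) = G w := fun w => by simp [A]
  have hG0 : (fun w => A (0, w)) = G := funext hA0
  have hzΩ : ((0 : ℝ), z) ∈ Ω := ⟨⟨trivial, hz⟩, by
    show (A (0, z)).det ≠ 0
    rw [hA0]; exact (hu z hz).ne_zero⟩
  have hd : ∀ w, HasDerivM (fun s => A (s, w)) (H w) 0 := fun w => hasDerivM_line (G w) (H w) 0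
  have hc : ∀ j k, HasDerivM (fun s => curv (fun w => A (s, w)) z j k) (dcurv G H z j k) 0 := by
    intro j k
    have := hasDerivM_curv hΩ hAΩ huΩ hzΩ (fun w _ => hd w) j k
    rwa [hG0] at this
  have hiv : HasDerivM (fun s => (A (s, z))⁻¹) (-((G z)⁻¹ * H z * (G z)⁻¹)) 0 := by
    have := (hd z).inv (huΩ _ hzΩ)
    simpa only [hA0] using this
  have hkey : ∀ᶠ s : ℝ in 𝓝 0, (∑ j, ∑ k, (A (s, z))⁻¹ k j • curv (fun w => A (s, w)) z j k) =
      (ric (fun w => A (s, w)) z) * (A (s, z))⁻¹ := by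
    have : ∀ᶠ s : ℝ in 𝓝 0, (s, z) ∈ Ω :=
      (Continuous.prodMk_left z).continuousAt.preimage_mem_nhds (hΩ.mem_nhds hzΩ)
    filter_upwards [this] with s hs
    have hUs : IsOpen {w : Cn n | (s, w) ∈ Ω} := hΩ.preimage (Continuous.prodMk_right s)
    refine sum_inv_curv hUs ?_ (fun w hw => huΩ _ hw) hs
    have : {w : Cn n | (s, w) ∈ Ω} ⊆ U := fun w hw => hw.1.2
    exact (hG.mono this).add hUs ((hH.mono this).smul hUs (s : ℂ))
  have hric : HasDerivM (fun s => ric (fun w => A (s, w)) z)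
      (-hess (fun w => (H w * (G w)⁻¹).trace) z) 0 := by
    intro j k
    have := (hc j k).trace
    rwa [trace_dcurv hU hG.smooth hu hH.smooth hz] at this
  have hR := hric.mul hiv
  ext p q
  have hL : HasDerivAt (fun s => (∑ j, ∑ k, (A (s, z))⁻¹ k j • curv (fun w => A (s, w)) z j k) p q)
      (∑ j, ∑ k, ((-((G z)⁻¹ * H z * (G z)⁻¹)) k j * curv G z j k p q
        + (G z)⁻¹ k j * dcurv G H z j k p q)) 0 := by
    simp only [Matrix.sum_apply, Matrix.smul_apply, smul_eq_mul]
    refine HasDerivAt.fun_sum fun j _ => HasDerivAt.fun_sum fun k _ => ?_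
    refine ((hiv k j).mul (hc j k p q)).congr_deriv ?_
    show _ * curv (fun w => A (0, w)) z j k p q + (A (0, z))⁻¹ k j * _ = _
    rw [hA0, hG0]
  have h5 := (hL.congr_of_eventuallyEq (f₁ := fun s => ((ric (fun w => A (s, w)) z) *
    (A (s, z))⁻¹) p q) (hkey.mono fun s hs => by
      show (_ : Matrix (Fin n) (Fin n) ℂ) p q = (_ : Matrix (Fin n) (Fin n) ℂ) p q
      rw [hs])).unique (hR p q)
  simp only [hA0, Finset.sum_add_distrib, Matrix.neg_apply, neg_mul, Finset.sum_neg_distrib,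
    Matrix.add_apply, mul_neg, Matrix.mul_assoc] at h5
  simp only [Matrix.sub_apply, Matrix.sum_apply, Matrix.smul_apply, smul_eq_mul, Matrix.mul_assoc]
  linear_combination h5

/-! ### Curvature contractions -/

theorem wd_conj (j : Fin n) (f : Cn n → ℂ) (z : Cn n) :
    (starRingEnd ℂ) (wd 0 j f z) = wd 1 j (fun w => (starRingEnd ℂ) (f w)) z := by
  have h : fderiv ℝ (fun w => (starRingEnd ℂ) (f w)) z =
      (Complex.conjCLE : ℂ →L[ℝ] ℂ).comp (fderiv ℝ f z) :=
    Complex.conjCLE.comp_fderiv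
  simp only [wd, h, wsign, map_mul, map_sub]
  simp
  exact Or.inl (map_ofNat _ 2)

/-- The matrix of a Kähler metric on an open subset of `ℂⁿ`. -/
structure IsKahler (U : Set (Cn n)) (G : Cn n → Matrix (Fin n) (Fin n) ℂ) : Prop where
  closed : Closed11 U G
  herm : ∀ w ∈ U, (G w).IsHermitian
  unit : ∀ w ∈ U, IsUnit (G w).det

/-- Conjugation exchanges ∂ and ∂̄ and transposes G, hence permutes the ingredients of `curv_mul`.
-/
theorem IsKahler.conj_riem {U : Set (Cn n)} (hU : IsOpen U)
    {G : Cn n → Matrix (Fin n) (Fin n) ℂ} (hG : IsKahler U G) {z : Cn n} (hz : z ∈ U)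
    (p q j k : Fin n) : (starRingEnd ℂ) (riem G z q p k j) = riem G z p q j k := by
  have h1 : ∀ w ∈ U, ∀ p q, (starRingEnd ℂ) (G w p q) = G w q p := fun w hw p q =>
    (hG.herm w hw).apply q p
  have h2 : ∀ w ∈ U, ∀ j, (wdM 0 j G w).conjTranspose = wdM 1 j G w := by
    intro w hw j
    ext p q
    show (starRingEnd ℂ) (wd 0 j (fun w => G w q p) w) = wd 1 j (fun w => G w p q) w
    rw [wd_conj]
    exact wd_congr_on hU hw fun x hx => h1 x hx q p
  have h3 : (wdM 1 j (wdM 0 k G) z).conjTranspose = wdM 1 k (wdM 0 j G) z := by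
    rw [wdM_comm hU hG.closed.smooth hz]
    ext p q
    show (starRingEnd ℂ) (wd 0 k (fun w => wdM 1 j G w q p) z) = wd 1 k (fun w => wdM 0 j G w p q) z
    rw [wd_conj]
    refine wd_congr_on hU hz fun x hx => ?_
    rw [← h2 x hx, Matrix.conjTranspose_apply]
    exact Complex.conj_conj _
  have h4 : (curv G z k j * G z).conjTranspose = curv G z j k * G z := by
    rw [curv_mul hU hG.closed.smooth hG.unit hz, curv_mul hU hG.closed.smooth hG.unit hz,
      Matrix.conjTranspose_add, Matrix.conjTranspose_neg, h3, Matrix.conjTranspose_mul,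
      Matrix.conjTranspose_mul, h2 z hz, (hG.herm z hz).inv.eq, ← h2 z hz j,
      Matrix.conjTranspose_conjTranspose, Matrix.mul_assoc]
  exact congrFun (congrFun h4 p) q

theorem inner11_eq (G : Cn n → Matrix (Fin n) (Fin n) ℂ) (z : Cn n)
    (α β : Matrix (Fin n) (Fin n) ℂ) :
    inner11 G z α β = (α * (G z)⁻¹ * (β * (G z)⁻¹)).trace := by
  have h : (α * (G z)⁻¹ * (β * (G z)⁻¹)).trace =
      ∑ j, ∑ r, (∑ l, α j l * (G z)⁻¹ l r) * ∑ k, β r k * (G z)⁻¹ k j := by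
    simp only [Matrix.trace, Matrix.diag, Matrix.mul_apply]
  rw [h]
  simp only [inner11, gInv, Finset.sum_mul_sum]
  refine Finset.sum_congr rfl fun j _ => ?_
  rw [Finset.sum_comm]
  refine Finset.sum_congr rfl fun r _ => ?_
  rw [Finset.sum_comm]
  exact Finset.sum_congr rfl fun l _ => Finset.sum_congr rfl fun k _ => by ring

section Point

variable {G : Cn n → Matrix (Fin n) (Fin n) ℂ} {z : Cn n}

theorem curv_apply (hu : IsUnit (G z).det) (j k p r : Fin n) :
    curv G z j k p r = ∑ q, riem G z p q j k * (G z)⁻¹ q r := by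
  have h : curv G z j k * G z * (G z)⁻¹ = curv G z j k := by
    rw [Matrix.mul_assoc, Matrix.mul_nonsing_inv _ hu, Matrix.mul_one]
  conv_lhs => rw [← h]
  rfl

theorem riemHessHess_eq (hu : IsUnit (G z).det) (ψ : Cn n → ℂ) :
    riemHessHess G ψ z = ∑ r, ∑ s, ((G z)⁻¹ * hess ψ z * (G z)⁻¹) s r *
      (curv G z r s * (hess ψ z * (G z)⁻¹)).trace := by
  simp only [Matrix.trace, Matrix.diag, Matrix.mul_apply, curv_apply hu, Finset.mul_sum,
    Finset.sum_mul]
  simp only [riemHessHess, gInv, ← Fintype.sum_prod_type']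
  -- Both sides are sums over the same eight indices; `e` matches their names.
  let e : (Fin n × Fin n × Fin n × Fin n × Fin n × Fin n × Fin n × Fin n) ≃
      (Fin n × Fin n × Fin n × Fin n × Fin n × Fin n × Fin n × Fin n) :=
    { toFun := fun ⟨i, j, k, l, p, q, r, s⟩ => ⟨r, s, p, i, j, q, l, k⟩
      invFun := fun ⟨r, s, p, i, j, q, l, k⟩ => ⟨i, j, k, l, p, q, r, s⟩
      left_inv := fun _ => rfl
      right_inv := fun _ => rfl }
  refine Fintype.sum_equiv e _ _ fun x => ?_
  simp only [e, Equiv.coe_fn_mk]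
  ring

theorem IsKahler.riemSq_eq {U : Set (Cn n)} (hU : IsOpen U) (hG : IsKahler U G) (hz : z ∈ U) :
    riemSq G z = ∑ j, ∑ k, ∑ r, ∑ s, (curv G z j k * curv G z r s).trace *
      ((G z)⁻¹ k r * (G z)⁻¹ s j) := by
  simp only [Matrix.trace, Matrix.diag, Matrix.mul_apply, curv_apply (hG.unit z hz), Finset.mul_sum,
    Finset.sum_mul]
  simp only [riemSq, gInv, hG.conj_riem hU hz, ← Fintype.sum_prod_type']
  let e : (Fin n × Fin n × Fin n × Fin n × Fin n × Fin n × Fin n × Fin n) ≃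
      (Fin n × Fin n × Fin n × Fin n × Fin n × Fin n × Fin n × Fin n) :=
    { toFun := fun ⟨p, q, j, k, a, b, c, d⟩ => ⟨j, k, c, d, p, a, b, q⟩
      invFun := fun ⟨j, k, c, d, p, a, b, q⟩ => ⟨p, q, j, k, a, b, c, d⟩
      left_inv := fun _ => rfl
      right_inv := fun _ => rfl }
  refine Fintype.sum_equiv e _ _ fun x => ?_
  simp only [e, Equiv.coe_fn_mk]
  ring

theorem form11_mul_form11 (A B : Matrix (Fin n) (Fin n) ℂ) :
    form11 A * form11 B = -(kf A * kf B) := by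
  simp only [kf, smul_mul_smul_comm, Complex.I_mul_I, neg_one_smul, neg_neg]

/-- The coefficient -1/8 becomes +1/8 because the Ricci form contains a factor i, which squares to
-1. -/
theorem chernWeil_td2 (G : Cn n → Matrix (Fin n) (Fin n) ℂ) (z : Cn n) :
    chernWeil td2Polar G z =
      (1 / 8 : ℂ) • ricForm G z ^ 2 + (1 / 24 : ℂ) • chernWeil trace2 G z := by
  have h1 : chernWeil td2Polar G z = form22 fun j k r s =>
      -(1 / 8) * (ric G z j k * ric G z r s) +
        (1 / 24) * trace2 (curv G z j k) (curv G z r s) := by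
    rw [chernWeil_eq]; simp only [td2Polar_eq]; rfl
  rw [h1, form22_add, form22_smul, form22_smul, form22_mul, form11_mul_form11, ← chernWeil_eq]
  congr 1
  rw [pow_two]
  simp only [smul_neg, neg_smul, neg_neg]
  rfl

theorem sum_inv_ric {U : Set (Cn n)} (hU : IsOpen U) (hG : IsKahler U G)
    (hz : z ∈ U) (B : Matrix (Fin n) (Fin n) ℂ) :
    ∑ j, ∑ k, (curv G z j k * B).trace * (G z)⁻¹ k j = (ric G z * (G z)⁻¹ * B).trace := by
  rw [← sum_inv_curv hU hG.closed hG.unit hz]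
  simp only [Finset.sum_mul, smul_mul_assoc, Matrix.trace_sum, Matrix.trace_smul, smul_eq_mul,
    mul_comm]

/-- In `topL_form22` the direct contraction of Tr(R ∧ R) gives |Ric|², by the Kähler symmetries, and
the crossed contraction gives |R|²; the overall sign is i². -/
theorem IsKahler.topL_trace2 {U : Set (Cn n)} (hU : IsOpen U) (hG : IsKahler U G) (hz : z ∈ U) :
    topL n (chernWeil trace2 G z * powFact (omega G z) 2) =
      vd (G z) * (riemSq G z - ricSq G z) := by
  have hu := hG.unit z hz
  rw [chernWeil_eq, omega_eq, topL_form22 hu, hG.riemSq_eq hU hz, ricSq, inner11_eq]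
  have h1 : ∑ j, ∑ k, ∑ r, ∑ s, (curv G z j k * curv G z r s).trace *
      ((G z)⁻¹ k j * (G z)⁻¹ s r) = (ric G z * (G z)⁻¹ * (ric G z * (G z)⁻¹)).trace := by
    rw [← sum_inv_ric hU hG hz]
    refine Finset.sum_congr rfl fun j _ => Finset.sum_congr rfl fun k _ => ?_
    rw [Matrix.trace_mul_comm, ← sum_inv_ric hU hG hz, Finset.sum_mul]
    refine Finset.sum_congr rfl fun r _ => ?_
    rw [Finset.sum_mul]
    refine Finset.sum_congr rfl fun s _ => ?_
    rw [Matrix.trace_mul_comm]; ring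
  simp only [trace2, mul_sub, Finset.sum_sub_distrib, h1]
  ring

/-- The part Ric²/8 contributes (S² - |Ric|²)/8 and Tr(R²)/24 contributes (|R|² - |Ric|²)/24. The
sum is a₂ without its Laplacian term. -/
theorem IsKahler.topL_td2 {U : Set (Cn n)} (hU : IsOpen U) (hG : IsKahler U G) (hz : z ∈ U) :
    topL n (chernWeil td2Polar G z * powFact (omega G z) 2) =
      vd (G z) * ((1 / 24) * quadCurv G z) := by
  have h1 := topL_two (hG.unit z hz) (ric G z) (ric G z)
  rw [← pow_two] at h1
  have h2 : topL n (ricForm G z ^ 2 * powFact (omega G z) 2) =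
      vd (G z) * (scal G z ^ 2 - ricSq G z) := by
    rw [scal_eq, ricSq, inner11_eq, pow_two (Matrix.trace _)]; exact h1
  rw [chernWeil_td2, add_mul, map_add, smul_mul_assoc, smul_mul_assoc, map_smul, map_smul,
    hG.topL_trace2 hU hz, h2, quadCurv]
  simp only [smul_eq_mul]
  ring

end Point

/-! ### Closed forms -/

/-- The mechanism behind all closedness statements: a derivative symmetric in two indices is summed
against a product of covectors antisymmetric in them. -/
theorem sum_eq_zero_of_anti {X : Type*} [Fintype X] (e : X ≃ X) {f : X → ℂ}
    (h : ∀ x, f (e x) = -f x) : ∑ x, f x = 0 := by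
  have h1 := e.sum_comp f
  simp only [h, Finset.sum_neg_distrib] at h1
  exact self_eq_neg.1 h1.symm

/-- Closedness of a form-valued function under `∂` and `∂̄`, tested on linear functionals. -/
def ClosedF (U : Set (Cn n)) (Θ : Cn n → Form n) : Prop :=
  ∀ z ∈ U, ∀ (τ : Fin 2) (l : Form n →ₗ[ℂ] ℂ), ∑ i, wd τ i (fun w => l (dw τ i * Θ w)) z = 0

/-- The functional `x ↦ l (a * x)`. -/
def lmul (l : Form n →ₗ[ℂ] ℂ) (a : Form n) : Form n →ₗ[ℂ] ℂ := l ∘ₗ LinearMap.mulLeft ℂ a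

/-- The functional `x ↦ l (x * a)`. -/
def rmul (l : Form n →ₗ[ℂ] ℂ) (a : Form n) : Form n →ₗ[ℂ] ℂ := l ∘ₗ LinearMap.mulRight ℂ a

@[simp] theorem lmul_apply (l : Form n →ₗ[ℂ] ℂ) (a x : Form n) : lmul l a x = l (a * x) := rfl
@[simp] theorem rmul_apply (l : Form n →ₗ[ℂ] ℂ) (a x : Form n) : rmul l a x = l (x * a) := rfl

section

variable {U : Set (Cn n)} (hU : IsOpen U) {z : Cn n} (hz : z ∈ U)

include hU hz

theorem ContDiffOn.diffAt {f : Cn n → ℂ} (hf : ContDiffOn ℝ ∞ f U) : DifferentiableAt ℝ f z :=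
  (hf.contDiffAt (hU.mem_nhds hz)).differentiableAt (by simp)

theorem wd_lin_mul {η ξ : Cn n → Form n} (hη : SmF η U) (hξ : SmF ξ U) (l : Form n →ₗ[ℂ] ℂ)
    (τ : Fin 2) (i : Fin n) :
    wd τ i (fun w => l (η w * ξ w)) z =
      wd τ i (fun w => l (η w * ξ z)) z + wd τ i (fun w => l (η z * ξ w)) z := by
  have dη := fun a => ContDiffOn.diffAt hU hz (hη ((formBasis n).coord a))
  have dξ := fun a => ContDiffOn.diffAt hU hz (hξ ((formBasis n).coord a))
  simp only [fun w => lin_mul_eq l (η w) (ξ w), fun w => lin_mul_eq l (η w) (ξ z),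
    fun w => lin_mul_eq l (η z) (ξ w)]
  have d1 : ∀ a b, DifferentiableAt ℝ (fun w => (formBasis n).coord a (η w) *
      (formBasis n).coord b (ξ w) * l (formBasis n a * formBasis n b)) z := fun a b =>
    ((dη a).mul (dξ b)).mul_const _
  have d2 : ∀ a b, DifferentiableAt ℝ (fun w => (formBasis n).coord a (η w) *
      (formBasis n).coord b (ξ z) * l (formBasis n a * formBasis n b)) z := fun a b =>
    ((dη a).mul_const _).mul_const _
  have d3 : ∀ a b, DifferentiableAt ℝ (fun w => (formBasis n).coord a (η z) *
      (formBasis n).coord b (ξ w) * l (formBasis n a * formBasis n b)) z := fun a b =>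
    ((dξ b).const_mul _).mul_const _
  rw [wd_sum _ fun a _ => DifferentiableAt.fun_sum fun b _ => d1 a b,
    wd_sum _ fun a _ => DifferentiableAt.fun_sum fun b _ => d2 a b,
    wd_sum _ fun a _ => DifferentiableAt.fun_sum fun b _ => d3 a b, ← Finset.sum_add_distrib]
  refine Finset.sum_congr rfl fun a _ => ?_
  rw [wd_sum _ fun b _ => d1 a b, wd_sum _ fun b _ => d2 a b, wd_sum _ fun b _ => d3 a b,
    ← Finset.sum_add_distrib]
  refine Finset.sum_congr rfl fun b _ => ?_
  rw [wd_mul_const (f := fun w => (formBasis n).coord a (η w) * (formBasis n).coord b (ξ w)) _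
    ((dη a).mul (dξ b)), wd_mul_const _ ((dη a).mul_const _),
    wd_mul_const _ ((dξ b).const_mul _), wd_mul (dη a) (dξ b), wd_mul_const _ (dη a),
    wd_const_mul _ (dξ b)]
  ring

end

namespace ClosedF

variable {U : Set (Cn n)} (hU : IsOpen U) {Θ Ξ : Cn n → Form n}

theorem const_smul (c : ℂ) (hΘ : ClosedF U Θ) : ClosedF U fun w => c • Θ w := by
  intro z hz τ l
  have := hΘ z hz τ (c • l)
  simpa only [mul_smul_comm, map_smul, LinearMap.smul_apply] using this

theorem one : ClosedF U fun _ => 1 := fun z _ τ l => by simp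

theorem zero : ClosedF U fun _ => 0 := fun z _ τ l => by simp

include hU

theorem add (hΘ : ClosedF U Θ) (hΞ : ClosedF U Ξ) (sΘ : SmF Θ U) (sΞ : SmF Ξ U) :
    ClosedF U fun w => Θ w + Ξ w := by
  intro z hz τ l
  refine Eq.trans ?_ ((congrArg₂ (· + ·) (hΘ z hz τ l) (hΞ z hz τ l)).trans (add_zero 0))
  rw [← Finset.sum_add_distrib]
  refine Finset.sum_congr rfl fun i _ => ?_
  simp only [mul_add, map_add]
  exact wd_add (ContDiffOn.diffAt hU hz (sΘ (lmul l _))) (ContDiffOn.diffAt hU hz (sΞ (lmul l _)))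

/-- The Leibniz rule, with one factor frozen at z in each term. No sign occurs because Θ is central
and can be moved past the covector. -/
theorem mul (hΘ : ClosedF U Θ) (hΞ : ClosedF U Ξ) (sΘ : SmF Θ U) (sΞ : SmF Ξ U)
    (cΘ : ∀ z, Θ z ∈ Subalgebra.center ℂ (Form n)) : ClosedF U fun w => Θ w * Ξ w := by
  intro z hz τ l
  have h1 := hΘ z hz τ (rmul l (Ξ z))
  have h2 := hΞ z hz τ (lmul l (Θ z))
  refine Eq.trans ?_ ((congrArg₂ (· + ·) h1 h2).trans (add_zero 0))
  rw [← Finset.sum_add_distrib]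
  refine Finset.sum_congr rfl fun i _ => ?_
  have e : (fun w => l (dw τ i * (Θ w * Ξ w))) = fun w => lmul l (dw τ i) (Θ w * Ξ w) := rfl
  rw [e, wd_lin_mul hU hz sΘ sΞ]
  simp only [lmul_apply, rmul_apply, mul_assoc]
  congr 2
  funext w
  rw [← mul_assoc, center_comm (cΘ z), mul_assoc]

theorem pow (hΘ : ClosedF U Θ) (sΘ : SmF Θ U)
    (cΘ : ∀ z, Θ z ∈ Subalgebra.center ℂ (Form n)) (m : ℕ) : ClosedF U fun w => Θ w ^ m := by
  induction m with
  | zero => simpa using one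
  | succ m ih =>
    simp only [pow_succ]
    exact mul hU ih hΘ (sΘ.pow m) sΘ fun z => pow_mem (cΘ z) m

theorem powFact (hΘ : ClosedF U Θ) (sΘ : SmF Θ U)
    (cΘ : ∀ z, Θ z ∈ Subalgebra.center ℂ (Form n)) (k : ℕ) :
    ClosedF U fun w => powFact (Θ w) k := by
  unfold Kahler.powFact
  split_ifs
  · exact const_smul _ (pow hU hΘ sΘ cΘ _)
  · exact zero

theorem form11 {A : Cn n → Matrix (Fin n) (Fin n) ℂ} (hA : Closed11 U A) :
    ClosedF U fun w => form11 (A w) := by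
  intro z hz τ l
  have dA := hA.smooth.diff hU hz
  have h1 : ∀ i, wd τ i (fun w => l (dw τ i * Kahler.form11 (A w))) z =
      ∑ j, ∑ k, wd τ i (fun w => A w j k) z * l (dw τ i * (dz j * dzb k)) := by
    intro i
    simp only [Kahler.form11, Finset.mul_sum, map_sum, mul_smul_comm, map_smul, smul_eq_mul]
    rw [wd_sum _ fun j _ => DifferentiableAt.fun_sum fun k _ => (dA j k).mul_const _]
    refine Finset.sum_congr rfl fun j _ => ?_
    rw [wd_sum _ fun k _ => (dA j k).mul_const _]
    exact Finset.sum_congr rfl fun k _ => wd_mul_const _ (dA j k)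
  simp only [h1, ← Fintype.sum_prod_type']
  fin_cases τ
  · refine sum_eq_zero_of_anti ⟨fun ⟨i, j, k⟩ => ⟨j, i, k⟩, fun ⟨i, j, k⟩ => ⟨j, i, k⟩,
      fun _ => rfl, fun _ => rfl⟩ fun ⟨i, j, k⟩ => ?_
    simp only [Equiv.coe_fn_mk, Fin.zero_eta, dz_eq_dw, ← mul_assoc]
    rw [hA.closed0 z hz j i k, dw_anticomm 0 0 j i, neg_mul, map_neg, mul_neg]
  · refine sum_eq_zero_of_anti ⟨fun ⟨i, j, k⟩ => ⟨k, j, i⟩, fun ⟨i, j, k⟩ => ⟨k, j, i⟩,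
      fun _ => rfl, fun _ => rfl⟩ fun ⟨i, j, k⟩ => ?_
    simp only [Equiv.coe_fn_mk, Fin.mk_one, dz_eq_dw, dzb_eq_dw]
    rw [hA.closed1 z hz k j i, dw_anticomm 0 1 j i, dw_anticomm 0 1 j k, mul_neg, mul_neg,
      ← mul_assoc, ← mul_assoc, dw_anticomm 1 1 k i]
    simp

/-- A `(2,2)`-form is closed if its derivatives split into parts symmetric in the relevant pairs
of indices. -/
theorem form22 {Φ : Cn n → Fin n → Fin n → Fin n → Fin n → ℂ}
    (sΦ : ∀ j k r s, ContDiffOn ℝ ∞ (fun w => Φ w j k r s) U)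
    (h0 : ∀ z ∈ U, ∃ a b : Fin n → Fin n → Fin n → Fin n → Fin n → ℂ,
      (∀ i j k r s, wd 0 i (fun w => Φ w j k r s) z = a i j k r s + b i j k r s) ∧
      (∀ i j k r s, a i j k r s = a j i k r s) ∧ (∀ i j k r s, b i j k r s = b r j k i s))
    (h1 : ∀ z ∈ U, ∃ a b : Fin n → Fin n → Fin n → Fin n → Fin n → ℂ,
      (∀ i j k r s, wd 1 i (fun w => Φ w j k r s) z = a i j k r s + b i j k r s) ∧
      (∀ i j k r s, a i j k r s = a k j i r s) ∧ (∀ i j k r s, b i j k r s = b s j k r i)) :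
    ClosedF U fun w => form22 (Φ w) := by
  intro z hz τ l
  have dA := fun j k r s => ContDiffOn.diffAt hU hz (sΦ j k r s)
  have h2 : ∀ i, wd τ i (fun w => l (dw τ i * Kahler.form22 (Φ w))) z =
      ∑ j, ∑ k, ∑ r, ∑ s, wd τ i (fun w => Φ w j k r s) z *
        l (dw τ i * ((dz j * dzb k) * (dz r * dzb s))) := by
    intro i
    have e : ∀ w, l (dw τ i * Kahler.form22 (Φ w)) =
        ∑ x : Fin n × Fin n × Fin n × Fin n, Φ w x.1 x.2.1 x.2.2.1 x.2.2.2 *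
          l (dw τ i * ((dz x.1 * dzb x.2.1) * (dz x.2.2.1 * dzb x.2.2.2))) := by
      intro w
      simp only [Kahler.form22, Finset.mul_sum, map_sum, mul_smul_comm, map_smul, smul_eq_mul,
        Fintype.sum_prod_type, mul_assoc]
    simp only [e]
    rw [wd_sum _ fun x _ => (dA _ _ _ _).mul_const _]
    simp only [Fintype.sum_prod_type]
    exact Finset.sum_congr rfl fun j _ => Finset.sum_congr rfl fun k _ =>
      Finset.sum_congr rfl fun r _ => Finset.sum_congr rfl fun s _ => wd_mul_const _ (dA _ _ _ _)
  have hswap : ∀ (i j k r s : Fin n), dw τ i * ((dz j * dzb k) * (dz r * dzb s)) =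
      dw τ i * ((dz r * dzb s) * (dz j * dzb k)) := fun i j k r s => by
    rw [center_comm (dz_mul_dzb_mem_center r s)]
  simp only [h2]
  fin_cases τ
  · obtain ⟨a, b, hab, ha, hb⟩ := h0 z hz
    have hanti : ∀ i j k : Fin n, dw 0 i * (dz j * dzb k) = -(dw 0 j * (dz i * dzb k)) := by
      intro i j k
      simp only [dz_eq_dw, ← mul_assoc]
      rw [dw_anticomm 0 0 i j, neg_mul]
    simp only [Fin.zero_eta] at hswap ⊢
    simp only [hab, add_mul, Finset.sum_add_distrib, ← Fintype.sum_prod_type']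
    refine (congrArg₂ (· + ·) ?_ ?_).trans (add_zero 0)
    · refine sum_eq_zero_of_anti ⟨fun ⟨i, j, k, r, s⟩ => ⟨j, i, k, r, s⟩,
        fun ⟨i, j, k, r, s⟩ => ⟨j, i, k, r, s⟩, fun _ => rfl, fun _ => rfl⟩
        fun ⟨i, j, k, r, s⟩ => ?_
      simp only [Equiv.coe_fn_mk]
      rw [ha j i, ← mul_assoc, hanti j i, neg_mul, map_neg, mul_neg, mul_assoc]
    · refine sum_eq_zero_of_anti ⟨fun ⟨i, j, k, r, s⟩ => ⟨r, j, k, i, s⟩,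
        fun ⟨i, j, k, r, s⟩ => ⟨r, j, k, i, s⟩, fun _ => rfl, fun _ => rfl⟩
        fun ⟨i, j, k, r, s⟩ => ?_
      simp only [Equiv.coe_fn_mk]
      rw [hb r, hswap, hswap i, ← mul_assoc, hanti r i, neg_mul, map_neg, mul_neg, mul_assoc]
  · obtain ⟨a, b, hab, ha, hb⟩ := h1 z hz
    have hanti : ∀ i j k : Fin n, dw 1 i * (dz j * dzb k) = -(dw 1 k * (dz j * dzb i)) := by
      intro i j k
      simp only [dz_eq_dw, dzb_eq_dw]
      rw [dw_anticomm 0 1 j i, dw_anticomm 0 1 j k, mul_neg, mul_neg,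
        ← mul_assoc, ← mul_assoc, dw_anticomm 1 1 k i]
      simp
    simp only [Fin.mk_one] at hswap ⊢
    simp only [hab, add_mul, Finset.sum_add_distrib, ← Fintype.sum_prod_type']
    refine (congrArg₂ (· + ·) ?_ ?_).trans (add_zero 0)
    · refine sum_eq_zero_of_anti ⟨fun ⟨i, j, k, r, s⟩ => ⟨k, j, i, r, s⟩,
        fun ⟨i, j, k, r, s⟩ => ⟨k, j, i, r, s⟩, fun _ => rfl, fun _ => rfl⟩
        fun ⟨i, j, k, r, s⟩ => ?_
      simp only [Equiv.coe_fn_mk]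
      rw [ha k, ← mul_assoc, hanti k j i, neg_mul, map_neg, mul_neg, mul_assoc]
    · refine sum_eq_zero_of_anti ⟨fun ⟨i, j, k, r, s⟩ => ⟨s, j, k, r, i⟩,
        fun ⟨i, j, k, r, s⟩ => ⟨s, j, k, r, i⟩, fun _ => rfl, fun _ => rfl⟩
        fun ⟨i, j, k, r, s⟩ => ?_
      simp only [Equiv.coe_fn_mk]
      rw [hb s, hswap, hswap i, ← mul_assoc, hanti s r i, neg_mul, map_neg, mul_neg, mul_assoc]

/-- The form `Tr(R ∧ R)` is closed. -/
theorem chernWeil_trace2 {G : Cn n → Matrix (Fin n) (Fin n) ℂ} (hG : SmM G U)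
    (hu : ∀ w ∈ U, IsUnit (G w).det) : ClosedF U (chernWeil trace2 G) := by
  have sR := fun j k => smM_curv hU hG hu j k
  have hw : ∀ z ∈ U, ∀ τ i j k r s, wd τ i (fun w => trace2 (curv G w j k) (curv G w r s)) z =
      (wdM τ i (fun w => curv G w j k) z * curv G z r s).trace +
        (curv G z j k * wdM τ i (fun w => curv G w r s) z).trace := by
    intro z hz τ i j k r s
    have h := wd_trace (τ := τ) (j := i) (((sR j k).diff hU hz).mul ((sR r s).diff hU hz))
    rw [wdM_mul ((sR j k).diff hU hz) ((sR r s).diff hU hz), Matrix.trace_add] at h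
    exact h
  refine form22 hU (Φ := fun w j k r s => trace2 (curv G w j k) (curv G w r s))
    (fun j k r s => ((sR j k).mul (sR r s)).trace) (fun z hz => ?_) (fun z hz => ?_)
  · let D : Fin n → Fin n → Fin n → Matrix (Fin n) (Fin n) ℂ := fun i j k =>
      wdM 0 i (fun w => curv G w j k) z + curv G z j k * gam G i z - gam G i z * curv G z j k
    have hD : ∀ i j k, D i j k = D j i k := fun i j k => bianchi0 hU hG hu hz i j k
    refine ⟨fun i j k r s => (D i j k * curv G z r s).trace,
      fun i j k r s => (curv G z j k * D i r s).trace, fun i j k r s => ?_,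
      fun i j k r s => ?_, fun i j k r s => ?_⟩
    · rw [hw z hz]
      simp only [D, Matrix.sub_mul, Matrix.mul_sub, Matrix.add_mul, Matrix.mul_add,
        Matrix.trace_add, Matrix.trace_sub]
      have e1 : (gam G i z * curv G z j k * curv G z r s).trace =
          (curv G z j k * (curv G z r s * gam G i z)).trace := by
        rw [Matrix.mul_assoc, Matrix.trace_mul_comm, Matrix.mul_assoc]
      rw [e1, Matrix.mul_assoc (curv G z j k)]
      ring
    · simp only [hD i j k]
    · simp only [hD i r s]
  · refine ⟨fun i j k r s => (wdM 1 i (fun w => curv G w j k) z * curv G z r s).trace,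
      fun i j k r s => (curv G z j k * wdM 1 i (fun w => curv G w r s) z).trace,
      fun i j k r s => hw z hz 1 i j k r s, fun i j k r s => ?_, fun i j k r s => ?_⟩
    · simp only [bianchi1 hU hG hu hz j k i]
    · simp only [bianchi1 hU hG hu hz r s i]

end ClosedF

/-! ### Divergence identities -/

theorem del_eq (f : Cn n → ℂ) (z : Cn n) : del f z = ∑ j, wd 0 j f z • dz j := rfl

theorem delbar_eq (f : Cn n → ℂ) (z : Cn n) : delbar f z = ∑ j, wd 1 j f z • dzb j := by
  simp only [delbar, pzb_eq_wd]

theorem del_mul_delbar (f h : Cn n → ℂ) (z : Cn n) :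
    del f z * delbar h z = ∑ j, ∑ k, (wd 0 j f z * wd 1 k h z) • (dz j * dzb k) := by
  simp only [del_eq, delbar_eq, Finset.sum_mul_sum, smul_mul_smul_comm]

section

variable {U : Set (Cn n)} (hU : IsOpen U) {Θ : Cn n → Form n} (hΘ : ClosedF U Θ) (sΘ : SmF Θ U)
  (l : Form n →ₗ[ℂ] ℂ) {z : Cn n} (hz : z ∈ U)

include hU hΘ sΘ hz

/-- The divergence of `∑_k c_k dz^j ∧ dz̄^k ∧ Θ`. -/
theorem div0 {c : Fin n → Cn n → ℂ} (hc : ∀ k, ContDiffOn ℝ ∞ (c k) U) :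
    ∑ j, wd 0 j (fun w => ∑ k, c k w * l (dz j * dzb k * Θ w)) z =
      ∑ j, ∑ k, wd 0 j (c k) z * l (dz j * dzb k * Θ z) := by
  have h1 : ∀ j, wd 0 j (fun w => ∑ k, c k w * l (dz j * dzb k * Θ w)) z =
      ∑ k, (wd 0 j (c k) z * l (dz j * dzb k * Θ z)
        + c k z * wd 0 j (fun w => l (dz j * dzb k * Θ w)) z) := by
    intro j
    have d1 := fun k => ContDiffOn.diffAt hU hz (hc k)
    have d2 := fun k => ContDiffOn.diffAt hU hz (sΘ (lmul l (dz j * dzb k)))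
    refine (wd_sum (f := fun k w => c k w * l (dz j * dzb k * Θ w)) _
      fun k _ => (d1 k).mul (d2 k)).trans ?_
    exact Finset.sum_congr rfl fun k _ => wd_mul (d1 k) (d2 k)
  simp only [h1, Finset.sum_add_distrib]
  rw [add_eq_left, Finset.sum_comm]
  refine Finset.sum_eq_zero fun k _ => ?_
  rw [← Finset.mul_sum]
  have h2 := hΘ z hz 0 (lmul l (-dzb k))
  have h3 : ∀ j w, lmul l (-dzb k) (dw 0 j * Θ w) = l (dz j * dzb k * Θ w) := by
    intro j w
    rw [lmul_apply, ← mul_assoc, dz_eq_dw, dzb_eq_dw, dw_anticomm 0 1, neg_mul]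
  simp only [h3] at h2
  rw [h2, mul_zero]

/-- The conjugate divergence of `∑_j c_j dz^j ∧ dz̄^k ∧ Θ`. -/
theorem div1 {c : Fin n → Cn n → ℂ} (hc : ∀ k, ContDiffOn ℝ ∞ (c k) U) :
    ∑ k, wd 1 k (fun w => ∑ j, c j w * l (dz j * dzb k * Θ w)) z =
      ∑ j, ∑ k, wd 1 k (c j) z * l (dz j * dzb k * Θ z) := by
  have h1 : ∀ k, wd 1 k (fun w => ∑ j, c j w * l (dz j * dzb k * Θ w)) z =
      ∑ j, (wd 1 k (c j) z * l (dz j * dzb k * Θ z)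
        + c j z * wd 1 k (fun w => l (dz j * dzb k * Θ w)) z) := by
    intro k
    have d1 := fun k => ContDiffOn.diffAt hU hz (hc k)
    have d2 := fun j => ContDiffOn.diffAt hU hz (sΘ (lmul l (dz j * dzb k)))
    refine (wd_sum (f := fun j w => c j w * l (dz j * dzb k * Θ w)) _
      fun j _ => (d1 j).mul (d2 j)).trans ?_
    exact Finset.sum_congr rfl fun j _ => wd_mul (d1 j) (d2 j)
  simp only [h1, Finset.sum_add_distrib]
  rw [Finset.sum_comm (f := fun k j => c j z * wd 1 k (fun w => l (dz j * dzb k * Θ w)) z),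
    Finset.sum_comm, add_eq_left]
  refine Finset.sum_eq_zero fun j _ => ?_
  rw [← Finset.mul_sum]
  have h2 := hΘ z hz 1 (lmul l (dz j))
  have h3 : ∀ k w, lmul l (dz j) (dw 1 k * Θ w) = l (dz j * dzb k * Θ w) := by
    intro j w
    rw [lmul_apply, ← mul_assoc]; rfl
  simp only [h3] at h2
  rw [h2, mul_zero]

/-- The left side is ∂(F ∂̄h ∧ Θ) in coordinates. The conjugate version `div_parts1` uses the
primitive -h ∂F, which produces the same gradient term. -/
theorem div_parts0 {F h : Cn n → ℂ} (hF : ContDiffOn ℝ ∞ F U) (hh : ContDiffOn ℝ ∞ h U) :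
    ∑ j, wd 0 j (fun w => l (dw 0 j * (F w • delbar h w * Θ w))) z =
      l ((F z • form11 (hess h z) + del F z * delbar h z) * Θ z) := by
  have e : ∀ j w, l (dw 0 j * (F w • delbar h w * Θ w)) =
      ∑ k, (F w * wd 1 k h w) * l (dz j * dzb k * Θ w) := by
    intro j w
    simp only [delbar_eq, Finset.smul_sum, Finset.sum_mul, Finset.mul_sum, smul_smul,
      smul_mul_assoc, mul_smul_comm, map_sum, map_smul, smul_eq_mul, ← mul_assoc, dz_eq_dw]
  have hw := fun k => contDiffOn_wd hU hh 1 k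
  simp only [e]
  rw [div0 hU hΘ sΘ l hz (c := fun k w => F w * wd 1 k h w) fun k => hF.mul (hw k)]
  rw [del_mul_delbar, form11]
  simp only [Finset.smul_sum, smul_smul, ← Finset.sum_add_distrib, ← add_smul, Finset.sum_mul,
    smul_mul_assoc, map_sum, map_smul, smul_eq_mul, hess_apply]
  refine Finset.sum_congr rfl fun j _ => Finset.sum_congr rfl fun k _ => ?_
  rw [wd_mul (ContDiffOn.diffAt hU hz hF) (ContDiffOn.diffAt hU hz (hw k))]
  ring

theorem div_parts1 {F h : Cn n → ℂ} (hF : ContDiffOn ℝ ∞ F U) (hh : ContDiffOn ℝ ∞ h U) :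
    ∑ k, wd 1 k (fun w => l (dw 1 k * (-(h w • del F w) * Θ w))) z =
      l ((h z • form11 (hess F z) + del F z * delbar h z) * Θ z) := by
  have e : ∀ k w, l (dw 1 k * (-(h w • del F w) * Θ w)) =
      ∑ j, (h w * wd 0 j F w) * l (dz j * dzb k * Θ w) := by
    intro k w
    simp only [del_eq, Finset.smul_sum, Finset.sum_mul, Finset.mul_sum, smul_smul,
      smul_mul_assoc, mul_smul_comm, map_sum, map_smul, smul_eq_mul, ← mul_assoc, neg_mul, mul_neg,
      map_neg, dz_eq_dw, dzb_eq_dw, ← Finset.sum_neg_distrib]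
    refine Finset.sum_congr rfl fun j _ => ?_
    rw [dw_anticomm 1 0, neg_mul, map_neg, mul_neg, neg_neg]
  have hw := fun k => contDiffOn_wd hU hF 0 k
  simp only [e]
  rw [div1 hU hΘ sΘ l hz (c := fun k w => h w * wd 0 k F w) fun k => hh.mul (hw k)]
  rw [del_mul_delbar, form11]
  simp only [Finset.smul_sum, smul_smul, ← Finset.sum_add_distrib, ← add_smul, Finset.sum_mul,
    smul_mul_assoc, map_sum, map_smul, smul_eq_mul, hess_apply]
  refine Finset.sum_congr rfl fun j _ => Finset.sum_congr rfl fun k _ => ?_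
  rw [wd_mul (ContDiffOn.diffAt hU hz hh) (ContDiffOn.diffAt hU hz (hw j)),
    wd_comm hU hF hz 0 1]
  ring

variable {G H : Cn n → Matrix (Fin n) (Fin n) ℂ} (hG : SmM G U)
  (hu : ∀ w ∈ U, IsUnit (G w).det) (hH : SmM H U) {u : Cn n → ℂ} (hu' : ContDiffOn ℝ ∞ u U)

/-- The `3`-form `∑ Tr(D_j v R_{rs̄}) dz^j ∧ dz^r ∧ dz̄^s` with `v = H G⁻¹`. -/
def dgamCurv (G H : Cn n → Matrix (Fin n) (Fin n) ℂ) (z : Cn n) : Form n :=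
  ∑ j, ∑ r, ∑ s, (dgam G H j z * curv G z r s).trace • (dz j * (dz r * dzb s))

/-- The matrix of the `(1,1)`-form `Tr(v R)` with `v = H G⁻¹`. -/
def traceCurv (G H : Cn n → Matrix (Fin n) (Fin n) ℂ) (z : Cn n) : Matrix (Fin n) (Fin n) ℂ :=
  Matrix.of fun r s => (H z * (G z)⁻¹ * curv G z r s).trace

omit hU hΘ sΘ hz in
-- Exchanging two dz factors in a product of four covectors changes its sign; `quad_anti1` does the
-- same for two dz̄ factors. Against these, terms symmetric by the Bianchi identities sum to zero.
theorem quad_anti0 (a : Form n) (j k r s : Fin n) :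
    l (dz r * dzb s * (dz j * dzb k * a)) = -l (dz j * dzb s * (dz r * dzb k * a)) := by
  rw [← map_neg]
  congr 1
  simp only [dz_eq_dw, dzb_eq_dw, ← mul_assoc]
  rw [mul_assoc (dw 0 r), dw_anticomm 1 0 s j, mul_neg, ← mul_assoc, dw_anticomm 0 0 r j,
    mul_assoc (dw 0 j) (dw 1 s), dw_anticomm 1 0 s r]
  simp only [mul_neg, neg_mul, neg_neg, ← mul_assoc]

omit hU hΘ sΘ hz in
theorem quad_anti1 (a : Form n) (j k r s : Fin n) :
    l (dz r * dzb s * (dz j * dzb k * a)) = -l (dz r * dzb k * (dz j * dzb s * a)) := by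
  rw [← map_neg]
  congr 1
  simp only [dz_eq_dw, dzb_eq_dw, ← mul_assoc]
  rw [mul_assoc (dw 0 r), dw_anticomm 1 0 s j, mul_assoc (dw 0 r), neg_mul,
    mul_assoc (dw 0 j), dw_anticomm 1 1 s k, mul_assoc (dw 0 r) (dw 1 k), dw_anticomm 1 0 k j]
  simp only [mul_neg, neg_mul, neg_neg, ← mul_assoc]

omit hU hΘ sΘ hz in
theorem apply_delbar_mul_dgamCurv (a : Form n) :
    l (-(delbar u z * dgamCurv G H z) * a) = ∑ r, ∑ s, ∑ j, ∑ k,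
      (wd 1 k u z * (dgam G H j z * curv G z r s).trace) *
        l (dz r * dzb s * (dz j * dzb k * a)) := by
  have e : ∀ j k r s : Fin n, l (dzb k * (dz j * (dz r * dzb s)) * a) =
      -l (dz r * dzb s * (dz j * dzb k * a)) := by
    intro j k r s
    rw [← map_neg]
    congr 1
    rw [← mul_assoc, center_comm (dz_mul_dzb_mem_center r s), dz_eq_dw j, dzb_eq_dw k,
      dw_anticomm 1 0]
    simp only [mul_neg, neg_mul, mul_assoc]
  simp only [delbar_eq, dgamCurv, neg_mul, map_neg, Finset.sum_mul, map_sum,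
    Finset.mul_sum, mul_smul_comm, smul_mul_assoc, map_smul, smul_eq_mul, e, mul_neg,
    Finset.sum_neg_distrib, neg_neg]
  simp only [← Fintype.sum_prod_type']
  refine Fintype.sum_equiv ⟨fun ⟨j, r, s, k⟩ => ⟨r, s, j, k⟩, fun ⟨r, s, j, k⟩ => ⟨j, r, s, k⟩,
    fun _ => rfl, fun _ => rfl⟩ _ _ fun ⟨j, r, s, k⟩ => ?_
  simp only [Equiv.coe_fn_mk]
  ring

omit hU hΘ sΘ hz in
theorem apply_form22_mul (Φ : Fin n → Fin n → Fin n → Fin n → ℂ) (a : Form n) :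
    l (form22 Φ * a) = ∑ r, ∑ s, ∑ j, ∑ k, Φ j k r s * l (dz r * dzb s * (dz j * dzb k * a)) := by
  have e1 : ∀ j k r s : Fin n, dz j * dzb k * dz r * dzb s * a =
      dz r * dzb s * (dz j * dzb k * a) := fun j k r s => by
    rw [mul_assoc (dz j * dzb k), center_comm (dz_mul_dzb_mem_center r s), mul_assoc]
  simp only [form22, Finset.sum_mul, smul_mul_assoc, map_sum, map_smul, smul_eq_mul, e1]
  calc _ = ∑ j, ∑ r, ∑ k, ∑ s, Φ j k r s * l (dz r * dzb s * (dz j * dzb k * a)) :=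
        Finset.sum_congr rfl fun j _ => Finset.sum_comm
    _ = ∑ r, ∑ j, ∑ k, ∑ s, Φ j k r s * l (dz r * dzb s * (dz j * dzb k * a)) := Finset.sum_comm
    _ = ∑ r, ∑ j, ∑ s, ∑ k, Φ j k r s * l (dz r * dzb s * (dz j * dzb k * a)) :=
        Finset.sum_congr rfl fun r _ => Finset.sum_congr rfl fun j _ => Finset.sum_comm
    _ = _ := Finset.sum_congr rfl fun r _ => Finset.sum_comm

include hG hu hH hu'

/-- This is ∂̄(u Tr(Dv ∧ R) ∧ Θ). The derivative of Dv gives -R', the derivative of u gives the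
mixed term, and the derivative of R cancels by `bianchi1`. -/
theorem div_dgamCurv1 :
    ∑ k, wd 1 k (fun w => l (dw 1 k * (u w • dgamCurv G H w * Θ w))) z =
      l ((u z • form22 fun j k r s => (dcurv G H z j k * curv G z r s).trace) * Θ z) -
        l (-(delbar u z * dgamCurv G H z) * Θ z) := by
  have sR := fun r s => smM_curv hU hG hu r s
  have sD := fun j => smM_dgam hU hG hu hH j
  have sc : ∀ r s j, ContDiffOn ℝ ∞ (fun w => -(u w * (dgam G H j w * curv G w r s).trace)) U :=
    fun r s j => (hu'.mul ((sD j).mul (sR r s)).trace).neg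
  have e : ∀ k w, l (dw 1 k * (u w • dgamCurv G H w * Θ w)) =
      ∑ x : Fin n × Fin n, ∑ j, -(u w * (dgam G H j w * curv G w x.1 x.2).trace) *
        lmul l (dz x.1 * dzb x.2) (dz j * dzb k * Θ w) := by
    intro k w
    have e1 : ∀ j r s : Fin n, l (dw 1 k * (dz j * (dz r * dzb s) * Θ w)) =
        -l (dz r * dzb s * (dz j * dzb k * Θ w)) := by
      intro j r s
      rw [← map_neg]
      congr 1
      rw [center_comm (dz_mul_dzb_mem_center r s), mul_assoc, ← mul_assoc (dw 1 k),
        center_comm (dz_mul_dzb_mem_center r s), mul_assoc, ← mul_assoc (dw 1 k), dz_eq_dw j,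
        dw_anticomm 1 0, dzb_eq_dw k]
      simp only [mul_neg, neg_mul]
    simp only [dgamCurv, Finset.smul_sum, Finset.sum_mul, Finset.mul_sum, smul_smul,
      mul_smul_comm, smul_mul_assoc, map_sum, map_smul, smul_eq_mul, e1, lmul_apply, mul_neg,
      neg_mul]
    rw [Finset.sum_comm, Fintype.sum_prod_type]
    refine Finset.sum_congr rfl fun r _ => ?_
    rw [Finset.sum_comm]
  have h1 : ∀ k, wd 1 k (fun w => l (dw 1 k * (u w • dgamCurv G H w * Θ w))) z =
      ∑ x : Fin n × Fin n, wd 1 k (fun w => ∑ j,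
        -(u w * (dgam G H j w * curv G w x.1 x.2).trace) *
          lmul l (dz x.1 * dzb x.2) (dz j * dzb k * Θ w)) z := by
    intro k
    simp only [e]
    rw [wd_sum]
    exact fun x _ => ContDiffOn.diffAt hU hz (ContDiffOn.sum fun j _ => (sc x.1 x.2 j).mul
      (sΘ (lmul (lmul l (dz x.1 * dzb x.2)) (dz j * dzb k))))
  simp only [h1]
  rw [Finset.sum_comm]
  have h2 := fun x : Fin n × Fin n => div1 hU hΘ sΘ (lmul l (dz x.1 * dzb x.2)) hz (sc x.1 x.2)
  simp only [h2]
  have h3 : ∀ r s j k, wd 1 k (fun w => -(u w * (dgam G H j w * curv G w r s).trace)) z =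
      -(wd 1 k u z * (dgam G H j z * curv G z r s).trace)
        + u z * (dcurv G H z j k * curv G z r s).trace
        - u z * (dgam G H j z * wdM 1 k (fun w => curv G w r s) z).trace := by
    intro r s j k
    rw [wd_neg, wd_mul (ContDiffOn.diffAt hU hz hu')
      (ContDiffOn.diffAt hU hz ((sD j).mul (sR r s)).trace),
      wd_trace (((sD j).mul (sR r s)).diff hU hz),
      wdM_mul ((sD j).diff hU hz) ((sR r s).diff hU hz), Matrix.trace_add, dcurv, Matrix.neg_mul,
      Matrix.trace_neg]
    ring
  simp only [h3, sub_mul, add_mul, Finset.sum_sub_distrib, Finset.sum_add_distrib, lmul_apply,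
    Fintype.sum_prod_type]
  have h4 : ∑ r, ∑ s, ∑ j, ∑ k, u z * (dgam G H j z * wdM 1 k (fun w => curv G w r s) z).trace *
      l (dz r * dzb s * (dz j * dzb k * Θ z)) = 0 := by
    simp only [← Fintype.sum_prod_type']
    refine sum_eq_zero_of_anti ⟨fun ⟨r, s, j, k⟩ => ⟨r, k, j, s⟩,
      fun ⟨r, s, j, k⟩ => ⟨r, k, j, s⟩, fun _ => rfl, fun _ => rfl⟩ fun ⟨r, s, j, k⟩ => ?_
    simp only [Equiv.coe_fn_mk]
    rw [bianchi1 hU hG hu hz, quad_anti1, mul_neg]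
  rw [h4, apply_delbar_mul_dgamCurv]
  have h5 : l ((u z • form22 fun j k r s => (dcurv G H z j k * curv G z r s).trace) * Θ z) =
      ∑ r, ∑ s, ∑ j, ∑ k, u z * (dcurv G H z j k * curv G z r s).trace *
        l (dz r * dzb s * (dz j * dzb k * Θ z)) := by
    rw [smul_mul_assoc, map_smul, apply_form22_mul, smul_eq_mul]
    simp only [Finset.mul_sum, mul_assoc]
  rw [h5]
  simp only [neg_mul, Finset.sum_neg_distrib]
  ring

/-- This is ∂(∂̄u ∧ Tr(vR) ∧ Θ). By the Leibniz rule with covariant derivatives ∂ Tr(vR) splits into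
Tr(Dv R) and Tr(v DR); the second part cancels by `bianchi0`. The mixed term is the one of
`div_dgamCurv1` with the opposite sign. -/
theorem div_dgamCurv0 :
    ∑ j, wd 0 j (fun w => l (dw 0 j * (delbar u w * form11 (traceCurv G H w) * Θ w))) z =
      l (form11 (hess u z) * form11 (traceCurv G H z) * Θ z) +
        l (-(delbar u z * dgamCurv G H z) * Θ z) := by
  have sR := fun r s => smM_curv hU hG hu r s
  have sv : SmM (fun w => H w * (G w)⁻¹) U := hH.mul (hG.inv hu)
  have su := fun k => contDiffOn_wd hU hu' 1 k
  have sβ : SmM (traceCurv G H) U := fun r s => (sv.mul (sR r s)).trace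
  have sc : ∀ r s k, ContDiffOn ℝ ∞ (fun w => wd 1 k u w * traceCurv G H w r s) U :=
    fun r s k => (su k).mul (sβ r s)
  have e : ∀ j w, l (dw 0 j * (delbar u w * form11 (traceCurv G H w) * Θ w)) =
      ∑ x : Fin n × Fin n, ∑ k, (wd 1 k u w * traceCurv G H w x.1 x.2) *
        lmul l (dz x.1 * dzb x.2) (dz j * dzb k * Θ w) := by
    intro j w
    have e1 : ∀ k r s : Fin n, l (dw 0 j * (dzb k * (dz r * dzb s) * Θ w)) =
        l (dz r * dzb s * (dz j * dzb k * Θ w)) := by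
      intro k r s
      congr 1
      rw [← mul_assoc, ← mul_assoc, center_comm (dz_mul_dzb_mem_center r s), mul_assoc]
      rfl
    simp only [delbar_eq, form11, Finset.sum_mul, Finset.mul_sum,
      mul_smul_comm, smul_mul_assoc, map_sum, map_smul, smul_eq_mul, e1, lmul_apply]
    rw [Fintype.sum_prod_type]
    exact Finset.sum_congr rfl fun r _ => Finset.sum_congr rfl fun s _ =>
      Finset.sum_congr rfl fun k _ => by ring
  have h1 : ∀ j, wd 0 j (fun w => l (dw 0 j * (delbar u w * form11 (traceCurv G H w) * Θ w))) z =
      ∑ x : Fin n × Fin n, wd 0 j (fun w => ∑ k, (wd 1 k u w * traceCurv G H w x.1 x.2) *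
          lmul l (dz x.1 * dzb x.2) (dz j * dzb k * Θ w)) z := by
    intro j
    simp only [e]
    rw [wd_sum]
    exact fun x _ => ContDiffOn.diffAt hU hz (ContDiffOn.sum fun k _ => (sc x.1 x.2 k).mul
      (sΘ (lmul (lmul l (dz x.1 * dzb x.2)) (dz j * dzb k))))
  simp only [h1]
  rw [Finset.sum_comm]
  have h2 := fun x : Fin n × Fin n => div0 hU hΘ sΘ (lmul l (dz x.1 * dzb x.2)) hz (sc x.1 x.2)
  simp only [h2]
  let D : Fin n → Fin n → Fin n → Matrix (Fin n) (Fin n) ℂ := fun i j k =>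
    wdM 0 i (fun w => curv G w j k) z + curv G z j k * gam G i z - gam G i z * curv G z j k
  have hD : ∀ i j k, D i j k = D j i k := fun i j k => bianchi0 hU hG hu hz i j k
  have h3 : ∀ r s j k, wd 0 j (fun w => wd 1 k u w * traceCurv G H w r s) z =
      hess u z j k * traceCurv G H z r s
        + wd 1 k u z * (dgam G H j z * curv G z r s).trace
        + wd 1 k u z * (H z * (G z)⁻¹ * D j r s).trace := by
    intro r s j k
    have h4 : wd 0 j (fun w => traceCurv G H w r s) z = (dgam G H j z * curv G z r s).trace +
        (H z * (G z)⁻¹ * D j r s).trace := by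
      refine (wd_trace ((sv.mul (sR r s)).diff hU hz)).trans ?_
      rw [wdM_mul (sv.diff hU hz) ((sR r s).diff hU hz), dgam_eq hU hG hu hH hz]
      simp only [D, Matrix.sub_mul, Matrix.mul_sub, Matrix.add_mul, Matrix.mul_add,
        Matrix.trace_add, Matrix.trace_sub]
      have e1 : (gam G j z * (H z * (G z)⁻¹) * curv G z r s).trace =
          (H z * (G z)⁻¹ * (curv G z r s * gam G j z)).trace := by
        rw [Matrix.mul_assoc, Matrix.trace_mul_comm, Matrix.mul_assoc]
      rw [e1, Matrix.mul_assoc _ (gam G j z) (curv G z r s)]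
      ring
    rw [wd_mul (ContDiffOn.diffAt hU hz (su k)) (ContDiffOn.diffAt hU hz (sβ r s)), h4, hess_apply]
    ring
  simp only [h3, add_mul, Finset.sum_add_distrib, lmul_apply, Fintype.sum_prod_type]
  have h4 : ∑ r, ∑ s, ∑ j, ∑ k, wd 1 k u z * (H z * (G z)⁻¹ * D j r s).trace *
      l (dz r * dzb s * (dz j * dzb k * Θ z)) = 0 := by
    simp only [← Fintype.sum_prod_type']
    refine sum_eq_zero_of_anti ⟨fun ⟨r, s, j, k⟩ => ⟨j, s, r, k⟩,
      fun ⟨r, s, j, k⟩ => ⟨j, s, r, k⟩, fun _ => rfl, fun _ => rfl⟩ fun ⟨r, s, j, k⟩ => ?_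
    simp only [Equiv.coe_fn_mk]
    rw [hD, quad_anti0, mul_neg]
  rw [h4, apply_delbar_mul_dgamCurv, add_zero]
  congr 1
  rw [← form22_mul, apply_form22_mul]

end

/-! ### Holomorphic changes of coordinates -/

/-- The Jacobian matrix `(∂τ^a/∂z^j)`. -/
def jac (τ : Cn n → Cn n) (z : Cn n) : Matrix (Fin n) (Fin n) ℂ :=
  Matrix.of fun a j => fderiv ℂ τ z (Pi.single j 1) a

/-- The complex conjugate of a matrix. -/
def cj (A : Matrix (Fin n) (Fin n) ℂ) : Matrix (Fin n) (Fin n) ℂ := A.map (starRingEnd ℂ)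

@[simp] theorem cj_apply (A : Matrix (Fin n) (Fin n) ℂ) (j k : Fin n) :
    cj A j k = (starRingEnd ℂ) (A j k) := rfl

theorem det_cj (A : Matrix (Fin n) (Fin n) ℂ) : (cj A).det = (starRingEnd ℂ) A.det :=
  ((starRingEnd ℂ).map_det A).symm

/-- A locally biholomorphic map `τ` from the open set `U` to the open set `V`. -/
structure LocBihol (U V : Set (Cn n)) (τ : Cn n → Cn n) : Prop where
  isOpen : IsOpen U
  isOpen' : IsOpen V
  maps : Set.MapsTo τ U V
  smooth : ContDiffOn ℂ ω τ U
  unit : ∀ z ∈ U, IsUnit (jac τ z).det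

/-- `A` is the pullback of the `(1,1)`-tensor `A'`. -/
def CovM (τ : Cn n → Cn n) (U : Set (Cn n)) (A A' : Cn n → Matrix (Fin n) (Fin n) ℂ) : Prop :=
  ∀ z ∈ U, A z = (jac τ z).transpose * A' (τ z) * cj (jac τ z)

/-- `Θ` is the pullback of the form `Θ'`. -/
def CovF (τ : Cn n → Cn n) (U : Set (Cn n)) (Θ Θ' : Cn n → Form n) : Prop :=
  ∀ z ∈ U, Θ z = pull (jac τ z) (cj (jac τ z)) (Θ' (τ z))

/-- A real-linear functional splits into a complex-linear and an antilinear part whose coefficients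
have the shape of ∂ and ∂̄. The chain rule for Wirtinger derivatives follows. -/
theorem real_linear_eq (L : Cn n →L[ℝ] ℂ) (v : Cn n) :
    L v = ∑ a, (v a * (1 / 2 * (L (Pi.single a 1) - Complex.I * L (Pi.single a Complex.I))) +
      (starRingEnd ℂ) (v a) *
        (1 / 2 * (L (Pi.single a 1) + Complex.I * L (Pi.single a Complex.I)))) := by
  have h : v = ∑ a, ((v a).re • (Pi.single a 1 : Cn n) + (v a).im • (Pi.single a Complex.I : Cn n)) := by
    ext b
    rw [Finset.sum_apply, Finset.sum_eq_single b]
    · simp [Complex.re_add_im]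
    · intro a _ hab; simp [Pi.single_eq_of_ne hab.symm]
    · simp
  conv_lhs => rw [h]
  simp only [map_sum, map_add, map_smul, Complex.real_smul]
  refine Finset.sum_congr rfl fun a _ => ?_
  conv_rhs => rw [← Complex.re_add_im (v a)]
  simp only [map_add, map_mul, Complex.conj_ofReal, Complex.conj_I]
  linear_combination ((v a).im : ℂ) * L (Pi.single a Complex.I) * Complex.I_sq

theorem wd_one_of_differentiableAt {f : Cn n → ℂ} {z : Cn n} (hf : DifferentiableAt ℂ f z)
    (k : Fin n) : wd 1 k f z = 0 := by
  have h1 : fderiv ℝ f z = (fderiv ℂ f z).restrictScalars ℝ :=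
    (hf.hasFDerivAt.restrictScalars ℝ).fderiv
  have h2 : (Pi.single k Complex.I : Cn n) = Complex.I • Pi.single k 1 := by
    rw [← Pi.single_smul]; simp
  simp only [wd, h1, ContinuousLinearMap.coe_restrictScalars', h2, map_smul, smul_eq_mul, wsign]
  simp only [Matrix.cons_val_one, Matrix.cons_val_fin_one]
  linear_combination (1 / 2) * fderiv ℂ f z (Pi.single k 1) * Complex.I_sq

theorem sum4_comm (f : Fin n → Fin n → Fin n → Fin n → ℂ) :
    ∑ c, ∑ d, ∑ a, ∑ b, f a b c d = ∑ a, ∑ b, ∑ c, ∑ d, f a b c d := by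
  have := Finset.sum_comm (s := Finset.univ) (t := Finset.univ)
    (f := fun x y : Fin n × Fin n => f y.1 y.2 x.1 x.2)
  simpa only [Fintype.sum_prod_type] using this

/-! ### Transformation laws under holomorphic changes of coordinates. -/

namespace LocBihol

variable {U V : Set (Cn n)} {τ : Cn n → Cn n} (h : LocBihol U V τ) {z : Cn n} (hz : z ∈ U)

include h hz

theorem differentiableAt : DifferentiableAt ℂ τ z :=
  (h.smooth.contDiffAt (h.isOpen.mem_nhds hz)).differentiableAt (by simp)

theorem fderiv_comp {f : Cn n → ℂ} (hf : DifferentiableAt ℝ f (τ z)) (v : Cn n) :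
    fderiv ℝ (fun w => f (τ w)) z v = fderiv ℝ f (τ z) (fderiv ℂ τ z v) := by
  have h1 := (h.differentiableAt hz).hasFDerivAt.restrictScalars ℝ
  have h2 : HasFDerivAt (fun w => f (τ w)) _ z := hf.hasFDerivAt.comp z h1
  rw [h2.fderiv]; rfl

theorem wd_comp {f : Cn n → ℂ} (hf : DifferentiableAt ℝ f (τ z)) (j : Fin n) :
    wd 0 j (fun w => f (τ w)) z = ∑ a, jac τ z a j * wd 0 a f (τ z) ∧
    wd 1 j (fun w => f (τ w)) z = ∑ a, cj (jac τ z) a j * wd 1 a f (τ z) := by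
  have h2 : (Pi.single j Complex.I : Cn n) = Complex.I • Pi.single j 1 := by
    rw [← Pi.single_smul]; simp
  have h3 : ∀ a, fderiv ℂ τ z (Pi.single j 1) a = jac τ z a j := fun a => rfl
  constructor <;>
  · simp only [wd, h.fderiv_comp hz hf, h2, map_smul]
    rw [real_linear_eq _ (fderiv ℂ τ z (Pi.single j 1)),
      real_linear_eq _ (Complex.I • fderiv ℂ τ z (Pi.single j 1)), Finset.mul_sum,
      ← Finset.sum_sub_distrib, Finset.mul_sum]
    refine Finset.sum_congr rfl fun a _ => ?_
    simp only [Pi.smul_apply, smul_eq_mul, map_mul, Complex.conj_I, h3, wsign, cj_apply,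
      Matrix.cons_val_zero, Matrix.cons_val_one, Matrix.cons_val_fin_one]
    ring_nf
    simp only [Complex.I_sq, Complex.I_pow_three]
    ring

omit hz in
theorem holo (a j : Fin n) : ContDiffOn ℂ ω (fun w => jac τ w a j) U := by
  have h1 : ContDiffOn ℂ ω (fun w => fderiv ℂ τ w (Pi.single j 1)) U :=
    (h.smooth.fderiv_of_isOpen h.isOpen (by simp)).clm_apply contDiffOn_const
  exact contDiffOn_pi.1 h1 a

omit hz in
theorem smM_jac : SmM (jac τ) U := fun a j => ((h.holo a j).restrict_scalars ℝ).of_le le_top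

omit hz in
theorem smM_transpose : SmM (fun w => (jac τ w).transpose) U := fun p q => h.smM_jac q p

omit hz in
theorem contDiffOn : ContDiffOn ℝ ∞ τ U := (h.smooth.restrict_scalars ℝ).of_le le_top

omit hz in
theorem smM_cj : SmM (fun w => cj (jac τ w)) U := fun p q =>
  (Complex.conjCLE.contDiff.comp_contDiffOn (h.smM_jac p q))

omit hz in
theorem isUnit_transpose (w : Cn n) (hw : w ∈ U) : IsUnit (jac τ w).transpose.det := by
  rw [Matrix.det_transpose]; exact h.unit w hw

omit hz in
theorem isUnit_cj (w : Cn n) (hw : w ∈ U) : IsUnit (cj (jac τ w)).det := by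
  rw [det_cj]; exact (h.unit w hw).map (starRingEnd ℂ)

theorem wd_jac (k a j : Fin n) : wd 1 k (fun w => jac τ w a j) z = 0 :=
  wd_one_of_differentiableAt
    (((h.holo a j).contDiffAt (h.isOpen.mem_nhds hz)).differentiableAt (by simp)) k

theorem wdM_transpose (k : Fin n) : wdM 1 k (fun w => (jac τ w).transpose) z = 0 := by
  ext p q; exact h.wd_jac hz k q p

theorem wd_cj (k a j : Fin n) : wd 0 k (fun w => cj (jac τ w) a j) z = 0 := by
  apply (starRingEnd ℂ).injective
  rw [wd_conj, map_zero, ← h.wd_jac hz k a j]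
  simp only [cj_apply, Complex.conj_conj]

theorem wdM_cj (k : Fin n) : wdM 0 k (fun w => cj (jac τ w)) z = 0 := by
  ext p q; exact h.wd_cj hz k p q

theorem wdM_comp {A : Cn n → Matrix (Fin n) (Fin n) ℂ} (hA : DiffM A (τ z)) (j : Fin n) :
    wdM 0 j (fun w => A (τ w)) z = ∑ a, jac τ z a j • wdM 0 a A (τ z) ∧
    wdM 1 j (fun w => A (τ w)) z = ∑ a, cj (jac τ z) a j • wdM 1 a A (τ z) := by
  constructor <;> ext p q
  · simpa [Matrix.sum_apply] using (h.wd_comp hz (hA p q) j).1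
  · simpa [Matrix.sum_apply] using (h.wd_comp hz (hA p q) j).2

omit hz in
theorem smM_comp {A : Cn n → Matrix (Fin n) (Fin n) ℂ} (hA : SmM A V) :
    SmM (fun w => A (τ w)) U := fun p q => (hA p q).comp h.contDiffOn h.maps

theorem diffM_comp {A : Cn n → Matrix (Fin n) (Fin n) ℂ} (hA : SmM A V) :
    DiffM (fun w => A (τ w)) z := (h.smM_comp hA).diff h.isOpen hz

omit hz in
theorem contDiffOn_comp {f : Cn n → ℂ} (hf : ContDiffOn ℝ ∞ f V) :
    ContDiffOn ℝ ∞ (fun w => f (τ w)) U := hf.comp h.contDiffOn h.maps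

-- The conjugate Jacobian is annihilated by ∂, so no second derivative of the coordinate change
-- appears and the complex Hessian is a tensor.
omit hz in
theorem hess_comp {f : Cn n → ℂ} (hf : ContDiffOn ℝ ∞ f V) :
    CovM τ U (hess fun w => f (τ w)) (hess f) := by
  intro z hz
  ext j k
  have hw := fun b => contDiffOn_wd h.isOpen' hf 1 b
  have d1 := fun b => ContDiffOn.diffAt h.isOpen hz (h.smM_cj b k)
  have d2 := fun b => ContDiffOn.diffAt h.isOpen hz (h.contDiffOn_comp (hw b))
  rw [hess_apply, wd_congr_on h.isOpen hz (g := fun w => ∑ b, cj (jac τ w) b k * wd 1 b f (τ w))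
    fun w hw => (h.wd_comp hw (ContDiffOn.diffAt h.isOpen' (h.maps hw) hf) k).2]
  refine (wd_sum (f := fun b w => cj (jac τ w) b k * wd 1 b f (τ w)) _
    fun b _ => (d1 b).mul (d2 b)).trans ?_
  rw [Matrix.mul_apply]
  refine Finset.sum_congr rfl fun b _ => ?_
  rw [wd_mul (d1 b) (d2 b), h.wd_cj hz, zero_mul, zero_add,
    (h.wd_comp hz (ContDiffOn.diffAt h.isOpen' (h.maps hz) (hw b)) j).1, mul_comm,
    Matrix.mul_apply]
  simp only [hess_apply, Matrix.transpose_apply]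

section

variable {G G' H H' : Cn n → Matrix (Fin n) (Fin n) ℂ} (cG : CovM τ U G G') (cH : CovM τ U H H')
  (sG : SmM G' V) (sH : SmM H' V) (hu : ∀ w ∈ V, IsUnit (G' w).det)

omit h hz in
theorem mul_inv_aux {P A B C : Matrix (Fin n) (Fin n) ℂ} (hC : IsUnit C.det) :
    (P * A * C) * (P * B * C)⁻¹ = P * (A * B⁻¹) * P⁻¹ := by
  rw [Matrix.mul_inv_rev, Matrix.mul_inv_rev, ← Matrix.mul_assoc, Matrix.mul_assoc (P * A) C,
    Matrix.mul_nonsing_inv _ hC, Matrix.mul_one]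
  simp only [Matrix.mul_assoc]

include cG cH in
/-- The endomorphism `H G⁻¹` is conjugated by the Jacobian. -/
theorem mul_inv_eq : H z * (G z)⁻¹ =
    (jac τ z).transpose * (H' (τ z) * (G' (τ z))⁻¹) * (jac τ z).transpose⁻¹ := by
  rw [cG z hz, cH z hz, mul_inv_aux (h.isUnit_cj z hz)]

include cG cH in
theorem trace_mul_inv_eq : (H z * (G z)⁻¹).trace = (H' (τ z) * (G' (τ z))⁻¹).trace := by
  rw [h.mul_inv_eq hz cG cH, Matrix.trace_mul_comm, ← Matrix.mul_assoc,
    Matrix.nonsing_inv_mul _ (h.isUnit_transpose z hz), Matrix.one_mul]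

include cH sH in
theorem wdM_covM (j : Fin n) : wdM 0 j H z =
    (wdM 0 j (fun w => (jac τ w).transpose) z * H' (τ z)
      + (jac τ z).transpose * ∑ a, jac τ z a j • wdM 0 a H' (τ z)) * cj (jac τ z) := by
  have d1 := h.smM_transpose.diff h.isOpen hz
  have d2 := h.diffM_comp hz sH
  rw [wdM_congr_on h.isOpen hz cH, wdM_mul (d1.mul d2) (h.smM_cj.diff h.isOpen hz),
    h.wdM_cj hz, Matrix.mul_zero, add_zero, wdM_mul d1 d2,
    (h.wdM_comp hz (sH.diff h.isOpen' (h.maps hz)) j).1]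

-- The connection is not a tensor: its inhomogeneous part is (∂P)P⁻¹ with P the transposed Jacobian.
-- This part is holomorphic and independent of the metric, hence invisible to the curvature and to
-- variations.
include cG sG hu in
theorem gam_eq (j : Fin n) : gam G j z =
    wdM 0 j (fun w => (jac τ w).transpose) z * (jac τ z).transpose⁻¹
      + (jac τ z).transpose * (∑ a, jac τ z a j • gam G' a (τ z)) * (jac τ z).transpose⁻¹ := by
  have hg := Matrix.mul_nonsing_inv _ (hu _ (h.maps hz))
  have hc := Matrix.mul_nonsing_inv _ (h.isUnit_cj z hz)
  rw [gam, h.wdM_covM hz cG sG, cG z hz, Matrix.mul_inv_rev, Matrix.mul_inv_rev,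
    ← Matrix.mul_assoc, Matrix.mul_assoc _ (cj (jac τ z)), hc, Matrix.mul_one]
  simp only [gam, Matrix.add_mul, Matrix.mul_assoc, Matrix.mul_sum, Matrix.sum_mul,
    Matrix.mul_smul, Matrix.smul_mul]
  rw [← Matrix.mul_assoc (G' (τ z)), hg, Matrix.one_mul]

-- The inhomogeneous part of the connection cancels against the derivative of the Jacobian in the
-- transformation of ∂H.
include cG cH sG sH hu in
theorem dgam_eq (j : Fin n) : dgam G H j z =
    (jac τ z).transpose * (∑ a, jac τ z a j • dgam G' H' a (τ z)) * (jac τ z).transpose⁻¹ := by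
  have hp := Matrix.nonsing_inv_mul _ (h.isUnit_transpose z hz)
  rw [dgam, Matrix.mul_assoc, h.mul_inv_eq hz cG cH, h.gam_eq hz cG sG hu, h.wdM_covM hz cH sH,
    cG z hz, mul_assoc _ (cj (jac τ z))]
  have e1 : cj (jac τ z) * ((jac τ z).transpose * G' (τ z) * cj (jac τ z))⁻¹ =
      (G' (τ z))⁻¹ * (jac τ z).transpose⁻¹ := by
    rw [Matrix.mul_inv_rev, Matrix.mul_inv_rev, ← Matrix.mul_assoc,
      Matrix.mul_nonsing_inv _ (h.isUnit_cj z hz), Matrix.one_mul]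
  rw [e1]
  have e2 : ∀ X : Matrix (Fin n) (Fin n) ℂ,
      (jac τ z).transpose⁻¹ * ((jac τ z).transpose * X) = X := fun X => by
    rw [← Matrix.mul_assoc, hp, Matrix.one_mul]
  simp only [dgam, Matrix.add_mul, Matrix.mul_assoc, e2, Matrix.mul_sum, Matrix.sum_mul,
    Matrix.mul_smul, Matrix.smul_mul, Matrix.mul_sub, Matrix.sub_mul, smul_sub,
    Finset.sum_sub_distrib]
  abel

-- Applying ∂̄ to `gam_eq` kills the holomorphic inhomogeneous term and leaves a conjugation by the
-- transposed Jacobian.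
include cG sG hu in
theorem curv_cov (j k : Fin n) : curv G z j k = (jac τ z).transpose *
    (∑ a, ∑ b, (jac τ z a j * cj (jac τ z) b k) • curv G' (τ z) a b) *
      (jac τ z).transpose⁻¹ := by
  have hi := h.smM_transpose.inv h.isUnit_transpose
  have s1 := fun j => h.smM_transpose.wdM h.isOpen 0 j
  have sg := fun a => smM_gam h.isOpen' sG hu a
  have s2 : ∀ a, SmM (fun w => jac τ w a j • gam G' a (τ w)) U :=
    fun a => (h.smM_comp (sg a)).smul (h.smM_jac a j)
  have s3 : SmM (fun w => ∑ a, jac τ w a j • gam G' a (τ w)) U := fun p q => by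
    simp only [Matrix.sum_apply]
    exact ContDiffOn.sum fun a _ => s2 a p q
  have hd := fun {A : Cn n → Matrix (Fin n) (Fin n) ℂ} (hA : SmM A U) => hA.diff h.isOpen hz
  have e0 : wdM 1 k (fun w => (jac τ w).transpose⁻¹) z = 0 := by
    rw [wdM_inv h.isOpen h.smM_transpose h.isUnit_transpose hz, h.wdM_transpose hz,
      Matrix.mul_zero, Matrix.zero_mul, neg_zero]
  have e1 : wdM 1 k (wdM 0 j fun w => (jac τ w).transpose) z = 0 := by
    rw [wdM_comm h.isOpen h.smM_transpose hz,
      wdM_congr_on (B := fun _ => 0) h.isOpen hz fun w hw => h.wdM_transpose hw k]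
    ext p q; exact wd_const _
  have e2 : wdM 1 k (fun w => ∑ a, jac τ w a j • gam G' a (τ w)) z =
      ∑ a, ∑ b, (jac τ z a j * cj (jac τ z) b k) • wdM 1 b (gam G' a) (τ z) := by
    ext p q
    simp only [wdM_apply, Matrix.sum_apply, Matrix.smul_apply, smul_eq_mul]
    refine (wd_sum (f := fun a w => jac τ w a j * gam G' a (τ w) p q) _
      fun a _ => hd (s2 a) p q).trans (Finset.sum_congr rfl fun a _ => ?_)
    rw [wd_mul (hd h.smM_jac a j) (hd (h.smM_comp (sg a)) p q), h.wd_jac hz, zero_mul, zero_add,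
      (h.wd_comp hz ((sg a).diff h.isOpen' (h.maps hz) p q) k).2, Finset.mul_sum]
    exact Finset.sum_congr rfl fun b _ => by ring
  rw [curv_eq, wdM_congr_on h.isOpen hz fun w hw => h.gam_eq hw cG sG hu j,
    wdM_add ((hd (s1 j)).mul (hd hi)) (((hd h.smM_transpose).mul (hd s3)).mul (hd hi)),
    wdM_mul (hd (s1 j)) (hd hi), wdM_mul ((hd h.smM_transpose).mul (hd s3)) (hd hi),
    wdM_mul (hd h.smM_transpose) (hd s3), e0, e1, e2, h.wdM_transpose hz]
  simp only [curv_eq, Matrix.zero_mul, Matrix.mul_zero, zero_add, add_zero, smul_neg,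
    Finset.sum_neg_distrib, Matrix.mul_neg, Matrix.neg_mul]

include cG sG hu in
theorem trace_mul_curv {X X' : Matrix (Fin n) (Fin n) ℂ}
    (hX : X = (jac τ z).transpose * X' * (jac τ z).transpose⁻¹) (j k : Fin n) :
    (X * curv G z j k).trace = ∑ a, ∑ b, (jac τ z a j * cj (jac τ z) b k) *
      (X' * curv G' (τ z) a b).trace := by
  have hp := Matrix.nonsing_inv_mul _ (h.isUnit_transpose z hz)
  rw [h.curv_cov hz cG sG hu j k, hX]
  have e : ∀ P X Y : Matrix (Fin n) (Fin n) ℂ, P⁻¹ * P = 1 →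
      (P * X * P⁻¹ * (P * Y * P⁻¹)).trace = (X * Y).trace := fun P X Y hP => by
    rw [← Matrix.mul_assoc, ← Matrix.mul_assoc, Matrix.mul_assoc (P * X), hP, Matrix.mul_one,
      Matrix.trace_mul_comm, ← Matrix.mul_assoc, ← Matrix.mul_assoc, hP, Matrix.one_mul]
  rw [e _ _ _ hp]
  simp only [Matrix.mul_sum, Matrix.mul_smul, Matrix.trace_sum, Matrix.trace_smul, smul_eq_mul]

omit h hz in
theorem covM_of_apply {A A' : Cn n → Matrix (Fin n) (Fin n) ℂ} (hA : ∀ z ∈ U, ∀ j k, A z j k =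
      ∑ a, ∑ b, (jac τ z a j * cj (jac τ z) b k) * A' (τ z) a b) : CovM τ U A A' := by
  intro z hz
  ext j k
  rw [hA z hz, Matrix.mul_apply, Finset.sum_comm]
  refine Finset.sum_congr rfl fun b _ => ?_
  rw [Matrix.mul_apply, Finset.sum_mul]
  exact Finset.sum_congr rfl fun a _ => by rw [Matrix.transpose_apply]; ring

omit hz in
include cG sG hu in
theorem ric_cov : CovM τ U (ric G) (ric G') := by
  refine covM_of_apply fun z hz j k => ?_
  have hp := Matrix.mul_nonsing_inv _ (h.isUnit_transpose z hz)
  have := h.trace_mul_curv hz cG sG hu (X := 1) (X' := 1) (by rw [Matrix.mul_one, hp]) j k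
  simp only [Matrix.one_mul] at this
  exact this

omit hz in
include cG cH sG hu in
theorem traceCurv_cov : CovM τ U (traceCurv G H) (traceCurv G' H') :=
  covM_of_apply fun _ hz j k => h.trace_mul_curv hz cG sG hu (h.mul_inv_eq hz cG cH) j k

omit hz in
include cG sG hu in
theorem chernWeil_trace2_cov : CovF τ U (chernWeil trace2 G) (chernWeil trace2 G') := by
  intro z hz
  rw [chernWeil_eq, chernWeil_eq, pull_form22]
  congr 1
  funext j k r s
  rw [trace2, h.trace_mul_curv hz cG sG hu (h.curv_cov hz cG sG hu j k) r s]
  simp only [Finset.sum_mul, Matrix.smul_mul, Matrix.trace_sum, Matrix.trace_smul, smul_eq_mul,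
    Finset.mul_sum, trace2]
  rw [sum4_comm]
  refine Finset.sum_congr rfl fun a _ => Finset.sum_congr rfl fun b _ =>
    Finset.sum_congr rfl fun c _ => Finset.sum_congr rfl fun d _ => ?_
  ring

omit hz in
include cG cH sG sH hu in
theorem dgamCurv_cov : CovF τ U (dgamCurv G H) (dgamCurv G' H') := by
  intro z hz
  let T : Fin n → Matrix (Fin n) (Fin n) ℂ := fun j =>
    Matrix.of fun r s => (dgam G H j z * curv G z r s).trace
  let T' : Fin n → Matrix (Fin n) (Fin n) ℂ := fun j =>
    Matrix.of fun r s => (dgam G' H' j (τ z) * curv G' (τ z) r s).trace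
  have e : ∀ (G H : Cn n → Matrix (Fin n) (Fin n) ℂ) (z : Cn n), dgamCurv G H z =
      ∑ j, dz j * form11 (Matrix.of fun r s => (dgam G H j z * curv G z r s).trace) := by
    intro G H z
    simp only [dgamCurv, form11, Finset.mul_sum, mul_smul_comm, Matrix.of_apply]
  have e1 : ∀ j, T j = ∑ a, jac τ z a j • ((jac τ z).transpose * T' a * cj (jac τ z)) := by
    intro j
    ext r s
    show (dgam G H j z * curv G z r s).trace = _
    rw [h.trace_mul_curv hz cG sG hu (h.dgam_eq hz cG cH sG sH hu j) r s]
    simp only [Matrix.sum_apply, Matrix.smul_apply, smul_eq_mul, Matrix.mul_apply (N := cj _),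
      Matrix.mul_apply (N := T' _), Matrix.transpose_apply, Finset.sum_mul, Finset.mul_sum,
      Matrix.trace_sum, Matrix.smul_mul, Matrix.trace_smul]
    rw [Finset.sum_comm_cycle]
    refine Finset.sum_congr rfl fun a _ => ?_
    rw [Finset.sum_comm]
    refine Finset.sum_congr rfl fun b _ => Finset.sum_congr rfl fun c _ => ?_
    show _ = _ * (_ * (dgam G' H' a (τ z) * curv G' (τ z) c b).trace * _)
    ring
  rw [e, e, map_sum]
  have e2 : ∀ j, form11 (T j) =
      ∑ a, jac τ z a j • form11 ((jac τ z).transpose * T' a * cj (jac τ z)) := by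
    intro j
    rw [e1]
    exact (map_sum (form11L n) _ _).trans (Finset.sum_congr rfl fun a _ => map_smul (form11L n) _ _)
  show ∑ j, dz j * form11 (T j) = ∑ a, pull _ _ (dz a * form11 (T' a))
  simp only [e2, map_mul, pull_form11, pull_dz, Finset.mul_sum, Finset.sum_mul]
  rw [Finset.sum_comm]
  simp only [mul_smul_comm, smul_mul_assoc]

end

omit hz in
theorem del_cov {f f' : Cn n → ℂ} (hf : ∀ w ∈ U, f w = f' (τ w)) (hf' : ContDiffOn ℝ ∞ f' V) :
    CovF τ U (del f) (del f') := by
  intro z hz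
  simp only [del_eq, map_sum, map_smul, pull_dz, Finset.smul_sum, smul_smul]
  rw [Finset.sum_comm]
  refine Finset.sum_congr rfl fun j _ => ?_
  rw [← Finset.sum_smul, wd_congr_on h.isOpen hz hf,
    (h.wd_comp hz (ContDiffOn.diffAt h.isOpen' (h.maps hz) hf') j).1]
  simp only [mul_comm]

omit hz in
theorem delbar_cov {f f' : Cn n → ℂ} (hf : ∀ w ∈ U, f w = f' (τ w))
    (hf' : ContDiffOn ℝ ∞ f' V) : CovF τ U (delbar f) (delbar f') := by
  intro z hz
  simp only [delbar_eq, map_sum, map_smul, pull_dzb, Finset.smul_sum, smul_smul]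
  rw [Finset.sum_comm]
  refine Finset.sum_congr rfl fun j _ => ?_
  rw [← Finset.sum_smul, wd_congr_on h.isOpen hz hf,
    (h.wd_comp hz (ContDiffOn.diffAt h.isOpen' (h.maps hz) hf') j).2]
  simp only [mul_comm]

omit hz in
theorem hess_cov {f f' : Cn n → ℂ} (hf : ∀ w ∈ U, f w = f' (τ w))
    (hf' : ContDiffOn ℝ ∞ f' V) : CovM τ U (hess f) (hess f') := by
  intro z hz
  rw [← h.hess_comp hf' z hz]
  ext j k
  rw [hess_apply, hess_apply]
  exact wd_congr_on h.isOpen hz fun w hw => wd_congr_on h.isOpen hw hf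

end LocBihol

namespace CovF

variable {τ : Cn n → Cn n} {U : Set (Cn n)} {Θ Θ' Ξ Ξ' : Cn n → Form n}

theorem form11 {A A' : Cn n → Matrix (Fin n) (Fin n) ℂ} (h : CovM τ U A A') :
    CovF τ U (fun z => form11 (A z)) (fun z => form11 (A' z)) := fun z hz => by
  beta_reduce
  rw [pull_form11, h z hz]

theorem kf {A A' : Cn n → Matrix (Fin n) (Fin n) ℂ} (h : CovM τ U A A') :
    CovF τ U (fun z => kf (A z)) (fun z => kf (A' z)) := fun z hz => by
  show Complex.I • _ = pull _ _ (Complex.I • _)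
  rw [map_smul, ← form11 h z hz]

theorem add (h : CovF τ U Θ Θ') (h' : CovF τ U Ξ Ξ') :
    CovF τ U (fun z => Θ z + Ξ z) (fun z => Θ' z + Ξ' z) := fun z hz => by
  beta_reduce
  rw [map_add, h z hz, h' z hz]

theorem mul (h : CovF τ U Θ Θ') (h' : CovF τ U Ξ Ξ') :
    CovF τ U (fun z => Θ z * Ξ z) (fun z => Θ' z * Ξ' z) := fun z hz => by
  beta_reduce
  rw [map_mul, h z hz, h' z hz]

theorem smul {f f' : Cn n → ℂ} (hf : ∀ w ∈ U, f w = f' (τ w)) (h : CovF τ U Θ Θ') :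
    CovF τ U (fun z => f z • Θ z) (fun z => f' z • Θ' z) := fun z hz => by
  beta_reduce
  rw [map_smul, h z hz, hf z hz]

theorem powFact (h : CovF τ U Θ Θ') (k : ℕ) :
    CovF τ U (fun z => powFact (Θ z) k) (fun z => powFact (Θ' z) k) := fun z hz => by
  beta_reduce
  rw [pull_powFact, h z hz]

theorem topL (h : CovF τ U Θ Θ') {z : Cn n} (hz : z ∈ U) :
    topL n (Θ z) = (jac τ z).det * (starRingEnd ℂ) (jac τ z).det * topL n (Θ' (τ z)) := by
  rw [h z hz, topL_pull, det_cj]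

end CovF

/-! ### Families of coordinate expressions -/

theorem clm_apply_eq_sum (L : Cn n →L[ℂ] Cn n) (v : Cn n) :
    L v = ∑ a, v a • L (Pi.single a 1) := by
  have h4 : v = ∑ a, v a • (Pi.single a 1 : Cn n) := by
    ext b; simp [Finset.sum_apply, Pi.single_apply]
  conv_lhs => rw [h4]
  simp only [map_sum, map_smul]

theorem sesq_apply_sum (B : Cn n →ₗ[ℂ] Cn n →ₛₗ[starRingEnd ℂ] ℂ) (c d : Fin n → ℂ)
    (v w : Fin n → Cn n) : B (∑ a, c a • v a) (∑ b, d b • w b) =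
      ∑ b, (∑ a, c a * B (v a) (w b)) * (starRingEnd ℂ) (d b) := by
  rw [map_sum]
  refine Finset.sum_congr rfl fun b _ => ?_
  rw [LinearMap.map_smulₛₗ, smul_eq_mul, mul_comm, map_sum, LinearMap.sum_apply]
  simp only [map_smul, LinearMap.smul_apply, smul_eq_mul]

section Transition

variable {M : Type*} [TopologicalSpace M]

/-- The change of coordinates from the chart `e` to the chart `e'`. -/
def trans (e e' : OpenPartialHomeomorph M (Cn n)) (z : Cn n) : Cn n := e' (e.symm z)

/-- The domain of the change of coordinates. -/
def overlap (e e' : OpenPartialHomeomorph M (Cn n)) : Set (Cn n) :=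
  e.target ∩ e.symm ⁻¹' e'.source

theorem isOpen_overlap (e e' : OpenPartialHomeomorph M (Cn n)) : IsOpen (overlap e e') :=
  e.symm.isOpen_inter_preimage e'.open_source

theorem trans_mem {e e' : OpenPartialHomeomorph M (Cn n)} {z : Cn n} (hz : z ∈ overlap e e') :
    trans e e' z ∈ overlap e' e := by
  refine ⟨e'.map_source hz.2, ?_⟩
  show e'.symm (e' (e.symm z)) ∈ e.source
  rw [e'.left_inv hz.2]
  exact e.map_target hz.1

theorem symm_trans {e e' : OpenPartialHomeomorph M (Cn n)} {z : Cn n} (hz : z ∈ overlap e e') :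
    e'.symm (trans e e' z) = e.symm z := e'.left_inv hz.2

theorem trans_trans {e e' : OpenPartialHomeomorph M (Cn n)} {z : Cn n} (hz : z ∈ overlap e e') :
    trans e' e (trans e e' z) = z := by
  rw [trans, symm_trans hz, e.right_inv hz.1]

variable [ChartedSpace (Cn n) M] [IsManifold 𝓘(ℂ, Cn n) ω M]

theorem contDiffOn_trans {e e' : OpenPartialHomeomorph M (Cn n)} (he : e ∈ atlas (Cn n) M)
    (he' : e' ∈ atlas (Cn n) M) : ContDiffOn ℂ ω (trans e e') (overlap e e') := by
  have h0 := StructureGroupoid.compatible (contDiffGroupoid ω 𝓘(ℂ, Cn n)) he he'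
  rw [contDiffGroupoid, mem_groupoid_of_pregroupoid] at h0
  have h : ContDiffOn ℂ ω (𝓘(ℂ, Cn n) ∘ (e.symm.trans e') ∘ 𝓘(ℂ, Cn n).symm)
      (𝓘(ℂ, Cn n).symm ⁻¹' (e.symm.trans e').source ∩ Set.range 𝓘(ℂ, Cn n)) := h0.1
  refine h.mono fun z hz => ⟨?_, by simp⟩
  simpa [overlap] using hz

theorem locBihol_trans {e e' : OpenPartialHomeomorph M (Cn n)} (he : e ∈ atlas (Cn n) M)
    (he' : e' ∈ atlas (Cn n) M) : LocBihol (overlap e e') e'.target (trans e e') where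
  isOpen := isOpen_overlap e e'
  isOpen' := e'.open_target
  maps := fun _ hz => (trans_mem hz).1
  smooth := contDiffOn_trans he he'
  unit := fun z hz => by
    have d1 : DifferentiableAt ℂ (trans e e') z :=
      ((contDiffOn_trans he he').contDiffAt
        ((isOpen_overlap e e').mem_nhds hz)).differentiableAt (by simp)
    have d2 : DifferentiableAt ℂ (trans e' e) (trans e e' z) :=
      ((contDiffOn_trans he' he).contDiffAt
        ((isOpen_overlap e' e).mem_nhds (trans_mem hz))).differentiableAt (by simp)
    have h1 := d2.hasFDerivAt.comp z d1.hasFDerivAt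
    have h2 : HasFDerivAt (trans e' e ∘ trans e e') (ContinuousLinearMap.id ℂ (Cn n)) z :=
      (hasFDerivAt_id z).congr_of_eventuallyEq
        (Filter.eventually_of_mem ((isOpen_overlap e e').mem_nhds hz) fun w hw => trans_trans hw)
    -- The two changes of coordinates are mutually inverse, so by the chain rule their Jacobians are
    -- inverse matrices.
    have h4 : jac (trans e' e) (trans e e' z) * jac (trans e e') z = 1 := by
      ext a j
      have h5 := congrFun (DFunLike.congr_fun (h1.unique h2) (Pi.single j 1)) a
      have h6 : fderiv ℂ (trans e' e) (trans e e' z) (fderiv ℂ (trans e e') z (Pi.single j 1)) a =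
          (Pi.single j 1 : Cn n) a := h5
      rw [clm_apply_eq_sum] at h6
      rw [Matrix.mul_apply, Matrix.one_apply, ← Pi.single_apply, ← h6, Finset.sum_apply]
      exact Finset.sum_congr rfl fun b _ => mul_comm _ _
    exact Matrix.isUnit_det_of_left_inverse h4

end Transition

variable (M : Type*) [TopologicalSpace M] [ChartedSpace (Cn n) M]

/-- A smooth function, given by its expressions in charts. -/
structure GlobS (f : OpenPartialHomeomorph M (Cn n) → Cn n → ℂ) : Prop where
  smooth : ∀ e ∈ atlas (Cn n) M, ContDiffOn ℝ ∞ (f e) e.target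
  cov : ∀ e ∈ atlas (Cn n) M, ∀ e' ∈ atlas (Cn n) M,
    ∀ z ∈ overlap e e', f e z = f e' (trans e e' z)

/-- A smooth `(1,1)`-tensor, given by its expressions in charts. -/
structure GlobM (A : OpenPartialHomeomorph M (Cn n) → Cn n → Matrix (Fin n) (Fin n) ℂ) : Prop where
  smooth : ∀ e ∈ atlas (Cn n) M, SmM (A e) e.target
  cov : ∀ e ∈ atlas (Cn n) M, ∀ e' ∈ atlas (Cn n) M,
    CovM (trans e e') (overlap e e') (A e) (A e')

/-- A smooth form, given by its expressions in charts. -/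
structure GlobF (Θ : OpenPartialHomeomorph M (Cn n) → Cn n → Form n) : Prop where
  smooth : ∀ e ∈ atlas (Cn n) M, SmF (Θ e) e.target
  cov : ∀ e ∈ atlas (Cn n) M, ∀ e' ∈ atlas (Cn n) M,
    CovF (trans e e') (overlap e e') (Θ e) (Θ e')

/-- A smooth closed form which is a polynomial in forms of even degree. -/
structure GlobC (Θ : OpenPartialHomeomorph M (Cn n) → Cn n → Form n) : Prop extends
    GlobF M Θ where
  closed : ∀ e ∈ atlas (Cn n) M, ClosedF e.target (Θ e)
  central : ∀ e z, Θ e z ∈ Subalgebra.center ℂ (Form n)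

variable {M}

namespace GlobS

variable {f h : OpenPartialHomeomorph M (Cn n) → Cn n → ℂ}

theorem const (c : ℂ) : GlobS M (fun _ _ => c : OpenPartialHomeomorph M (Cn n) → Cn n → ℂ) :=
  ⟨fun _ _ => contDiffOn_const, fun _ _ _ _ _ _ => rfl⟩

variable [IsManifold 𝓘(ℂ, Cn n) ω M]

theorem hess (hf : GlobS M f) : GlobM M fun e => hess (f e) :=
  ⟨fun e he => (closed11_hess e.open_target (hf.smooth e he)).smooth,
    fun e he e' he' => (locBihol_trans he he').hess_cov (hf.cov e he e' he') (hf.smooth e' he')⟩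

theorem del (hf : GlobS M f) : GlobF M fun e => del (f e) :=
  ⟨fun e he => (SmF.sum _ fun j _ => SmF.smul (contDiffOn_wd e.open_target (hf.smooth e he) 0 j)
      (SmF.const (dz j))).congr fun z _ => del_eq _ z,
    fun e he e' he' => (locBihol_trans he he').del_cov (hf.cov e he e' he') (hf.smooth e' he')⟩

theorem delbar (hf : GlobS M f) : GlobF M fun e => delbar (f e) :=
  ⟨fun e he => (SmF.sum _ fun j _ => SmF.smul (contDiffOn_wd e.open_target (hf.smooth e he) 1 j)
      (SmF.const (dzb j))).congr fun z _ => delbar_eq _ z,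
    fun e he e' he' => (locBihol_trans he he').delbar_cov (hf.cov e he e' he') (hf.smooth e' he')⟩

end GlobS

namespace GlobF

variable {Θ Ξ : OpenPartialHomeomorph M (Cn n) → Cn n → Form n}
  {f : OpenPartialHomeomorph M (Cn n) → Cn n → ℂ}
  {A : OpenPartialHomeomorph M (Cn n) → Cn n → Matrix (Fin n) (Fin n) ℂ}

theorem form11 (hA : GlobM M A) : GlobF M fun e z => form11 (A e z) :=
  ⟨fun e he => SmF.form11 (hA.smooth e he), fun e he e' he' => CovF.form11 (hA.cov e he e' he')⟩

theorem kf (hA : GlobM M A) : GlobF M fun e z => kf (A e z) :=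
  ⟨fun e he => (SmF.form11 (hA.smooth e he)).const_smul _,
    fun e he e' he' => CovF.kf (hA.cov e he e' he')⟩

theorem mul (hΘ : GlobF M Θ) (hΞ : GlobF M Ξ) : GlobF M fun e z => Θ e z * Ξ e z :=
  ⟨fun e he => (hΘ.smooth e he).mul (hΞ.smooth e he),
    fun e he e' he' => (hΘ.cov e he e' he').mul (hΞ.cov e he e' he')⟩

theorem add (hΘ : GlobF M Θ) (hΞ : GlobF M Ξ) : GlobF M fun e z => Θ e z + Ξ e z :=
  ⟨fun e he => (hΘ.smooth e he).add (hΞ.smooth e he),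
    fun e he e' he' => (hΘ.cov e he e' he').add (hΞ.cov e he e' he')⟩

theorem smul (hf : GlobS M f) (hΘ : GlobF M Θ) : GlobF M fun e z => f e z • Θ e z :=
  ⟨fun e he => SmF.smul (hf.smooth e he) (hΘ.smooth e he),
    fun e he e' he' => CovF.smul (hf.cov e he e' he') (hΘ.cov e he e' he')⟩

theorem const_smul (c : ℂ) (hΘ : GlobF M Θ) : GlobF M fun e z => c • Θ e z :=
  smul (GlobS.const c) hΘ

theorem neg (hΘ : GlobF M Θ) : GlobF M fun e z => -Θ e z := by
  simpa only [neg_smul, one_smul] using const_smul (-1) hΘ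

theorem powFact (hΘ : GlobF M Θ) (k : ℕ) : GlobF M fun e z => powFact (Θ e z) k :=
  ⟨fun e he => (hΘ.smooth e he).powFact k, fun e he e' he' => (hΘ.cov e he e' he').powFact k⟩

end GlobF

namespace GlobC

variable {Θ Ξ : OpenPartialHomeomorph M (Cn n) → Cn n → Form n}

theorem mul (hΘ : GlobC M Θ) (hΞ : GlobC M Ξ) : GlobC M fun e z => Θ e z * Ξ e z :=
  ⟨hΘ.toGlobF.mul hΞ.toGlobF, fun e he => ClosedF.mul e.open_target (hΘ.closed e he)
    (hΞ.closed e he) (hΘ.smooth e he) (hΞ.smooth e he) (hΘ.central e),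
    fun e z => mul_mem (hΘ.central e z) (hΞ.central e z)⟩

theorem add (hΘ : GlobC M Θ) (hΞ : GlobC M Ξ) : GlobC M fun e z => Θ e z + Ξ e z :=
  ⟨hΘ.toGlobF.add hΞ.toGlobF, fun e he => ClosedF.add e.open_target (hΘ.closed e he)
    (hΞ.closed e he) (hΘ.smooth e he) (hΞ.smooth e he),
    fun e z => add_mem (hΘ.central e z) (hΞ.central e z)⟩

theorem const_smul (c : ℂ) (hΘ : GlobC M Θ) : GlobC M fun e z => c • Θ e z :=
  ⟨hΘ.toGlobF.const_smul c, fun e he => ClosedF.const_smul c (hΘ.closed e he),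
    fun e z => Subalgebra.smul_mem _ (hΘ.central e z) c⟩

theorem powFact (hΘ : GlobC M Θ) (k : ℕ) : GlobC M fun e z => powFact (Θ e z) k :=
  ⟨hΘ.toGlobF.powFact k, fun e he => ClosedF.powFact e.open_target (hΘ.closed e he)
    (hΘ.smooth e he) (hΘ.central e) k, fun e z => powFact_mem_center (hΘ.central e z) k⟩

theorem kf {A : OpenPartialHomeomorph M (Cn n) → Cn n → Matrix (Fin n) (Fin n) ℂ}
    (hA : GlobM M A) (h : ∀ e ∈ atlas (Cn n) M, Closed11 e.target (A e)) :
    GlobC M fun e z => kf (A e z) :=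
  ⟨GlobF.kf hA, fun e he => ClosedF.const_smul _ (ClosedF.form11 e.open_target (h e he)),
    fun _ _ => kf_mem_center _⟩

end GlobC

/-! ### The metric -/

section Metric

variable [IsManifold 𝓘(ℂ, Cn n) ω M] (g : Metric n M)

/-- The chain rule for the inverse chart of e, written as the inverse chart of e' after the change
of coordinates. It makes the coefficient matrix of the metric a (1,1)-tensor. -/
theorem coordVec_eq {e e' : OpenPartialHomeomorph M (Cn n)} (he : e ∈ atlas (Cn n) M)
    (he' : e' ∈ atlas (Cn n) M) {z : Cn n} (hz : z ∈ overlap e e') (j : Fin n) :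
    (coordVec e z j : Cn n) =
      ∑ a, jac (trans e e') z a j • (coordVec e' (trans e e' z) a : Cn n) := by
  have h1 : MDifferentiableAt 𝓘(ℂ, Cn n) 𝓘(ℂ, Cn n) e'.symm (trans e e' z) :=
    ((contMDiffOn_symm_of_mem_maximalAtlas (I := 𝓘(ℂ, Cn n)) (n := ω)
      (IsManifold.subset_maximalAtlas he')).contMDiffAt
        (e'.open_target.mem_nhds (trans_mem hz).1)).mdifferentiableAt (by simp)
  have h2 : MDifferentiableAt 𝓘(ℂ, Cn n) 𝓘(ℂ, Cn n) (trans e e') z :=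
    ((locBihol_trans he he').differentiableAt hz).mdifferentiableAt
  have h3 : mfderiv 𝓘(ℂ, Cn n) 𝓘(ℂ, Cn n) e.symm z =
      mfderiv 𝓘(ℂ, Cn n) 𝓘(ℂ, Cn n) (e'.symm ∘ trans e e') z :=
    Filter.EventuallyEq.mfderiv_eq (Filter.eventually_of_mem
      ((isOpen_overlap e e').mem_nhds hz) fun w hw => (symm_trans hw).symm)
  have h5 : (coordVec e z j : Cn n) = (mfderiv 𝓘(ℂ, Cn n) 𝓘(ℂ, Cn n) e'.symm (trans e e' z) :
      Cn n →L[ℂ] Cn n) (fderiv ℂ (trans e e') z (Pi.single j 1)) := by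
    rw [← mfderiv_eq_fderiv]
    show (mfderiv 𝓘(ℂ, Cn n) 𝓘(ℂ, Cn n) e.symm z : Cn n →L[ℂ] Cn n) (Pi.single j 1) = _
    have := congrArg (fun L : Cn n →L[ℂ] Cn n => L (Pi.single j 1))
      (h3.trans (mfderiv_comp z h1 h2))
    exact this
  exact h5.trans (clm_apply_eq_sum _ _)

theorem Metric.globM : GlobM M g.mat := by
  refine ⟨fun e he j k => g.smooth e he j k, fun e he e' he' z hz => ?_⟩
  ext j k
  have h1 : ∀ {p q : M} (_ : p = q) (v w : Cn n), g.herm p v w = g.herm q v w := by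
    rintro p _ rfl v w; rfl
  have h2 : g.mat e z j k = g.herm (e'.symm (trans e e' z))
      (∑ a, jac (trans e e') z a j • (coordVec e' (trans e e' z) a : Cn n))
      (∑ b, jac (trans e e') z b k • (coordVec e' (trans e e' z) b : Cn n)) := by
    rw [← coordVec_eq he he' hz, ← coordVec_eq he he' hz]
    exact h1 (symm_trans hz).symm _ _
  rw [h2]
  refine (sesq_apply_sum _ _ _ _ _).trans ?_
  rw [Matrix.mul_apply]
  simp only [Matrix.mul_apply, Matrix.transpose_apply]
  rfl

omit [IsManifold 𝓘(ℂ, Cn n) ω M] in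
theorem Metric.isHermitian (e : OpenPartialHomeomorph M (Cn n)) (z : Cn n) :
    (g.mat e z).IsHermitian := by
  ext j k
  exact (g.symm _ _ _).symm

end Metric

section Real

variable [IsManifold 𝓘(ℂ, Cn n) ω M]

theorem contDiffOn_read {f : M → ℝ} (hf : ContMDiff 𝓘(ℝ, Cn n) 𝓘(ℝ, ℝ) ∞ f)
    {e : OpenPartialHomeomorph M (Cn n)} (he : e ∈ atlas (Cn n) M) :
    ContDiffOn ℝ ∞ (read f e) e.target := by
  have := isManifold_real (n := n) M
  have h1 : ContMDiffOn 𝓘(ℝ, Cn n) 𝓘(ℝ, Cn n) ∞ e.symm e.target :=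
    contMDiffOn_symm_of_mem_maximalAtlas (IsManifold.subset_maximalAtlas he)
  have h2 := (hf.contMDiffOn (s := Set.univ)).comp h1 fun _ _ => Set.mem_univ _
  exact Complex.ofRealCLM.contDiff.comp_contDiffOn (contMDiffOn_iff_contDiffOn.1 h2)

theorem globS_read {f : M → ℝ} (hf : ContMDiff 𝓘(ℝ, Cn n) 𝓘(ℝ, ℝ) ∞ f) :
    GlobS M (read f : OpenPartialHomeomorph M (Cn n) → Cn n → ℂ) :=
  ⟨fun e he => contDiffOn_read hf he, fun e he e' he' z hz => by rw [read, read, symm_trans hz]⟩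

end Real

/-! ### Integration in a chart -/

section Local

open MeasureTheory

theorem integrableOn_of_support {U K : Set (Cn n)} (hU : IsOpen U) (hK : IsCompact K) (hKU : K ⊆ U)
    {F : Cn n → ℂ} (hF : ContinuousOn F U) (h0 : ∀ z ∈ U, z ∉ K → F z = 0) : IntegrableOn F U :=
  ((hF.mono hKU).integrableOn_compact hK).of_forall_sdiff_eq_zero hU.measurableSet
    fun z hz => h0 z hz.1 hz.2

/-- Extended by zero, F is a compactly supported smooth function on the whole space; integrating its
derivative by parts against the constant 1 gives zero. -/
theorem integral_fderiv_eq_zero {U K : Set (Cn n)} (hU : IsOpen U) (hK : IsCompact K) (hKU : K ⊆ U)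
    {F : Cn n → ℂ} (hF : ContDiffOn ℝ ∞ F U) (h0 : ∀ z ∈ U, z ∉ K → F z = 0) (v : Cn n) :
    ∫ z in U, fderiv ℝ F z v = 0 := by
  let F0 : Cn n → ℂ := K.indicator F
  have e1 : ∀ z ∈ U, F0 z = F z := fun z hz => by
    by_cases hzK : z ∈ K
    · exact Set.indicator_of_mem hzK F
    · rw [h0 z hz hzK]; exact Set.indicator_of_notMem hzK F
  have e2 : ∀ z ∈ Kᶜ, F0 z = 0 := fun z hz => Set.indicator_of_notMem hz F
  have e3 : ∀ z ∈ U, F0 =ᶠ[𝓝 z] F := fun z hz => Filter.eventually_of_mem (hU.mem_nhds hz) e1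
  have e4 : ∀ z ∈ Kᶜ, F0 =ᶠ[𝓝 z] fun _ => 0 := fun z hz =>
    Filter.eventually_of_mem (hK.isClosed.isOpen_compl.mem_nhds hz) e2
  have hs : ContDiff ℝ ∞ F0 := contDiff_iff_contDiffAt.2 fun z => by
    by_cases hzK : z ∈ K
    · exact (hF.contDiffAt (hU.mem_nhds (hKU hzK))).congr_of_eventuallyEq (e3 z (hKU hzK))
    · exact contDiffAt_const.congr_of_eventuallyEq (e4 z hzK)
  have hc : HasCompactSupport F0 := HasCompactSupport.intro hK e2
  have hd : Continuous fun z => fderiv ℝ F0 z v :=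
    (hs.continuous_fderiv (by simp)).clm_apply continuous_const
  have i1 : Integrable (fun z => fderiv ℝ F0 z v) := hd.integrable_of_hasCompactSupport
    (HasCompactSupport.intro hK fun z hz => by
      rw [(e4 z hz).fderiv_eq, fderiv_const_apply]; rfl)
  have i2 : Integrable F0 := hs.continuous.integrable_of_hasCompactSupport hc
  have key := integral_mul_fderiv_eq_neg_fderiv_mul_of_integrable (μ := volume) (f := F0)
    (g := fun _ => (1 : ℂ)) (v := v) (by simpa using i1) (by simp) (by simpa using i2)
    (fun x _ => (hs.differentiable (by simp)) x) (fun x _ => differentiableAt_const _)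
  simp only [fderiv_fun_const, Pi.zero_apply, zero_apply, mul_zero, integral_zero, mul_one] at key
  have e5 : ∫ z in U, fderiv ℝ F z v = ∫ z in U, fderiv ℝ F0 z v :=
    setIntegral_congr_fun hU.measurableSet fun z hz => by rw [(e3 z hz).fderiv_eq]
  rw [e5, setIntegral_eq_integral_of_forall_compl_eq_zero, ← neg_eq_zero, ← key]
  intro z hz
  rw [(e4 z fun h => hz (hKU h)).fderiv_eq, fderiv_const_apply]; rfl

theorem integral_wd_eq_zero {U K : Set (Cn n)} (hU : IsOpen U) (hK : IsCompact K) (hKU : K ⊆ U)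
    {F : Cn n → ℂ} (hF : ContDiffOn ℝ ∞ F U) (h0 : ∀ z ∈ U, z ∉ K → F z = 0) (τ : Fin 2)
    (j : Fin n) : ∫ z in U, wd τ j F z = 0 := by
  have h := integral_fderiv_eq_zero hU hK hKU hF h0
  have i : ∀ v, IntegrableOn (fun z => fderiv ℝ F z v) U := fun v =>
    integrableOn_of_support hU hK hKU (contDiffOn_fderiv_apply hU hF v).continuousOn
      fun z hz hzK => by
        have : F =ᶠ[𝓝 z] fun _ => 0 := Filter.eventually_of_mem
          ((hU.inter hK.isClosed.isOpen_compl).mem_nhds ⟨hz, hzK⟩) fun w hw => h0 w hw.1 hw.2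
        rw [this.fderiv_eq, fderiv_const_apply]; rfl
  simp only [wd]
  rw [integral_const_mul, integral_sub (i _) ((i _).const_mul _), integral_const_mul, h, h]
  simp

/-- The change of variables formula for densities on complex manifolds. -/
theorem LocBihol.integral_image {U V : Set (Cn n)} {τ : Cn n → Cn n} (h : LocBihol U V τ)
    (hi : Set.InjOn τ U) (D : Cn n → ℂ) :
    ∫ z in τ '' U, D z =
      ∫ z in U, ((jac τ z).det * (starRingEnd ℂ) (jac τ z).det) * D (τ z) := by
  have hd : ∀ z ∈ U, HasFDerivWithinAt τ ((fderiv ℂ τ z).restrictScalars ℝ) U z := fun z hz =>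
    ((h.differentiableAt hz).hasFDerivAt.restrictScalars ℝ).hasFDerivWithinAt
  rw [integral_image_eq_integral_abs_det_fderiv_smul volume h.isOpen.measurableSet hd hi]
  refine setIntegral_congr_fun h.isOpen.measurableSet fun z hz => ?_
  -- The real determinant of a complex-linear map is the norm of its complex determinant, that is
  -- its squared modulus.
  have h1 : ((fderiv ℂ τ z).restrictScalars ℝ).det = Complex.normSq (jac τ z).det := by
    have h2 : LinearMap.toMatrix' (fderiv ℂ τ z : Cn n →ₗ[ℂ] Cn n) = jac τ z := by
      ext a j; rw [LinearMap.toMatrix'_apply]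
      simp [jac]
    have h3 : LinearMap.det (fderiv ℂ τ z : Cn n →ₗ[ℂ] Cn n) = (jac τ z).det := by
      rw [← h2, LinearMap.det_toMatrix']
    show LinearMap.det ((fderiv ℂ τ z : Cn n →ₗ[ℂ] Cn n).restrictScalars ℝ) = _
    rw [LinearMap.det_restrictScalars, h3, Algebra.norm_complex_apply]
  beta_reduce
  rw [h1, abs_of_nonneg (Complex.normSq_nonneg _), Complex.real_smul, Complex.mul_conj]

end Local

/-! ### Integration on the manifold -/

section Global

open MeasureTheory

variable {M : Type*} [TopologicalSpace M] [ChartedSpace (Cn n) M] [IsManifold 𝓘(ℂ, Cn n) ω M]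
  [CompactSpace M] [T2Space M]

variable (n M) in
/-- The indices of the nonzero functions of the partition of unity. -/
def pouIdx : Finset M := (pou n M).locallyFinite.finite_nonempty_of_compact.toFinset

theorem pou_eq_zero {x : M} (hx : x ∉ pouIdx n M) (p : M) : pou n M x p = 0 := by
  by_contra h
  exact hx ((Set.Finite.mem_toFinset _).2 ⟨p, h⟩)

theorem sum_pou (p : M) : ∑ x ∈ pouIdx n M, pou n M x p = 1 := by
  rw [← (pou n M).sum_eq_one (Set.mem_univ p), finsum_eq_sum_of_support_subset]
  intro x hx
  by_contra h
  exact hx (pou_eq_zero h p)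

theorem pou_subordinate (x : M) : tsupport (pou n M x) ⊆ (chartAt (Cn n) x).source := by
  have := isManifold_real (n := n) M
  exact (SmoothPartitionOfUnity.exists_isSubordinate_chartAt_source 𝓘(ℝ, Cn n) M).choose_spec x

theorem contDiffOn_pou (x : M) {e : OpenPartialHomeomorph M (Cn n)} (he : e ∈ atlas (Cn n) M) :
    ContDiffOn ℝ ∞ (read (pou n M x) e) e.target :=
  contDiffOn_read (pou n M x).contMDiff he

/-- The coordinate expression of the support of a function of the partition of unity. -/
def pouSupp (n : ℕ) {M : Type*} [TopologicalSpace M] [ChartedSpace (Cn n) M]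
    [IsManifold 𝓘(ℂ, Cn n) ω M] [CompactSpace M] [T2Space M] (x : M) : Set (Cn n) :=
  chartAt (Cn n) x '' tsupport (pou n M x)

theorem isCompact_pouSupp (x : M) : IsCompact (pouSupp n x) :=
  (isClosed_tsupport _).isCompact.image_of_continuousOn
    ((chartAt (Cn n) x).continuousOn.mono (pou_subordinate x))

theorem pouSupp_subset (x : M) : pouSupp n x ⊆ (chartAt (Cn n) x).target := by
  rintro _ ⟨p, hp, rfl⟩
  exact (chartAt (Cn n) x).map_source (pou_subordinate x hp)

theorem notMem_tsupport {x : M} {z : Cn n} (hz : z ∈ (chartAt (Cn n) x).target)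
    (hK : z ∉ pouSupp n x) : (chartAt (Cn n) x).symm z ∉ tsupport (pou n M x) :=
  fun h => hK ⟨_, h, (chartAt (Cn n) x).right_inv hz⟩

theorem read_pou_eq_zero {x : M} {z : Cn n} (hz : z ∈ (chartAt (Cn n) x).target)
    (hK : z ∉ pouSupp n x) : read (pou n M x) (chartAt (Cn n) x) z = 0 := by
  rw [read, image_eq_zero_of_notMem_tsupport (notMem_tsupport hz hK), Complex.ofReal_zero]

theorem wd_pou_eq_zero {x : M} {e : OpenPartialHomeomorph M (Cn n)} {z : Cn n} (hz : z ∈ e.target)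
    (h : e.symm z ∉ tsupport (pou n M x)) (τ : Fin 2) (j : Fin n) :
    wd τ j (read (pou n M x) e) z = 0 := by
  have h1 : IsOpen (e.target ∩ e.symm ⁻¹' (tsupport (pou n M x))ᶜ) :=
    e.symm.isOpen_inter_preimage (isClosed_tsupport _).isOpen_compl
  rw [wd_congr_on (g := fun _ => 0) h1 ⟨hz, h⟩, wd_const]
  intro w hw
  rw [read, image_eq_zero_of_notMem_tsupport hw.2, Complex.ofReal_zero]

theorem integral_eq_sum (η : OpenPartialHomeomorph M (Cn n) → Cn n → Form n) :
    integral η = ∑ x ∈ pouIdx n M, ∫ z in (chartAt (Cn n) x).target,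
      read (pou n M x) (chartAt (Cn n) x) z * topL n (η (chartAt (Cn n) x) z) := by
  rw [integral, finsum_eq_sum_of_support_subset (s := pouIdx n M)]
  · rfl
  · intro x hx
    by_contra h
    refine hx ?_
    simp only [pou_eq_zero h, Complex.ofReal_zero, zero_mul, integral_zero]

theorem integrableOn_pou_mul (x : M) {D : Cn n → ℂ}
    (hD : ContinuousOn D (chartAt (Cn n) x).target) :
    IntegrableOn (fun z => read (pou n M x) (chartAt (Cn n) x) z * D z)
      (chartAt (Cn n) x).target :=
  integrableOn_of_support (chartAt (Cn n) x).open_target (isCompact_pouSupp x) (pouSupp_subset x)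
    ((contDiffOn_pou x (chart_mem_atlas _ x)).continuousOn.mul hD)
    fun z hz hK => by rw [read_pou_eq_zero hz hK, zero_mul]

theorem integral_congr {η ξ : OpenPartialHomeomorph M (Cn n) → Cn n → Form n}
    (h : ∀ e ∈ atlas (Cn n) M, ∀ z ∈ e.target, topL n (η e z) = topL n (ξ e z)) :
    integral η = integral ξ := by
  rw [integral_eq_sum, integral_eq_sum]
  refine Finset.sum_congr rfl fun x _ =>
    setIntegral_congr_fun (chartAt (Cn n) x).open_target.measurableSet fun z hz => ?_
  rw [h _ (chart_mem_atlas _ x) z hz]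

/-- Continuity of the top degree component in all charts. -/
def ContTop (η : OpenPartialHomeomorph M (Cn n) → Cn n → Form n) : Prop :=
  ∀ e ∈ atlas (Cn n) M, ContinuousOn (fun z => topL n (η e z)) e.target

omit [IsManifold 𝓘(ℂ, Cn n) ω M] [CompactSpace M] [T2Space M] in
theorem GlobF.contTop {η : OpenPartialHomeomorph M (Cn n) → Cn n → Form n} (h : GlobF M η) :
    ContTop η := fun e he => (h.smooth e he (topL n)).continuousOn

theorem integral_add {η ξ : OpenPartialHomeomorph M (Cn n) → Cn n → Form n} (hη : ContTop η)
    (hξ : ContTop ξ) : integral (fun e z => η e z + ξ e z) = integral η + integral ξ := by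
  rw [integral_eq_sum, integral_eq_sum, integral_eq_sum, ← Finset.sum_add_distrib]
  refine Finset.sum_congr rfl fun x _ => ?_
  simp only [map_add, mul_add]
  exact MeasureTheory.integral_add (integrableOn_pou_mul x (hη _ (chart_mem_atlas _ x)))
    (integrableOn_pou_mul x (hξ _ (chart_mem_atlas _ x)))

theorem integral_smul (c : ℂ) (η : OpenPartialHomeomorph M (Cn n) → Cn n → Form n) :
    integral (fun e z => c • η e z) = c * integral η := by
  rw [integral_eq_sum, integral_eq_sum, Finset.mul_sum]
  refine Finset.sum_congr rfl fun x _ => ?_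
  rw [← integral_const_mul]
  simp only [map_smul, smul_eq_mul, mul_left_comm]

omit [CompactSpace M] [T2Space M] in
/-- Densities can be integrated in any chart containing their support. -/
theorem integral_chart_eq {D : OpenPartialHomeomorph M (Cn n) → Cn n → ℂ}
    {e e' : OpenPartialHomeomorph M (Cn n)} (he : e ∈ atlas (Cn n) M) (he' : e' ∈ atlas (Cn n) M)
    (hD : ∀ z ∈ overlap e e', D e z = ((jac (trans e e') z).det *
      (starRingEnd ℂ) (jac (trans e e') z).det) * D e' (trans e e' z))
    (h1 : ∀ z ∈ e.target, e.symm z ∉ e'.source → D e z = 0)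
    (h2 : ∀ z ∈ e'.target, e'.symm z ∉ e.source → D e' z = 0) :
    ∫ z in e.target, D e z = ∫ z in e'.target, D e' z := by
  have r1 : ∫ z in e.target, D e z = ∫ z in overlap e e', D e z :=
    setIntegral_eq_of_subset_of_forall_sdiff_eq_zero e.open_target.measurableSet
      Set.inter_subset_left fun z hz => h1 z hz.1 fun h => hz.2 ⟨hz.1, h⟩
  have r2 : ∫ z in e'.target, D e' z = ∫ z in overlap e' e, D e' z :=
    setIntegral_eq_of_subset_of_forall_sdiff_eq_zero e'.open_target.measurableSet
      Set.inter_subset_left fun z hz => h2 z hz.1 fun h => hz.2 ⟨hz.1, h⟩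
  have hi : trans e e' '' overlap e e' = overlap e' e := by
    apply Set.Subset.antisymm
    · rintro _ ⟨z, hz, rfl⟩; exact trans_mem hz
    · exact fun z hz => ⟨trans e' e z, trans_mem hz, trans_trans hz⟩
  rw [r1, r2, ← hi, (locBihol_trans he he').integral_image
    fun z hz w hw h => by rw [← trans_trans hz, h, trans_trans hw]]
  exact setIntegral_congr_fun (isOpen_overlap e e').measurableSet hD

/-- `∂f` for `τ = 0` and `∂̄f` for `τ = 1`. -/
def ddel (τ : Fin 2) (f : Cn n → ℂ) (z : Cn n) : Form n := ∑ i, wd τ i f z • dw τ i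

omit [CompactSpace M] [T2Space M] in
theorem GlobS.ddel {f : OpenPartialHomeomorph M (Cn n) → Cn n → ℂ} (hf : GlobS M f) (τ : Fin 2) :
    GlobF M fun e => ddel τ (f e) := by
  fin_cases τ
  · exact hf.del
  · have := hf.delbar
    have e : ∀ f : Cn n → ℂ, Kahler.ddel 1 f = Kahler.delbar f := fun f => by
      funext z; rw [delbar_eq]; rfl
    simp only [← e] at this
    exact this

theorem ddel_pou_eq_zero {x : M} {e : OpenPartialHomeomorph M (Cn n)} {z : Cn n}
    (hz : z ∈ e.target) (h : e.symm z ∉ tsupport (pou n M x)) (τ : Fin 2) :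
    ddel τ (read (pou n M x) e) z = 0 := by
  simp only [ddel, wd_pou_eq_zero hz h, zero_smul, Finset.sum_const_zero]

/-- The differential of ρ_x Ξ has integral zero in the chart, since ρ_x has compact support there.
The remaining term contains dρ_x and still has support inside the chart. -/
theorem integral_pou_div {Ξ : OpenPartialHomeomorph M (Cn n) → Cn n → Form n} (hΞ : GlobF M Ξ)
    (τ : Fin 2) (x : M) :
    ∫ z in (chartAt (Cn n) x).target, read (pou n M x) (chartAt (Cn n) x) z *
        ∑ i, wd τ i (fun w => topL n (dw τ i * Ξ (chartAt (Cn n) x) w)) z =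
      -∫ z in (chartAt (Cn n) x).target,
        topL n (ddel τ (read (pou n M x) (chartAt (Cn n) x)) z * Ξ (chartAt (Cn n) x) z) := by
  set e := chartAt (Cn n) x with he
  have hat : e ∈ atlas (Cn n) M := chart_mem_atlas _ x
  let b : Fin n → Cn n → ℂ := fun i w => topL n (dw τ i * Ξ e w)
  have sρ := contDiffOn_pou x hat
  have sb : ∀ i, ContDiffOn ℝ ∞ (b i) e.target := fun i =>
    hΞ.smooth e hat (lmul (topL n) (dw τ i))
  have hK : ∀ i, ∀ z ∈ e.target, z ∉ pouSupp n x → read (pou n M x) e z * b i z = 0 :=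
    fun i z hz hzK => by rw [read_pou_eq_zero hz hzK, zero_mul]
  have sF : ∀ i, ContDiffOn ℝ ∞ (fun z => read (pou n M x) e z * b i z) e.target :=
    fun i => sρ.mul (sb i)
  have h1 : ∀ i, IntegrableOn (wd τ i fun z => read (pou n M x) e z * b i z) e.target := fun i =>
    integrableOn_of_support e.open_target (isCompact_pouSupp x) (pouSupp_subset x)
      (contDiffOn_wd e.open_target (sF i) τ i).continuousOn fun z hz hzK => by
        rw [wd_congr_on (g := fun _ => 0) (e.open_target.inter
          (isCompact_pouSupp x).isClosed.isOpen_compl) ⟨hz, hzK⟩ fun w hw => hK i w hw.1 hw.2,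
          wd_const]
  have h2 : ∫ z in e.target, ∑ i, wd τ i (fun z => read (pou n M x) e z * b i z) z = 0 := by
    rw [integral_finsetSum _ fun i _ => h1 i]
    exact Finset.sum_eq_zero fun i _ => integral_wd_eq_zero e.open_target (isCompact_pouSupp x)
      (pouSupp_subset x) (sF i) (hK i) τ i
  have h3 : ∀ z ∈ e.target, ∑ i, wd τ i (fun z => read (pou n M x) e z * b i z) z =
      read (pou n M x) e z * ∑ i, wd τ i (b i) z
        + topL n (ddel τ (read (pou n M x) e) z * Ξ e z) := by
    intro z hz
    simp only [ddel, Finset.sum_mul, smul_mul_assoc, map_sum, map_smul, smul_eq_mul,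
      Finset.mul_sum, ← Finset.sum_add_distrib]
    refine Finset.sum_congr rfl fun i _ => ?_
    rw [wd_mul (ContDiffOn.diffAt e.open_target hz sρ) (ContDiffOn.diffAt e.open_target hz (sb i)),
      add_comm]
  rw [setIntegral_congr_fun e.open_target.measurableSet h3, MeasureTheory.integral_add] at h2
  · exact eq_neg_of_add_eq_zero_left h2
  · exact integrableOn_pou_mul x (ContDiffOn.sum fun i _ =>
      contDiffOn_wd e.open_target (sb i) τ i).continuousOn
  · refine integrableOn_of_support e.open_target (isCompact_pouSupp x) (pouSupp_subset x)
      (((((globS_read (pou n M x).contMDiff).ddel τ).mul hΞ).smooth e hat) (topL n)).continuousOn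
      fun z hz hzK => ?_
    rw [ddel_pou_eq_zero hz (notMem_tsupport hz hzK), zero_mul, map_zero]

/-- Stokes' theorem for forms given by their coordinate expressions. -/
theorem integral_eq_zero_of_div {Ξ η : OpenPartialHomeomorph M (Cn n) → Cn n → Form n}
    (hΞ : GlobF M Ξ) (τ : Fin 2) (h : ∀ e ∈ atlas (Cn n) M, ∀ z ∈ e.target,
      topL n (η e z) = ∑ i, wd τ i (fun w => topL n (dw τ i * Ξ e w)) z) : integral η = 0 := by
  have hc := fun x : M => chart_mem_atlas (Cn n) x
  let D : M → OpenPartialHomeomorph M (Cn n) → Cn n → ℂ := fun x e z =>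
    topL n (ddel τ (read (pou n M x) e) z * Ξ e z)
  have sD : ∀ x, GlobF M fun e z => ddel τ (read (pou n M x) e) z * Ξ e z := fun x =>
    ((globS_read (pou n M x).contMDiff).ddel τ).mul hΞ
  have cD : ∀ x, ∀ e ∈ atlas (Cn n) M, ContinuousOn (D x e) e.target := fun x e he =>
    ((sD x).smooth e he (topL n)).continuousOn
  have h1 : ∀ x, ∫ z in (chartAt (Cn n) x).target,
      read (pou n M x) (chartAt (Cn n) x) z * topL n (η (chartAt (Cn n) x) z) =
      -∑ y ∈ pouIdx n M, ∫ z in (chartAt (Cn n) y).target,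
        read (pou n M y) (chartAt (Cn n) y) z * D x (chartAt (Cn n) y) z := by
    intro x
    rw [setIntegral_congr_fun (chartAt (Cn n) x).open_target.measurableSet
      (g := fun z => read (pou n M x) (chartAt (Cn n) x) z *
        ∑ i, wd τ i (fun w => topL n (dw τ i * Ξ (chartAt (Cn n) x) w)) z)
      fun z hz => by rw [h _ (hc x) z hz], integral_pou_div hΞ]
    congr 1
    -- Inserting 1 = ∑ ρ_y splits dρ_x ∧ Ξ into pieces supported in both charts, and the piece with
    -- ρ_y is moved to the chart at y. There the sum over x can be taken first.
    have h2 : ∀ z, D x (chartAt (Cn n) x) z = ∑ y ∈ pouIdx n M,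
        read (pou n M y) (chartAt (Cn n) x) z * D x (chartAt (Cn n) x) z := fun z => by
      rw [← Finset.sum_mul]
      have := sum_pou (n := n) ((chartAt (Cn n) x).symm z)
      simp only [read, ← Complex.ofReal_sum, this, Complex.ofReal_one, one_mul]
    show ∫ z in _, D x (chartAt (Cn n) x) z = _
    rw [MeasureTheory.integral_congr_ae (Filter.Eventually.of_forall h2), integral_finsetSum]
    · refine Finset.sum_congr rfl fun y _ => ?_
      refine integral_chart_eq (D := fun e z => read (pou n M y) e z * D x e z) (hc x) (hc y) ?_ ?_ ?_
      · intro z hz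
        have e1 := (globS_read (pou n M y).contMDiff).cov _ (hc x) _ (hc y) z hz
        have e2 := ((sD x).cov _ (hc x) _ (hc y)).topL hz
        rw [e1]
        show _ * topL n _ = _ * (_ * topL n _)
        rw [e2]
        ring
      · intro z hz hzs
        rw [read, image_eq_zero_of_notMem_tsupport fun h => hzs (pou_subordinate y h),
          Complex.ofReal_zero, zero_mul]
      · intro z hz hzs
        show _ * topL n _ = 0
        rw [ddel_pou_eq_zero hz fun h => hzs (pou_subordinate x h), zero_mul, map_zero, mul_zero]
    · intro y _
      refine integrableOn_of_support (chartAt (Cn n) x).open_target (isCompact_pouSupp x)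
        (pouSupp_subset x) ((contDiffOn_pou y (hc x)).continuousOn.mul (cD x _ (hc x)))
        fun z hz hzK => ?_
      show _ * topL n _ = 0
      rw [ddel_pou_eq_zero hz (notMem_tsupport hz hzK), zero_mul, map_zero, mul_zero]
  rw [integral_eq_sum, Finset.sum_congr rfl fun x _ => h1 x, Finset.sum_neg_distrib, neg_eq_zero,
    Finset.sum_comm]
  refine Finset.sum_eq_zero fun y _ => ?_
  rw [← integral_finsetSum _ fun x _ => integrableOn_pou_mul y (cD x _ (hc y))]
  rw [setIntegral_congr_fun (chartAt (Cn n) y).open_target.measurableSet (g := fun _ => 0),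
    integral_zero]
  intro z hz
  beta_reduce
  rw [← Finset.mul_sum]
  -- The sum of the partition of unity is constant, so its derivatives add up to zero.
  have h3 : ∀ i, ∑ x ∈ pouIdx n M, wd τ i (read (pou n M x) (chartAt (Cn n) y)) z = 0 := by
    intro i
    rw [← wd_sum _ fun x _ => ContDiffOn.diffAt (chartAt (Cn n) y).open_target hz
      (contDiffOn_pou x (hc y)), ← wd_const (τ := τ) (j := i) (z := z) (1 : ℂ)]
    congr 1
    funext w
    have := sum_pou (n := n) ((chartAt (Cn n) y).symm w)
    simp only [read, ← Complex.ofReal_sum, this, Complex.ofReal_one]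
  have h4 : ∑ x ∈ pouIdx n M, ddel τ (read (pou n M x) (chartAt (Cn n) y)) z = 0 := by
    simp only [ddel]
    rw [Finset.sum_comm]
    exact Finset.sum_eq_zero fun i _ => by rw [← Finset.sum_smul, h3, zero_smul]
  have h5 : ∑ x ∈ pouIdx n M, D x (chartAt (Cn n) y) z = 0 := by
    show ∑ x ∈ pouIdx n M, topL n _ = 0
    rw [← map_sum, ← Finset.sum_mul, h4, zero_mul, map_zero]
  rw [h5, mul_zero]

/-! ### Integration by parts -/

section Parts

variable {F h : OpenPartialHomeomorph M (Cn n) → Cn n → ℂ}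
  {Θ : OpenPartialHomeomorph M (Cn n) → Cn n → Form n}

theorem integral_parts0 (hF : GlobS M F) (hh : GlobS M h) (hΘ : GlobC M Θ) :
    integral (fun e z => (F e z • form11 (hess (h e) z) + del (F e) z * delbar (h e) z) * Θ e z)
      = 0 :=
  integral_eq_zero_of_div ((GlobF.smul hF hh.delbar).mul hΘ.toGlobF) 0 fun e he _ hz =>
    (div_parts0 e.open_target (hΘ.closed e he) (hΘ.smooth e he) (topL n) hz (hF.smooth e he)
      (hh.smooth e he)).symm

theorem integral_parts1 (hF : GlobS M F) (hh : GlobS M h) (hΘ : GlobC M Θ) :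
    integral (fun e z => (h e z • form11 (hess (F e) z) + del (F e) z * delbar (h e) z) * Θ e z)
      = 0 :=
  integral_eq_zero_of_div ((GlobF.smul hh hF.del).neg.mul hΘ.toGlobF) 1 fun e he _ hz =>
    (div_parts1 e.open_target (hΘ.closed e he) (hΘ.smooth e he) (topL n) hz (hF.smooth e he)
      (hh.smooth e he)).symm

end Parts

end Global

/-! ### The geometric forms of a Kähler metric -/

section Geometry

variable {M : Type*} [TopologicalSpace M] [ChartedSpace (Cn n) M]

/-- The structure records only ∂ω = 0; the identity ∂̄ω = 0 follows by conjugation from the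
Hermitian symmetry. -/
theorem Metric.closed11 (g : Metric n M) {e : OpenPartialHomeomorph M (Cn n)}
    (he : e ∈ atlas (Cn n) M) : Closed11 e.target (g.mat e) := by
  have hc : ∀ z ∈ e.target, ∀ i j k, wd 0 i (fun w => g.mat e w j k) z =
      wd 0 j (fun w => g.mat e w i k) z := fun z hz i j k => g.closed e he z hz i j k
  refine ⟨fun j k => g.smooth e he j k, hc, fun z hz l j k => ?_⟩
  have h1 : ∀ a b, (fun w => g.mat e w a b) = fun w => (starRingEnd ℂ) (g.mat e w b a) :=
    fun a b => funext fun w => ((g.isHermitian e w).apply a b).symm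
  rw [h1 j k, h1 j l, ← wd_conj, ← wd_conj, hc z hz l k j]

/-- The coordinate expressions of the metric are invertible. -/
def Metric.Regular (g : Metric n M) : Prop :=
  ∀ e ∈ atlas (Cn n) M, ∀ z ∈ e.target, IsUnit (g.mat e z).det

theorem Metric.Regular.isKahler {g : Metric n M} (hg : g.Regular)
    {e : OpenPartialHomeomorph M (Cn n)} (he : e ∈ atlas (Cn n) M) :
    IsKahler e.target (g.mat e) :=
  ⟨g.closed11 he, fun w _ => g.isHermitian e w, fun w hw => hg e he w hw⟩

variable [IsManifold 𝓘(ℂ, Cn n) ω M] {g : Metric n M} (hg : g.Regular)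
  {f : OpenPartialHomeomorph M (Cn n) → Cn n → ℂ} (hf : GlobS M f)

variable (g) in
theorem Metric.globC_omega : GlobC M fun e => omega (g.mat e) :=
  GlobC.kf g.globM fun _ he => g.closed11 he

theorem GlobS.globC_iddbar (hf : GlobS M f) : GlobC M fun e => iddbar (f e) :=
  GlobC.kf hf.hess fun e he => closed11_hess e.open_target (hf.smooth e he)

namespace Metric.Regular

include hg

theorem globM_ric : GlobM M fun e => ric (g.mat e) :=
  ⟨fun e he => smM_ric e.open_target (g.closed11 he).smooth (hg e he), fun e he e' he' =>
    (locBihol_trans he he').ric_cov (g.globM.cov e he e' he') (g.closed11 he').smooth (hg e' he')⟩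

theorem globC_ricForm : GlobC M fun e => ricForm (g.mat e) :=
  GlobC.kf hg.globM_ric fun e he => closed11_ric e.open_target (g.closed11 he).smooth (hg e he)

theorem globS_trace {A : OpenPartialHomeomorph M (Cn n) → Cn n → Matrix (Fin n) (Fin n) ℂ}
    (hA : GlobM M A) : GlobS M fun e z => (A e z * (g.mat e z)⁻¹).trace :=
  ⟨fun e he => ((hA.smooth e he).mul ((g.closed11 he).smooth.inv (hg e he))).trace,
    fun e he e' he' _ hz => (locBihol_trans he he').trace_mul_inv_eq hz
      (g.globM.cov e he e' he') (hA.cov e he e' he')⟩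

theorem globS_scal : GlobS M fun e => scal (g.mat e) := by
  have := hg.globS_trace hg.globM_ric
  simp only [← scal_eq] at this
  exact this

theorem globS_lap (hf : GlobS M f) : GlobS M fun e => lap (g.mat e) (f e) := by
  have := hg.globS_trace hf.hess
  simp only [← lap_eq] at this
  exact this

theorem globC_trace2 : GlobC M fun e => chernWeil trace2 (g.mat e) :=
  ⟨⟨fun e he => by
      have sR := smM_curv e.open_target (g.closed11 he).smooth (hg e he)
      exact SmF.form22 fun j k r s => ((sR j k).mul (sR r s)).trace,
    fun e he e' he' => (locBihol_trans he he').chernWeil_trace2_cov (g.globM.cov e he e' he')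
      (g.closed11 he').smooth (hg e' he')⟩,
    fun e he => ClosedF.chernWeil_trace2 e.open_target (g.closed11 he).smooth (hg e he),
    fun e z => by rw [chernWeil_eq]; exact form22_mem_center _⟩

theorem globC_td2 : GlobC M fun e => chernWeil td2Polar (g.mat e) := by
  have : (fun e : OpenPartialHomeomorph M (Cn n) => chernWeil td2Polar (g.mat e)) = fun e z =>
      (1 / 8 : ℂ) • (ricForm (g.mat e) z * ricForm (g.mat e) z)
        + (1 / 24 : ℂ) • chernWeil trace2 (g.mat e) z := by
    funext e z
    rw [chernWeil_td2, pow_two]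
  rw [this]
  exact ((hg.globC_ricForm.mul hg.globC_ricForm).const_smul _).add (hg.globC_trace2.const_smul _)

theorem globF_dgamCurv (hf : GlobS M f) :
    GlobF M fun e => dgamCurv (g.mat e) (hess (f e)) :=
  ⟨fun e he => by
      have sR := smM_curv e.open_target (g.closed11 he).smooth (hg e he)
      have sD := smM_dgam e.open_target (g.closed11 he).smooth (hg e he) (hf.hess.smooth e he)
      exact SmF.sum _ fun j _ => SmF.sum _ fun r _ => SmF.sum _ fun s _ =>
        SmF.smul ((sD j).mul (sR r s)).trace (SmF.const _),
    fun e he e' he' => (locBihol_trans he he').dgamCurv_cov (g.globM.cov e he e' he')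
      (hf.hess.cov e he e' he') (g.closed11 he').smooth (hf.hess.smooth e' he') (hg e' he')⟩

theorem globM_traceCurv (hf : GlobS M f) :
    GlobM M fun e => traceCurv (g.mat e) (hess (f e)) :=
  ⟨fun e he r s => (((hf.hess.smooth e he).mul ((g.closed11 he).smooth.inv (hg e he))).mul
      (smM_curv e.open_target (g.closed11 he).smooth (hg e he) r s)).trace,
    fun e he e' he' => (locBihol_trans he he').traceCurv_cov (g.globM.cov e he e' he')
      (hf.hess.cov e he e' he') (g.closed11 he').smooth (hg e' he')⟩

/-- Integration by parts for `∫ u Tr(R' R) Θ`, where `R'` is the variation of the curvature in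
the direction `i∂∂̄u`. -/
theorem integral_dcurv_curv [CompactSpace M] [T2Space M] {Θ : OpenPartialHomeomorph M (Cn n) → Cn n → Form n}
    (hf : GlobS M f) (hΘ : GlobC M Θ) :
    integral (fun e z => (f e z • (form22 fun j k r s =>
        (dcurv (g.mat e) (hess (f e)) z j k * curv (g.mat e) z r s).trace) +
      form11 (hess (f e) z) * form11 (traceCurv (g.mat e) (hess (f e)) z)) * Θ e z) = 0 := by
  have hX := (hf.delbar.mul (hg.globF_dgamCurv hf)).neg
  have h1 : integral (fun e z => (f e z • (form22 fun j k r s =>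
        (dcurv (g.mat e) (hess (f e)) z j k * curv (g.mat e) z r s).trace) -
      -(delbar (f e) z * dgamCurv (g.mat e) (hess (f e)) z)) * Θ e z) = 0 :=
    integral_eq_zero_of_div ((GlobF.smul hf (hg.globF_dgamCurv hf)).mul hΘ.toGlobF) 1
      fun e he z hz => by
        rw [sub_mul, map_sub]
        exact (div_dgamCurv1 e.open_target (hΘ.closed e he) (hΘ.smooth e he) (topL n) hz
          (g.closed11 he).smooth (hg e he) (hf.hess.smooth e he) (hf.smooth e he)).symm
  have h2 : integral (fun e z => (form11 (hess (f e) z) *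
      form11 (traceCurv (g.mat e) (hess (f e)) z) +
      -(delbar (f e) z * dgamCurv (g.mat e) (hess (f e)) z)) * Θ e z) = 0 :=
    integral_eq_zero_of_div ((hf.delbar.mul (GlobF.form11 (hg.globM_traceCurv hf))).mul
      hΘ.toGlobF) 0 fun e he z hz => by
        rw [add_mul, map_add]
        exact (div_dgamCurv0 e.open_target (hΘ.closed e he) (hΘ.smooth e he) (topL n) hz
          (g.closed11 he).smooth (hg e he) (hf.hess.smooth e he) (hf.smooth e he)).symm
  have c2 := ((((GlobF.form11 hf.hess).mul (GlobF.form11 (hg.globM_traceCurv hf))).add hX).mul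
    hΘ.toGlobF).contTop
  have c1 : ContTop fun e z => (f e z • (form22 fun j k r s =>
        (dcurv (g.mat e) (hess (f e)) z j k * curv (g.mat e) z r s).trace) -
      -(delbar (f e) z * dgamCurv (g.mat e) (hess (f e)) z)) * Θ e z := fun e he => by
    have sG := (g.closed11 he).smooth
    have sR := smM_curv e.open_target sG (hg e he)
    have sR' := smM_dcurv e.open_target sG (hg e he) (hf.hess.smooth e he)
    exact (((SmF.smul (hf.smooth e he) (SmF.form22 fun j k r s =>
      ((sR' j k).mul (sR r s)).trace)).sub (hX.smooth e he)).mul (hΘ.smooth e he)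
        (topL n)).continuousOn
  -- In the sum of the two exact forms the mixed terms ∂̄u ∧ Tr(Dv ∧ R) cancel.
  rw [← add_zero (0 : ℂ)]
  nth_rw 1 [← h1]
  rw [← h2, ← integral_add c1 c2]
  refine integral_congr fun e _ z _ => ?_
  rw [← add_mul]
  congr 2
  abel

end Metric.Regular

end Geometry

/-! ### The second variation at a fixed metric -/

section Pointwise

variable {U : Set (Cn n)} (hU : IsOpen U) {G : Cn n → Matrix (Fin n) (Fin n) ℂ} (hG : IsKahler U G)
  {u f : Cn n → ℂ} (su : ContDiffOn ℝ ∞ u U) {z : Cn n} (hz : z ∈ U)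

/-- The variation of the Chern-Weil form of `Td₂` in the direction `i∂∂̄u`. -/
def dChernWeil (G H : Cn n → Matrix (Fin n) (Fin n) ℂ) (z : Cn n) : Form n :=
  form22 fun j k r s => 2 * td2Polar (dcurv G H z j k) (curv G z r s)

/-- The second variation of the Bott-Chern form of `Td₂` at a fixed metric, for a path of
potentials with first and second derivatives `u` and `f`. -/
def ddBottChern (G : Cn n → Matrix (Fin n) (Fin n) ℂ) (u f : Cn n → ℂ) (z : Cn n) : Form n :=
  form11 (Matrix.of fun j k => 2 * td2Polar (hess f z * (G z)⁻¹) (curv G z j k)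
    + 2 * td2Polar (hess u z * (G z)⁻¹) (dcurv G (hess u) z j k)
    - 2 * td2Polar (hess u z * (G z)⁻¹ * (hess u z * (G z)⁻¹)) (curv G z j k))

/-- Contraction with the inverse metric can be carried out inside one slot of Td₂, where
`sum_inv_curv` and `sum_inv_dcurv` apply. -/
theorem sum_td2Polar (B C : Matrix (Fin n) (Fin n) ℂ)
    (Y : Fin n → Fin n → Matrix (Fin n) (Fin n) ℂ) :
    ∑ j, ∑ k, td2Polar B (Y j k) * C k j = td2Polar B (∑ j, ∑ k, C k j • Y j k) := by
  simp only [td2Polar_eq, Matrix.trace_sum, Matrix.trace_smul, Matrix.mul_smul,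
    smul_eq_mul, Finset.mul_sum, ← Finset.sum_add_distrib, add_mul]
  refine Finset.sum_congr rfl fun j _ => Finset.sum_congr rfl fun k _ => ?_
  ring

theorem topL_form11 (hu : IsUnit (G z).det) (X : Matrix (Fin n) (Fin n) ℂ) :
    topL n (form11 X * powFact (omega G z) 1) =
      -Complex.I * (vd (G z) * ∑ j, ∑ k, X j k * (G z)⁻¹ k j) := by
  have h := topL_one hu X
  have e : (X * (G z)⁻¹).trace = ∑ j, ∑ k, X j k * (G z)⁻¹ k j := by
    simp only [Matrix.trace, Matrix.diag, Matrix.mul_apply]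
  have e2 : kf X = Complex.I • form11 X := rfl
  rw [← e, ← h, omega_eq, e2, smul_mul_assoc, map_smul, smul_eq_mul, ← mul_assoc]
  simp

include hU hG su hz

/-- Contracting with g⁻¹ replaces R by the Ricci endomorphism and R' by the expression of
`sum_inv_dcurv`. The full curvature survives only in `riemHessHess`. -/
theorem topL_ddBottChern :
    topL n (ddBottChern G u f z * powFact (omega G z) 1) = -Complex.I * (vd (G z) *
      (-(1 / 4) * (lap G f z * scal G z) + (1 / 12) * (ric G z * (G z)⁻¹ * (hess f z * (G z)⁻¹)).trace
      + (1 / 4) * (lap G u z * lap G (lap G u) z)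
      + (1 / 12) * (riemHessHess G u z
        - (hess u z * (G z)⁻¹ * (hess (lap G u) z * (G z)⁻¹)).trace
        - (ric G z * (G z)⁻¹ * (hess u z * (G z)⁻¹) * (hess u z * (G z)⁻¹)).trace)
      + (1 / 4) * ((hess u z * (G z)⁻¹ * (hess u z * (G z)⁻¹)).trace * scal G z)
      - (1 / 12) * (ric G z * (G z)⁻¹ * (hess u z * (G z)⁻¹) * (hess u z * (G z)⁻¹)).trace)) := by
  have hu := hG.unit z hz
  rw [ddBottChern, topL_form11 hu]
  congr 2
  simp only [Matrix.of_apply, add_mul, sub_mul, Finset.sum_add_distrib, Finset.sum_sub_distrib,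
    mul_assoc (2 : ℂ), ← Finset.mul_sum]
  rw [sum_td2Polar, sum_td2Polar, sum_td2Polar, sum_inv_curv hU hG.closed hG.unit hz,
    sum_inv_dcurv hU hG.closed hG.unit (closed11_hess hU su) hz]
  have hl : (fun w => (hess u w * (G w)⁻¹).trace) = lap G u := funext fun w => (lap_eq G u w).symm
  rw [hl, riemHessHess_eq hu, lap_eq G f, lap_eq G u, lap_eq G (lap G u), scal_eq]
  -- What is left is an identity between traces of words in a few matrices, settled by cyclicity of
  -- the trace.
  generalize hess (lap G u) z * (G z)⁻¹ = b
  have e1 : ∑ j, ∑ k, ((G z)⁻¹ * hess u z * (G z)⁻¹) k j * (curv G z j k).trace =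
      (ric G z * (G z)⁻¹ * (hess u z * (G z)⁻¹)).trace := by
    have : ∑ j, ∑ k, ((G z)⁻¹ * hess u z * (G z)⁻¹) k j * (curv G z j k).trace =
        (ric G z * ((G z)⁻¹ * hess u z * (G z)⁻¹)).trace := by
      simp only [Matrix.trace, Matrix.diag, Matrix.mul_apply (M := ric G z)]
      exact Finset.sum_congr rfl fun j _ => Finset.sum_congr rfl fun k _ => mul_comm _ _
    rw [this]
    simp only [Matrix.mul_assoc]
  generalize (G z)⁻¹ * hess u z * (G z)⁻¹ = E at e1 ⊢
  generalize hess u z * (G z)⁻¹ = v at e1 ⊢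
  generalize hess f z * (G z)⁻¹ = a
  generalize ric G z * (G z)⁻¹ = ρ at e1 ⊢
  simp only [td2Polar_eq, Matrix.trace_sub, Matrix.mul_sub, Matrix.trace_sum, Matrix.trace_smul,
    Matrix.mul_sum, Matrix.mul_smul, smul_eq_mul, e1, Matrix.trace_mul_comm v (curv G z _ _)]
  rw [Matrix.trace_mul_comm a ρ, ← Matrix.mul_assoc v ρ v, Matrix.trace_mul_comm (v * ρ) v,
    Matrix.trace_mul_comm (v * v) ρ, ← Matrix.mul_assoc v v ρ, Matrix.trace_mul_comm (v * v) ρ,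
    ← Matrix.mul_assoc ρ v v]
  ring

/-- The part of Td₂ built from traces varies through tr R' = -∂∂̄Δu alone. The part Tr(R' ∧ R) has
no such simplification and is left for integration by parts. -/
theorem dChernWeil_eq : dChernWeil G (hess u) z =
    -(1 / 4 : ℂ) • (iddbar (lap G u) z * ricForm G z) + (1 / 12 : ℂ) • form22 fun j k r s =>
      (dcurv G (hess u) z j k * curv G z r s).trace := by
  have hl : (fun w => (hess u w * (G w)⁻¹).trace) = lap G u := funext fun w => (lap_eq G u w).symm
  have h1 : ∀ j k, (dcurv G (hess u) z j k).trace = -hess (lap G u) z j k := fun j k => by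
    rw [trace_dcurv hU hG.closed.smooth hG.unit (closed11_hess hU su).smooth hz, hl]
  have h2 : iddbar (lap G u) z * ricForm G z = -(form11 (hess (lap G u) z) * form11 (ric G z)) := by
    rw [form11_mul_form11, neg_neg]; rfl
  rw [h2, ← form22_mul, ← neg_one_smul ℂ (form22 _), ← form22_smul, ← form22_smul, ← form22_smul,
    ← form22_add, dChernWeil]
  congr 1
  funext j k r s
  rw [td2Polar_eq, h1]
  show 2 * (-(1 / 8) * (-_ * ric G z r s) + _) = _
  ring

omit su in
theorem topL_traceCurv : topL n (form11 (hess u z) * form11 (traceCurv G (hess u) z) *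
      powFact (omega G z) 2) = -(vd (G z) *
    (lap G u z * (ric G z * (G z)⁻¹ * (hess u z * (G z)⁻¹)).trace - riemHessHess G u z)) := by
  have hu := hG.unit z hz
  have h1 : (traceCurv G (hess u) z * (G z)⁻¹).trace =
      (ric G z * (G z)⁻¹ * (hess u z * (G z)⁻¹)).trace := by
    rw [← sum_inv_ric hU hG hz, Matrix.trace]
    simp only [Matrix.diag, Matrix.mul_apply, traceCurv, Matrix.of_apply,
      Matrix.trace_mul_comm (hess u z * (G z)⁻¹)]
  have h2 : (hess u z * (G z)⁻¹ * (traceCurv G (hess u) z * (G z)⁻¹)).trace =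
      riemHessHess G u z := by
    rw [riemHessHess_eq hu, ← Matrix.mul_assoc, Matrix.trace_mul_comm, ← Matrix.mul_assoc,
      ← Matrix.mul_assoc, Matrix.trace_mul_comm]
    have h3 : ∀ A B : Matrix (Fin n) (Fin n) ℂ, (A * B).trace = ∑ r, ∑ s, A r s * B s r :=
      fun A B => by simp only [Matrix.trace, Matrix.diag, Matrix.mul_apply]
    rw [h3]
    refine Finset.sum_congr rfl fun r _ => Finset.sum_congr rfl fun s _ => ?_
    rw [Matrix.trace_mul_comm (curv G z r s)]
    exact mul_comm _ _
  rw [form11_mul_form11, neg_mul, map_neg, omega_eq, topL_two hu, h1, h2, lap_eq]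

end Pointwise

variable {M : Type*} [TopologicalSpace M] [ChartedSpace (Cn n) M] [IsManifold 𝓘(ℂ, Cn n) ω M]
  [CompactSpace M] [T2Space M]

/-! ### Forms of integral zero obtained by integration by parts. -/

section Null

/-- Forms with continuous top degree part and vanishing integral. -/
structure Null (η : OpenPartialHomeomorph M (Cn n) → Cn n → Form n) : Prop where
  cont : ContTop η
  integral_eq : integral η = 0

variable {η ξ Θ : OpenPartialHomeomorph M (Cn n) → Cn n → Form n}

omit [IsManifold 𝓘(ℂ, Cn n) ω M] [CompactSpace M] [T2Space M] in
theorem ContTop.add (hη : ContTop η) (hξ : ContTop ξ) : ContTop fun e z => η e z + ξ e z :=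
  fun e he => by simp only [map_add]; exact (hη e he).add (hξ e he)

omit [IsManifold 𝓘(ℂ, Cn n) ω M] [CompactSpace M] [T2Space M] in
theorem ContTop.const_smul (c : ℂ) (hη : ContTop η) : ContTop fun e z => c • η e z :=
  fun e he => by simp only [map_smul, smul_eq_mul]; exact continuousOn_const.mul (hη e he)

theorem Null.add (hη : Null η) (hξ : Null ξ) : Null fun e z => η e z + ξ e z :=
  ⟨hη.cont.add hξ.cont, by
    rw [integral_add hη.cont hξ.cont, hη.integral_eq, hξ.integral_eq, add_zero]⟩

theorem Null.const_smul (c : ℂ) (hη : Null η) : Null fun e z => c • η e z :=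
  ⟨hη.cont.const_smul c, by rw [integral_smul, hη.integral_eq, mul_zero]⟩

variable {F h : OpenPartialHomeomorph M (Cn n) → Cn n → ℂ}

theorem null_energy (hF : GlobS M F) (hh : GlobS M h) (hΘ : GlobC M Θ) :
    Null fun e z => F e z • (iddbar (h e) z * Θ e z)
      + Complex.I • (del (F e) z * delbar (h e) z * Θ e z) := by
  have h1 : (fun e z => F e z • (iddbar (h e) z * Θ e z)
      + Complex.I • (del (F e) z * delbar (h e) z * Θ e z)) = fun e z => Complex.I •
        ((F e z • form11 (hess (h e) z) + del (F e) z * delbar (h e) z) * Θ e z) := by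
    funext e z
    rw [add_mul, smul_add, smul_mul_assoc, smul_comm, iddbar, smul_mul_assoc]
  rw [h1]
  exact Null.const_smul _ ⟨(((GlobF.smul hF (GlobF.form11 hh.hess)).add
    (hF.del.mul hh.delbar)).mul hΘ.toGlobF).contTop, integral_parts0 hF hh hΘ⟩

theorem null_energy' (hF : GlobS M F) (hh : GlobS M h) (hΘ : GlobC M Θ) :
    Null fun e z => h e z • (iddbar (F e) z * Θ e z)
      + Complex.I • (del (F e) z * delbar (h e) z * Θ e z) := by
  have h1 : (fun e z => h e z • (iddbar (F e) z * Θ e z)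
      + Complex.I • (del (F e) z * delbar (h e) z * Θ e z)) = fun e z => Complex.I •
        ((h e z • form11 (hess (F e) z) + del (F e) z * delbar (h e) z) * Θ e z) := by
    funext e z
    rw [add_mul, smul_add, smul_mul_assoc, smul_comm, iddbar, smul_mul_assoc]
  rw [h1]
  exact Null.const_smul _ ⟨(((GlobF.smul hh (GlobF.form11 hF.hess)).add
    (hF.del.mul hh.delbar)).mul hΘ.toGlobF).contTop, integral_parts1 hF hh hΘ⟩

/-- Both ways of integrating by parts give the same gradient term, so their difference moves i∂∂̄
from one function to the other. -/
theorem null_swap (hF : GlobS M F) (hh : GlobS M h) (hΘ : GlobC M Θ) :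
    Null fun e z => F e z • (iddbar (h e) z * Θ e z) - h e z • (iddbar (F e) z * Θ e z) := by
  have h1 := (null_energy hF hh hΘ).add ((null_energy' hF hh hΘ).const_smul (-1))
  convert h1 using 3
  rw [neg_one_smul]
  abel

/-- The case F = 1 of `null_swap`. -/
theorem null_iddbar (hh : GlobS M h) (hΘ : GlobC M Θ) :
    Null fun e z => iddbar (h e) z * Θ e z := by
  have h1 := null_swap (GlobS.const (M := M) 1) hh hΘ
  have h2 : ∀ z : Cn n, iddbar (fun _ : Cn n => (1 : ℂ)) z = 0 := fun z => by
    have : hess (fun _ : Cn n => (1 : ℂ)) z = 0 := by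
      ext j k
      rw [hess_apply]
      have : wd 1 k (fun _ : Cn n => (1 : ℂ)) = fun _ => 0 := funext fun w => wd_const _
      rw [this, wd_const]; rfl
    rw [iddbar, this]
    simp [form11]
  simp only [one_smul, h2, zero_mul, smul_zero, sub_zero] at h1
  exact h1

end Null

/-! ### The second variation at a fixed metric. -/

section Variation

variable {g : Metric n M} {u f : OpenPartialHomeomorph M (Cn n) → Cn n → ℂ}

/-- The second variation of the first integrand of the Liouville action. -/
def ddAction (g : Metric n M) (u f : OpenPartialHomeomorph M (Cn n) → Cn n → ℂ)
    (e : OpenPartialHomeomorph M (Cn n)) (z : Cn n) : Form n :=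
  ddBottChern (g.mat e) (u e) (f e) z * powFact (omega (g.mat e) z) 1
    + f e z • (chernWeil td2Polar (g.mat e) z * (-Complex.I • powFact (omega (g.mat e) z) 2))
    + (2 * u e z) • (dChernWeil (g.mat e) (hess (u e)) z *
        (-Complex.I • powFact (omega (g.mat e) z) 2)
      + chernWeil td2Polar (g.mat e) z *
        ((-Complex.I / 2) • (iddbar (u e) z * powFact (omega (g.mat e) z) 3)))

/-- The second variation of the second integrand of the Liouville action. -/
def ddEnergy (g : Metric n M) (u f : OpenPartialHomeomorph M (Cn n) → Cn n → ℂ)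
    (e : OpenPartialHomeomorph M (Cn n)) (z : Cn n) : Form n :=
  f e z • (-Complex.I • powFact (omega (g.mat e) z) 0)
    + (2 * u e z) • ((-Complex.I / 2) • (iddbar (u e) z * powFact (omega (g.mat e) z) 1))

omit [IsManifold 𝓘(ℂ, Cn n) ω M] [CompactSpace M] [T2Space M] in
theorem topL_ddEnergy (hg : g.Regular) {e : OpenPartialHomeomorph M (Cn n)}
    (he : e ∈ atlas (Cn n) M) {z : Cn n} (hz : z ∈ e.target) :
    topL n (ddEnergy g u f e z) = -Complex.I * (vd (g.mat e z) *
      (f e z + u e z * lap (g.mat e) (u e) z)) := by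
  have h1 := topL_one (hg e he z hz) (hess (u e) z)
  have h2 : topL n (iddbar (u e) z * powFact (omega (g.mat e) z) 1) =
    vd (g.mat e z) * lap (g.mat e) (u e) z := by rw [lap_eq]; exact h1
  have h3 : topL n (powFact (omega (g.mat e) z) 0) = vd (g.mat e z) := rfl
  simp only [ddEnergy, map_add, map_smul, h2, h3, smul_eq_mul]
  ring

variable (hg : g.Regular) (hu : GlobS M u) (hf : GlobS M f)

include hg

/-- By `IsKahler.topL_td2` the integrands differ by ΔS/3 times the volume form, which is exact. -/
theorem integral_td2_eq : integral (fun e z => chernWeil td2Polar (g.mat e) z *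
      powFact (omega (g.mat e) z) 2) =
    integral (fun e z => a2 (g.mat e) z • powFact (omega (g.mat e) z) 0) := by
  have hW := g.globC_omega
  have h1 := (null_iddbar hg.globS_scal (hW.powFact 1)).const_smul (1 / 3)
  have h2 := (hg.globC_td2.mul (hW.powFact 2)).toGlobF.contTop
  rw [← add_zero (integral _), ← h1.integral_eq, ← integral_add h2 h1.cont]
  refine integral_congr fun e he z hz => ?_
  have h3 := topL_one (hg e he z hz) (hess (scal (g.mat e)) z)
  have h4 := (hg.isKahler he).topL_td2 e.open_target hz
  have h5 : topL n (iddbar (scal (g.mat e)) z * powFact (omega (g.mat e) z) 1) =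
    vd (g.mat e z) * lap (g.mat e) (scal (g.mat e)) z := by rw [lap_eq]; exact h3
  have h6 : topL n (powFact (omega (g.mat e) z) 0) = vd (g.mat e z) := rfl
  rw [map_add, h4, map_smul, map_smul, h5, h6, a2, smul_eq_mul, smul_eq_mul]
  ring

include hu hf

/-- The form by which the second variation of the action differs from its integrated form. -/
theorem exists_null_ddAction : ∃ ν, Null ν ∧ ∀ e ∈ atlas (Cn n) M, ∀ z ∈ e.target,
    topL n (-Complex.I • ddAction g u f e z + ν e z) = topL n (
      let G := g.mat e
      let W := omega G z
      let S := scal G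
      (f e z * ((1 / 6) * lap G S z - (1 / 24) * quadCurv G z)) • powFact W 0
      + (Complex.I / 6) • (del (lap G (u e)) z * delbar (lap G (u e)) z * powFact W 1)
      - (Complex.I / 6) • (del (u e) z * delbar (u e) z * iddbar S z * powFact W 2)
      + ((1 / 4) * lap G (u e) z ^ 2 * S z) • powFact W 0
      + (Complex.I / 8) • (del (u e) z * delbar (u e) z * ricForm G z ^ 2 * powFact W 3)
      + (Complex.I / 24) • (del (u e) z * delbar (u e) z * chernWeil trace2 G z * powFact W 3)
      - ((1 / 2) * lap G (u e) z * inner11 G z (hess (u e) z) (ric G z)) • powFact W 0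
      + ((1 / 12) * riemHessHess G (u e) z) • powFact W 0) := by
  have P := fun k => g.globC_omega.powFact k
  have hS := hg.globS_scal
  have hw := hg.globS_lap hu
  have hR := hg.globC_ricForm
  have hH := hu.globC_iddbar
  -- The part linear in f: `N2` turns ⟨∂∂̄f, Ric⟩ into SΔf, and `N1` then moves the Laplacian to S,
  -- leaving fΔS/6.
  have N1 := null_swap hS hf (P 1)
  have N2 := null_iddbar hf (hR.mul (P 2))
  -- `N8` below turns ⟨∂∂̄u, ∂∂̄Δu⟩ into ΔuΔΔu; `N3` converts the resulting -ΔuΔΔu/6 into the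
  -- gradient term in Δu.
  have N3 := null_energy hw hw (P 1)
  -- `N4` introduces the term with i∂∂̄S. The u i∂∂̄u ∧ i∂∂̄S that comes with it is turned by `N5`
  -- into the pointwise quantity S((Δu)² - |∂∂̄u|²).
  have N4 := null_energy hu hu (hS.globC_iddbar.mul (P 2))
  have N5 := null_swap hu hS (hH.mul (P 2))
  -- `N6` replaces u i∂∂̄u ∧ Td₂(R) by ∂u ∧ ∂̄u ∧ Td₂(R), which is the source of the Ric² and Tr(R²)
  -- terms.
  have N6 := null_energy hu hu (hg.globC_td2.mul (P 3))
  -- `N7` moves i∂∂̄ from Δu to u in the trace part of the variation of Td₂(R), giving Δu(SΔu -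
  -- ⟨∂∂̄u, Ric⟩)/2.
  have N7 := null_swap hu hw (hR.mul (P 2))
  have N8 := null_iddbar hw (hH.mul (P 2))
  -- `N9` removes u Tr(R' ∧ R), in which R' occurs uncontracted, at the cost of `riemHessHess` and
  -- Δu⟨∂∂̄u, Ric⟩.
  have N9 : Null fun e z => (u e z • (form22 fun j k r s =>
        (dcurv (g.mat e) (hess (u e)) z j k * curv (g.mat e) z r s).trace) +
      form11 (hess (u e) z) * form11 (traceCurv (g.mat e) (hess (u e)) z)) *
        powFact (omega (g.mat e) z) 2 := by
    refine ⟨fun e he => ?_, hg.integral_dcurv_curv hu (P 2)⟩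
    have sG := (g.closed11 he).smooth
    have sR := smM_curv e.open_target sG (hg e he)
    have sR' := smM_dcurv e.open_target sG (hg e he) (hu.hess.smooth e he)
    exact ((((SmF.smul (hu.smooth e he) (SmF.form22 fun j k r s =>
      ((sR' j k).mul (sR r s)).trace)).add ((SmF.form11 (hu.hess.smooth e he)).mul
        (SmF.form11 ((hg.globM_traceCurv hu).smooth e he)))).mul ((P 2).smooth e he))
          (topL n)).continuousOn
  -- `N10` cancels Tr(Ric v v) and S|∂∂̄u|² and brings the coefficient of S(Δu)² to 1/2 - 1/6 - 1/12
  -- = 1/4.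
  have N10 := null_iddbar hu (hR.mul (hH.mul (P 3)))
  refine ⟨_, ((((((((((N1.const_smul (-(1 / 6))).add (N2.const_smul (-(1 / 12)))).add
    (N3.const_smul (1 / 6))).add (N4.const_smul (-(1 / 6)))).add (N5.const_smul (1 / 6))).add
    N6).add (N7.const_smul (-(1 / 2)))).add (N8.const_smul (1 / 12))).add
    (N9.const_smul (1 / 6))).add (N10.const_smul (-(1 / 12)))), fun e he z hz => ?_⟩
  have hK := hg.isKahler he
  have hz' := hg e he z hz
  have t0 : topL n (powFact (omega (g.mat e) z) 0) = vd (g.mat e z) := rfl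
  have t1 : ∀ h : Cn n → ℂ, topL n (iddbar h z * powFact (omega (g.mat e) z) 1) =
      vd (g.mat e z) * lap (g.mat e) h z := fun h => by rw [lap_eq]; exact topL_one hz' (hess h z)
  have t2 := fun A B => (congrArg (topL n) (mul_assoc (kf A) (kf B) _)).symm.trans
    (topL_two hz' A B)
  have t3 := fun A B C => (congrArg (topL n) ((mul_assoc (kf A * kf B) (kf C) _).trans
    (mul_assoc (kf A) (kf B) _))).symm.trans (topL_three hz' A B C)
  have e0 := topL_ddBottChern (f := f e) e.open_target hK (hu.smooth e he) hz
  have e1 := dChernWeil_eq e.open_target hK (hu.smooth e he) hz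
  have e2 := topL_traceCurv (u := u e) e.open_target hK hz
  have e3 := hK.topL_td2 e.open_target hz
  have e4 : ∀ x, chernWeil td2Polar (g.mat e) z * (iddbar (u e) z * x) =
      iddbar (u e) z * (chernWeil td2Polar (g.mat e) z * x) := fun x => by
    rw [← mul_assoc, ← mul_assoc]
    congr 1
    exact center_comm (kf_mem_center _) _
  have e5 : topL n (del (u e) z * (delbar (u e) z * (chernWeil td2Polar (g.mat e) z *
      powFact (omega (g.mat e) z) 3))) =
      (1 / 8) * topL n (del (u e) z * (delbar (u e) z * (ricForm (g.mat e) z ^ 2 *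
        powFact (omega (g.mat e) z) 3))) +
      (1 / 24) * topL n (del (u e) z * (delbar (u e) z * (chernWeil trace2 (g.mat e) z *
        powFact (omega (g.mat e) z) 3))) := by
    simp only [chernWeil_td2, add_mul, mul_add, smul_mul_assoc, mul_smul_comm, map_add, map_smul,
      smul_eq_mul]
  have e6 := t2 (hess (f e) z) (ric (g.mat e) z)
  have e7 := t2 (hess (lap (g.mat e) (u e)) z) (ric (g.mat e) z)
  have e8 := t2 (hess (u e) z) (hess (scal (g.mat e)) z)
  have e9 := t2 (hess (scal (g.mat e)) z) (hess (u e) z)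
  have e10 := t2 (hess (u e) z) (hess (u e) z)
  have e11 := t2 (hess (u e) z) (ric (g.mat e) z)
  have e12 := t2 (hess (lap (g.mat e) (u e)) z) (hess (u e) z)
  have e13 := t3 (hess (u e) z) (ric (g.mat e) z) (hess (u e) z)
  simp only [← lap_eq, ← scal_eq] at e6 e7 e8 e9 e10 e11 e12 e13
  change topL n (iddbar (f e) z * (ricForm (g.mat e) z * powFact (omega (g.mat e) z) 2)) = _ at e6
  change topL n (iddbar (lap (g.mat e) (u e)) z * (ricForm (g.mat e) z *
    powFact (omega (g.mat e) z) 2)) = _ at e7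
  change topL n (iddbar (u e) z * (iddbar (scal (g.mat e)) z *
    powFact (omega (g.mat e) z) 2)) = _ at e8
  change topL n (iddbar (scal (g.mat e)) z * (iddbar (u e) z *
    powFact (omega (g.mat e) z) 2)) = _ at e9
  change topL n (iddbar (u e) z * (iddbar (u e) z * powFact (omega (g.mat e) z) 2)) = _ at e10
  change topL n (iddbar (u e) z * (ricForm (g.mat e) z * powFact (omega (g.mat e) z) 2)) = _ at e11
  change topL n (iddbar (lap (g.mat e) (u e)) z * (iddbar (u e) z *
    powFact (omega (g.mat e) z) 2)) = _ at e12
  change topL n (iddbar (u e) z * (ricForm (g.mat e) z * (iddbar (u e) z *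
    powFact (omega (g.mat e) z) 3))) = _ at e13
  have e14 := inner11_eq (g.mat e) z (hess (u e) z) (ric (g.mat e) z)
  rw [mul_assoc (form11 _)] at e2
  -- Only scalars and traces of words in these matrices remain. Cyclicity brings each word to one
  -- normal form, after which the identity is polynomial.
  generalize hess (u e) z * (g.mat e z)⁻¹ = v at e0 e2 e8 e9 e10 e11 e12 e13 e14
  generalize ric (g.mat e) z * (g.mat e z)⁻¹ = ρ at e0 e2 e6 e7 e11 e13 e14
  generalize hess (f e) z * (g.mat e z)⁻¹ = a at e0 e6
  generalize hess (lap (g.mat e) (u e)) z * (g.mat e z)⁻¹ = b at e0 e7 e12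
  generalize hess (scal (g.mat e)) z * (g.mat e z)⁻¹ = c at e8 e9
  rw [Matrix.trace_mul_comm a ρ] at e6
  rw [Matrix.trace_mul_comm v ρ] at e11 e14
  rw [Matrix.trace_mul_comm c v] at e9
  rw [Matrix.trace_mul_comm b v] at e12
  rw [Matrix.trace_mul_comm v ρ, Matrix.trace_mul_comm (v * v) ρ, Matrix.trace_mul_comm (v * ρ) v,
    ← Matrix.mul_assoc v v ρ, Matrix.trace_mul_comm (v * v) ρ, ← Matrix.mul_assoc ρ v v] at e13
  simp only [ddAction, e1, map_add, map_sub, map_smul, smul_eq_mul, add_mul, mul_assoc,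
    smul_mul_assoc, mul_smul_comm, smul_add, e0, t0, t1, e2, e3, e4, e5, e6, e7, e8, e9, e10,
    e11, e12, e13, e14]
  ring_nf
  simp only [Complex.I_sq]
  ring

theorem second_variation_eq (hc : ContTop (ddAction g u f)) :
    -Complex.I * integral (ddAction g u f) + (Complex.I / g.vol) *
        integral (fun e z => chernWeil td2Polar (g.mat e) z * powFact (omega (g.mat e) z) 2) *
        integral (ddEnergy g u f) =
      integral (M := M) (fun e z =>
        let G := g.mat e
        let W := omega G z
        let S := scal G
        (f e z * (g.a2Avg + (1 / 6) * lap G S z - (1 / 24) * quadCurv G z)) • powFact W 0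
        + (g.a2Avg * u e z * lap G (u e) z) • powFact W 0
        + (Complex.I / 6) • (del (lap G (u e)) z * delbar (lap G (u e)) z * powFact W 1)
        - (Complex.I / 6) • (del (u e) z * delbar (u e) z * iddbar S z * powFact W 2)
        + ((1 / 4) * lap G (u e) z ^ 2 * S z) • powFact W 0
        + (Complex.I / 8) • (del (u e) z * delbar (u e) z * ricForm G z ^ 2 * powFact W 3)
        + (Complex.I / 24) • (del (u e) z * delbar (u e) z * chernWeil trace2 G z * powFact W 3)
        - ((1 / 2) * lap G (u e) z * inner11 G z (hess (u e) z) (ric G z)) • powFact W 0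
        + ((1 / 12) * riemHessHess G (u e) z) • powFact W 0) := by
  obtain ⟨ν, hν, h⟩ := exists_null_ddAction hg hu hf
  have P := fun k => g.globC_omega.powFact k
  have c1 : ContTop fun e z => (f e z + u e z * lap (g.mat e) (u e) z) •
      powFact (omega (g.mat e) z) 0 := fun e he =>
    (SmF.smul ((hf.smooth e he).add ((hu.smooth e he).mul ((hg.globS_lap hu).smooth e he)))
      ((P 0).smooth e he) (topL n)).continuousOn
  have h1 : integral (ddEnergy g u f) = -Complex.I * integral (fun e z =>
      (f e z + u e z * lap (g.mat e) (u e) z) • powFact (omega (g.mat e) z) 0) := by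
    rw [← integral_smul]
    refine integral_congr fun e he z hz => ?_
    rw [topL_ddEnergy hg he hz, map_smul, map_smul, smul_eq_mul, smul_eq_mul, vd, omega_eq,
      mul_comm (topL n _)]
  have h2 : integral (fun e z => (-Complex.I • ddAction g u f e z + ν e z) +
      g.a2Avg • ((f e z + u e z * lap (g.mat e) (u e) z) • powFact (omega (g.mat e) z) 0)) =
      -Complex.I * integral (ddAction g u f) + g.a2Avg * integral (fun e z =>
        (f e z + u e z * lap (g.mat e) (u e) z) • powFact (omega (g.mat e) z) 0) := by
    rw [integral_add ((hc.const_smul _).add hν.cont) (c1.const_smul _),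
      integral_add (hc.const_smul _) hν.cont, hν.integral_eq, add_zero, integral_smul,
      integral_smul]
  -- The factors i and -i multiply to 1 and the curvature integral is that of a₂, so the second
  -- summand of the action contributes â₂ times the integral of f + uΔu.
  have h3 : (Complex.I / g.vol) *
        integral (fun e z => chernWeil td2Polar (g.mat e) z * powFact (omega (g.mat e) z) 2) *
        integral (ddEnergy g u f) = g.a2Avg * integral (fun e z =>
        (f e z + u e z * lap (g.mat e) (u e) z) • powFact (omega (g.mat e) z) 0) := by
    rw [h1, integral_td2_eq hg, Metric.a2Avg]
    linear_combination (-1 / g.vol * integral (fun e z => a2 (g.mat e) z •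
      powFact (omega (g.mat e) z) 0) * integral (fun e z =>
        (f e z + u e z * lap (g.mat e) (u e) z) • powFact (omega (g.mat e) z) 0)) * Complex.I_sq
  rw [h3, ← h2]
  refine integral_congr fun e he z hz => ?_
  rw [map_add, h e he z hz]
  simp only [map_add, map_sub, map_smul, smul_eq_mul]
  ring

end Variation

/-! ### Second derivatives in a real parameter -/

/-- `f` is differentiable near `0` and twice differentiable at `0`, with second derivative `a`. -/
def HasSecondDeriv (f : ℝ → ℂ) (a : ℂ) : Prop :=
  (∀ᶠ t in 𝓝 (0 : ℝ), DifferentiableAt ℝ f t) ∧ HasDerivAt (deriv f) a 0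

namespace HasSecondDeriv

variable {f g : ℝ → ℂ} {a b : ℂ}

theorem of_hasDerivAt {f' : ℝ → ℂ} (h : ∀ᶠ t in 𝓝 (0 : ℝ), HasDerivAt f (f' t) t)
    (h2 : HasDerivAt f' a 0) : HasSecondDeriv f a :=
  ⟨h.mono fun _ ht => ht.differentiableAt, h2.congr_of_eventuallyEq (h.mono fun _ ht => ht.deriv)⟩

theorem hasDerivAt (hf : HasSecondDeriv f a) : ∀ᶠ t in 𝓝 (0 : ℝ), HasDerivAt f (deriv f t) t :=
  hf.1.mono fun _ ht => ht.hasDerivAt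

theorem unique (hf : HasSecondDeriv f a) (hf' : HasSecondDeriv f b) : a = b := hf.2.unique hf'.2

theorem congr_deriv (hf : HasSecondDeriv f a) (h : a = b) : HasSecondDeriv f b := h ▸ hf

theorem congr (hf : HasSecondDeriv f a) (h : g =ᶠ[𝓝 0] f) : HasSecondDeriv g a :=
  of_hasDerivAt ((hf.hasDerivAt.and h.eventually_nhds).mono fun _ ht =>
    ht.1.congr_of_eventuallyEq ht.2) hf.2

theorem add (hf : HasSecondDeriv f a) (hg : HasSecondDeriv g b) :
    HasSecondDeriv (fun t => f t + g t) (a + b) :=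
  of_hasDerivAt ((hf.hasDerivAt.and hg.hasDerivAt).mono fun _ ht => ht.1.add ht.2) (hf.2.add hg.2)

theorem const_mul (c : ℂ) (hf : HasSecondDeriv f a) : HasSecondDeriv (fun t => c * f t) (c * a) :=
  of_hasDerivAt (hf.hasDerivAt.mono fun _ ht => ht.const_mul c) (hf.2.const_mul c)

theorem sum {ι : Type*} (s : Finset ι) {f : ι → ℝ → ℂ} {a : ι → ℂ}
    (h : ∀ i ∈ s, HasSecondDeriv (f i) (a i)) :
    HasSecondDeriv (fun t => ∑ i ∈ s, f i t) (∑ i ∈ s, a i) :=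
  of_hasDerivAt (((Filter.eventually_all_finset s).2 fun i hi => (h i hi).hasDerivAt).mono
    fun _ ht => HasDerivAt.fun_sum ht) (HasDerivAt.fun_sum fun i hi => (h i hi).2)

theorem of_contDiffAt (hf : ContDiffAt ℝ ∞ f 0) : HasSecondDeriv f (deriv (deriv f) 0) := by
  have h1 : ContDiffAt ℝ 1 (deriv f) 0 := by
    have := (hf.of_le (m := 2) ENat.LEInfty.out).fderiv_right (m := 1) (by norm_num)
    exact this.clm_apply contDiffAt_const
  refine ⟨?_, (h1.differentiableAt (by simp)).hasDerivAt⟩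
  filter_upwards [(hf.of_le (m := 1) ENat.LEInfty.out).eventually (by simp)] with t ht
  exact ht.differentiableAt (by simp)

/-- The second derivative of a product one of whose factors vanishes at `0`. -/
theorem mul (hf : HasSecondDeriv f a) (hg : ContDiffAt ℝ ∞ g 0) (h0 : f 0 = 0) {f' g' : ℂ}
    (hf' : HasDerivAt f f' 0) (hg' : HasDerivAt g g' 0) :
    HasSecondDeriv (fun t => f t * g t) (a * g 0 + 2 * f' * g') := by
  have hg2 := of_contDiffAt hg
  refine of_hasDerivAt ((hf.hasDerivAt.and hg2.hasDerivAt).mono fun _ ht => ht.1.mul ht.2) ?_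
  refine ((hf.2.mul hg').add (hf'.mul hg2.2)).congr_deriv ?_
  rw [h0, hf'.deriv, hg'.deriv]
  ring

end HasSecondDeriv

/-- `Y1` and `Y2` are the first and second derivatives of `Y` in the real parameter, and all three
are jointly continuous. -/
structure TwiceDiff {Z : Type*} [TopologicalSpace Z] (I : Set ℝ) (A : Set Z)
    (Y Y1 Y2 : ℝ → Z → ℂ) : Prop where
  cont : ContinuousOn (fun q : ℝ × Z => Y q.1 q.2) (I ×ˢ A)
  cont1 : ContinuousOn (fun q : ℝ × Z => Y1 q.1 q.2) (I ×ˢ A)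
  cont2 : ContinuousOn (fun q : ℝ × Z => Y2 q.1 q.2) (I ×ˢ A)
  deriv1 : ∀ t ∈ I, ∀ z ∈ A, HasDerivAt (fun s => Y s z) (Y1 t z) t
  deriv2 : ∀ t ∈ I, ∀ z ∈ A, HasDerivAt (fun s => Y1 s z) (Y2 t z) t

/-! ### Differentiation under the integral over a compact set. -/

section Parametric

open MeasureTheory

variable {Z S : Type*} [TopologicalSpace Z] [TopologicalSpace S] [MeasurableSpace S]
  [OpensMeasurableSpace S] {μ : Measure S} [IsFiniteMeasureOnCompacts μ] {K : Set S}

/-- Joint continuity bounds the integrand on a compact neighbourhood times K, which is all that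
dominated convergence requires. The same bound, applied to F', serves `hasDerivAt_integral_compact`.
-/
theorem continuousOn_integral_compact [LocallyCompactSpace Z] [FirstCountableTopology Z] [T2Space S]
    [SecondCountableTopologyEither S ℂ]
    {A : Set Z} (hA : IsOpen A) (hK : IsCompact K) {F : Z → S → ℂ}
    (hF : ContinuousOn (fun q : Z × S => F q.1 q.2) (A ×ˢ K)) :
    ContinuousOn (fun z => ∫ s in K, F z s ∂μ) A := by
  intro z hz
  obtain ⟨N, hN, hzN, hNA⟩ := exists_compact_subset hA hz
  obtain ⟨C, hC⟩ := (hN.prod hK).exists_bound_of_continuousOn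
    (hF.mono (Set.prod_mono hNA subset_rfl))
  have hsl : ∀ w ∈ A, ContinuousOn (F w) K := fun w hw =>
    hF.comp (f := fun s => (w, s)) (by fun_prop) fun s hs => ⟨hw, hs⟩
  refine ContinuousAt.continuousWithinAt ?_
  refine continuousAt_of_dominated (bound := fun _ => C) ?_ ?_ ?_ ?_
  · filter_upwards [hA.mem_nhds hz] with w hw
    exact (hsl w hw).aestronglyMeasurable hK.isClosed.measurableSet
  · filter_upwards [mem_interior_iff_mem_nhds.1 hzN] with w hw
    exact (ae_restrict_iff' hK.isClosed.measurableSet).2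
      (Filter.Eventually.of_forall fun s hs => hC (w, s) ⟨hw, hs⟩)
  · have : IsFiniteMeasure (μ.restrict K) := ⟨by simpa using hK.measure_lt_top⟩
    exact integrable_const C
  · refine (ae_restrict_iff' hK.isClosed.measurableSet).2
      (Filter.Eventually.of_forall fun s hs => ?_)
    have : ContinuousOn (fun w => F w s) A :=
      hF.comp (f := fun w => (w, s)) (by fun_prop) fun w hw => ⟨hw, hs⟩
    exact this.continuousAt (hA.mem_nhds hz)

theorem hasDerivAt_integral_compact [T2Space S] [SecondCountableTopologyEither S ℂ]
    {I : Set ℝ} (hI : IsOpen I) (hK : IsCompact K) {F F' : ℝ → S → ℂ}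
    (hF : ContinuousOn (fun q : ℝ × S => F q.1 q.2) (I ×ˢ K))
    (hF' : ContinuousOn (fun q : ℝ × S => F' q.1 q.2) (I ×ˢ K))
    (hd : ∀ t ∈ I, ∀ s ∈ K, HasDerivAt (fun t => F t s) (F' t s) t) {t : ℝ} (ht : t ∈ I) :
    HasDerivAt (fun t => ∫ s in K, F t s ∂μ) (∫ s in K, F' t s ∂μ) t := by
  obtain ⟨N, hN, htN, hNI⟩ := exists_compact_subset hI ht
  obtain ⟨C, hC⟩ := (hN.prod hK).exists_bound_of_continuousOn
    (hF'.mono (Set.prod_mono hNI subset_rfl))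
  have hm := hK.isClosed.measurableSet
  have hsl : ∀ {F : ℝ → S → ℂ}, ContinuousOn (fun q : ℝ × S => F q.1 q.2) (I ×ˢ K) →
      ∀ w ∈ I, ContinuousOn (F w) K := fun hF w hw =>
    hF.comp (f := fun s => (w, s)) (by fun_prop) fun s hs => ⟨hw, hs⟩
  have : IsFiniteMeasure (μ.restrict K) := ⟨by simpa using hK.measure_lt_top⟩
  refine (hasDerivAt_integral_of_dominated_loc_of_deriv_le (bound := fun _ => C)
    (s := N) (mem_interior_iff_mem_nhds.1 htN) ?_ ?_ ?_ ?_ (integrable_const C) ?_).2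
  · filter_upwards [hI.mem_nhds ht] with w hw
    exact (hsl hF w hw).aestronglyMeasurable hm
  · exact (hsl hF t ht).integrableOn_compact' hK hm
  · exact (hsl hF' t ht).aestronglyMeasurable hm
  · exact (ae_restrict_iff' hm).2
      (Filter.Eventually.of_forall fun s hs w hw => hC (w, s) ⟨hw, hs⟩)
  · exact (ae_restrict_iff' hm).2
      (Filter.Eventually.of_forall fun s hs w hw => hd w (hNI hw) s hs)

end Parametric

namespace TwiceDiff

variable {Z : Type*} [TopologicalSpace Z] {I : Set ℝ} {A : Set Z} {Y Y1 Y2 X X1 X2 : ℝ → Z → ℂ}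

theorem hasSecondDeriv (h : TwiceDiff I A Y Y1 Y2) (hI : I ∈ 𝓝 (0 : ℝ)) {z : Z} (hz : z ∈ A) :
    HasSecondDeriv (fun t => Y t z) (Y2 0 z) :=
  HasSecondDeriv.of_hasDerivAt (Filter.eventually_of_mem hI fun t ht => h.deriv1 t ht z hz)
    (h.deriv2 0 (mem_of_mem_nhds hI) z hz)

theorem continuousOn_slice (h : TwiceDiff I A Y Y1 Y2) {t : ℝ} (ht : t ∈ I) :
    ContinuousOn (Y2 t) A :=
  h.cont2.comp (f := fun z => (t, z)) (by fun_prop) fun _ hz => ⟨ht, hz⟩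

theorem add (h : TwiceDiff I A Y Y1 Y2) (h' : TwiceDiff I A X X1 X2) :
    TwiceDiff I A (fun t z => Y t z + X t z) (fun t z => Y1 t z + X1 t z)
      (fun t z => Y2 t z + X2 t z) :=
  ⟨h.cont.add h'.cont, h.cont1.add h'.cont1, h.cont2.add h'.cont2,
    fun t ht z hz => (h.deriv1 t ht z hz).add (h'.deriv1 t ht z hz),
    fun t ht z hz => (h.deriv2 t ht z hz).add (h'.deriv2 t ht z hz)⟩

theorem sum {ι : Type*} (s : Finset ι) {Y Y1 Y2 : ι → ℝ → Z → ℂ}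
    (h : ∀ i ∈ s, TwiceDiff I A (Y i) (Y1 i) (Y2 i)) :
    TwiceDiff I A (fun t z => ∑ i ∈ s, Y i t z) (fun t z => ∑ i ∈ s, Y1 i t z)
      (fun t z => ∑ i ∈ s, Y2 i t z) :=
  ⟨continuousOn_finsetSum s fun i hi => (h i hi).cont,
    continuousOn_finsetSum s fun i hi => (h i hi).cont1,
    continuousOn_finsetSum s fun i hi => (h i hi).cont2,
    fun t ht z hz => HasDerivAt.fun_sum fun i hi => (h i hi).deriv1 t ht z hz,
    fun t ht z hz => HasDerivAt.fun_sum fun i hi => (h i hi).deriv2 t ht z hz⟩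

theorem const_mul {c : Z → ℂ} (hc : ContinuousOn c A) (h : TwiceDiff I A Y Y1 Y2) :
    TwiceDiff I A (fun t z => c z * Y t z) (fun t z => c z * Y1 t z) (fun t z => c z * Y2 t z) := by
  have hc' : ContinuousOn (fun q : ℝ × Z => c q.2) (I ×ˢ A) :=
    hc.comp continuousOn_snd fun q hq => hq.2
  exact ⟨hc'.mul h.cont, hc'.mul h.cont1, hc'.mul h.cont2,
    fun t ht z hz => (h.deriv1 t ht z hz).const_mul _,
    fun t ht z hz => (h.deriv2 t ht z hz).const_mul _⟩

theorem congr (h : TwiceDiff I A Y Y1 Y2) (hI : IsOpen I) (hX : ∀ t ∈ I, ∀ z ∈ A, X t z = Y t z) :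
    TwiceDiff I A X Y1 Y2 :=
  ⟨h.cont.congr fun q hq => hX q.1 hq.1 q.2 hq.2, h.cont1, h.cont2,
    fun t ht z hz => (h.deriv1 t ht z hz).congr_of_eventuallyEq
      (Filter.eventually_of_mem (hI.mem_nhds ht) fun s hs => hX s hs z hz), h.deriv2⟩

theorem mono (h : TwiceDiff I A Y Y1 Y2) {B : Set Z} (hB : B ⊆ A) : TwiceDiff I B Y Y1 Y2 :=
  ⟨h.cont.mono (Set.prod_mono subset_rfl hB), h.cont1.mono (Set.prod_mono subset_rfl hB),
    h.cont2.mono (Set.prod_mono subset_rfl hB), fun t ht z hz => h.deriv1 t ht z (hB hz),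
    fun t ht z hz => h.deriv2 t ht z (hB hz)⟩

-- Needed twice: for the segment parameter of the Bott–Chern form, and for the supports of the
-- partition of unity.
open MeasureTheory in
theorem integral [LocallyCompactSpace Z] [FirstCountableTopology Z] {S : Type*} [TopologicalSpace S] [MeasurableSpace S]
    [OpensMeasurableSpace S] [T2Space S] [SecondCountableTopologyEither S ℂ] {μ : Measure S}
    [IsFiniteMeasureOnCompacts μ] {K : Set S} (hK : IsCompact K) (hI : IsOpen I) (hA : IsOpen A)
    {Y Y1 Y2 : ℝ → Z × S → ℂ} (h : TwiceDiff I (A ×ˢ K) Y Y1 Y2) :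
    TwiceDiff I A (fun t z => ∫ s in K, Y t (z, s) ∂μ) (fun t z => ∫ s in K, Y1 t (z, s) ∂μ)
      (fun t z => ∫ s in K, Y2 t (z, s) ∂μ) := by
  have c : ∀ {Y : ℝ → Z × S → ℂ},
      ContinuousOn (fun q : ℝ × (Z × S) => Y q.1 q.2) (I ×ˢ (A ×ˢ K)) →
      ContinuousOn (fun q : ℝ × Z => ∫ s in K, Y q.1 (q.2, s) ∂μ) (I ×ˢ A) := fun {Y} hY =>
    continuousOn_integral_compact (hI.prod hA) hK (F := fun q s => Y q.1 (q.2, s))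
      (hY.comp (f := fun q : (ℝ × Z) × S => (q.1.1, (q.1.2, q.2))) (by fun_prop)
        fun q hq => ⟨hq.1.1, hq.1.2, hq.2⟩)
  have e : ∀ {Y : ℝ → Z × S → ℂ} {z : Z}, z ∈ A →
      ContinuousOn (fun q : ℝ × (Z × S) => Y q.1 q.2) (I ×ˢ (A ×ˢ K)) →
      ContinuousOn (fun q : ℝ × S => Y q.1 (z, q.2)) (I ×ˢ K) := fun {Y} {z} hz hY =>
    hY.comp (f := fun q : ℝ × S => (q.1, (z, q.2))) (by fun_prop) fun q hq => ⟨hq.1, hz, hq.2⟩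
  exact ⟨c h.cont, c h.cont1, c h.cont2,
    fun t ht z hz => hasDerivAt_integral_compact hI hK (F := fun t s => Y t (z, s))
      (F' := fun t s => Y1 t (z, s)) (e hz h.cont) (e hz h.cont1)
      (fun t ht s hs => h.deriv1 t ht (z, s) ⟨hz, hs⟩) ht,
    fun t ht z hz => hasDerivAt_integral_compact hI hK (F := fun t s => Y1 t (z, s))
      (F' := fun t s => Y2 t (z, s)) (e hz h.cont1) (e hz h.cont2)
      (fun t ht s hs => h.deriv2 t ht (z, s) ⟨hz, hs⟩) ht⟩

theorem of_contDiffOn {Z : Type*} [NormedAddCommGroup Z] [NormedSpace ℝ Z] {A : Set Z}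
    {Ω : Set (ℝ × Z)} (hΩ : IsOpen Ω) {f : ℝ × Z → ℂ} (hf : ContDiffOn ℝ ∞ f Ω)
    (h : I ×ˢ A ⊆ Ω) :
    TwiceDiff I A (fun t z => f (t, z)) (fun t z => fderiv ℝ f (t, z) (1, 0))
      (fun t z => fderiv ℝ (fun q => fderiv ℝ f q (1, 0)) (t, z) (1, 0)) := by
  have h1 := contDiffOn_fderiv_apply hΩ hf (1, 0)
  have h2 := contDiffOn_fderiv_apply hΩ h1 (1, 0)
  have key : ∀ {f : ℝ × Z → ℂ}, ContDiffOn ℝ ∞ f Ω → ∀ t ∈ I, ∀ z ∈ A,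
      HasDerivAt (fun s => f (s, z)) (fderiv ℝ f (t, z) (1, 0)) t := fun {f} hf t ht z hz =>
    ((hf.contDiffAt (hΩ.mem_nhds (h ⟨ht, hz⟩))).differentiableAt (by simp)).hasFDerivAt.comp_hasDerivAt
      t ((hasDerivAt_id t).prodMk (hasDerivAt_const t z))
  exact ⟨hf.continuousOn.mono h, h1.continuousOn.mono h, h2.continuousOn.mono h, key hf, key h1⟩

open MeasureTheory in
theorem hasSecondDeriv_integral {U K : Set (Cn n)} {D D1 D2 : ℝ → Cn n → ℂ}
    (h : TwiceDiff I U D D1 D2) (hU : IsOpen U) (hI : IsOpen I) (h0 : (0 : ℝ) ∈ I)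
    (hK : IsCompact K) (hKU : K ⊆ U) {ρ : Cn n → ℂ} (hρ : ContinuousOn ρ U)
    (hρ0 : ∀ z ∈ U, z ∉ K → ρ z = 0) :
    HasSecondDeriv (fun t => ∫ z in U, ρ z * D t z) (∫ z in U, ρ z * D2 0 z) := by
  have r : ∀ D : Cn n → ℂ, ∫ z in U, ρ z * D z = ∫ z in K, ρ z * D z := fun D =>
    setIntegral_eq_of_subset_of_forall_sdiff_eq_zero hU.measurableSet hKU
      fun z hz => by rw [hρ0 z hz.1 hz.2, zero_mul]
  have h' := (h.const_mul hρ).mono hKU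
  -- A one-point parameter space makes the integral over K an instance of `TwiceDiff.integral`.
  have m : Set.MapsTo (fun q : ℝ × (Unit × Cn n) => (q.1, q.2.2))
    (I ×ˢ (Set.univ ×ˢ K)) (I ×ˢ K) := fun q hq => ⟨hq.1, hq.2.2⟩
  have c : Continuous (fun q : ℝ × (Unit × Cn n) => (q.1, q.2.2)) := by fun_prop
  have hT : TwiceDiff I (Set.univ ×ˢ K) (fun t (q : Unit × Cn n) => ρ q.2 * D t q.2)
      (fun t q => ρ q.2 * D1 t q.2) (fun t q => ρ q.2 * D2 t q.2) :=
    ⟨h'.cont.comp c.continuousOn m, h'.cont1.comp c.continuousOn m,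
      h'.cont2.comp c.continuousOn m, fun t ht q hq => h'.deriv1 t ht _ hq.2,
      fun t ht q hq => h'.deriv2 t ht _ hq.2⟩
  simp only [r]
  exact (hT.integral (μ := volume) hK hI isOpen_univ).hasSecondDeriv (hI.mem_nhds h0)
    (Set.mem_univ ())

end TwiceDiff

theorem contDiffAt_slice {Z : Type*} [NormedAddCommGroup Z] [NormedSpace ℝ Z]
    {Ω : Set (ℝ × Z)} (hΩ : IsOpen Ω) {f : ℝ × Z → ℂ} (hf : ContDiffOn ℝ ∞ f Ω) {t : ℝ} {z : Z}
    (h : (t, z) ∈ Ω) : ContDiffAt ℝ ∞ (fun s => f (s, z)) t :=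
  (hf.contDiffAt (hΩ.mem_nhds h)).comp t (contDiffAt_id.prodMk contDiffAt_const)

section Manifold

variable {M : Type*} [TopologicalSpace M] [ChartedSpace (Cn n) M] [IsManifold 𝓘(ℂ, Cn n) ω M]
  [CompactSpace M] [T2Space M]

/-- Differentiation under the integral sign on the manifold. -/
theorem hasSecondDeriv_integral {I : Set ℝ} (hI : IsOpen I) (h0 : (0 : ℝ) ∈ I)
    {η : ℝ → OpenPartialHomeomorph M (Cn n) → Cn n → Form n}
    {ξ : OpenPartialHomeomorph M (Cn n) → Cn n → Form n}
    (hη : ∀ e ∈ atlas (Cn n) M, ∃ Y1 Y2,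
      TwiceDiff I e.target (fun t z => topL n (η t e z)) Y1 Y2)
    (hξ : ∀ e ∈ atlas (Cn n) M, ∀ z ∈ e.target,
      HasSecondDeriv (fun t => topL n (η t e z)) (topL n (ξ e z))) :
    HasSecondDeriv (fun t => integral (η t)) (integral ξ) ∧ ContTop ξ := by
  have hI0 := hI.mem_nhds h0
  constructor
  · simp only [integral_eq_sum]
    refine HasSecondDeriv.sum _ fun x _ => ?_
    obtain ⟨Y1, Y2, hY⟩ := hη _ (chart_mem_atlas _ x)
    refine (hY.hasSecondDeriv_integral (chartAt (Cn n) x).open_target hI h0 (isCompact_pouSupp x)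
      (pouSupp_subset x) (contDiffOn_pou x (chart_mem_atlas _ x)).continuousOn
      fun z hz hK => read_pou_eq_zero hz hK).congr_deriv
      (MeasureTheory.setIntegral_congr_fun (chartAt (Cn n) x).open_target.measurableSet
        fun z hz => ?_)
    -- By uniqueness the abstract derivative `Y2` at time 0 is the prescribed density, so no formula
    -- for it at other times is needed. The continuity of ξ below uses the same identification.
    rw [(hY.hasSecondDeriv hI0 hz).unique (hξ _ (chart_mem_atlas _ x) z hz)]
  · intro e he
    obtain ⟨Y1, Y2, hY⟩ := hη e he
    exact (hY.continuousOn_slice h0).congr fun z hz =>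
      ((hY.hasSecondDeriv hI0 hz).unique (hξ e he z hz)).symm

end Manifold

/-! ### Paths of potentials in a chart -/

/-- The mixed powers `∑_s η^s η₀^{m-1-s} / m!` with `m = n + 1 - k`. -/
def geomPow (k : ℕ) (η₀ η : Form n) : Form n :=
  (Nat.factorial (n + 1 - k) : ℂ)⁻¹ • ∑ s ∈ Finset.range (n + 1 - k), η ^ s * η₀ ^ (n - k - s)

theorem geomPow_self (k : ℕ) (η : Form n) : geomPow k η η = powFact η k := by
  rw [geomPow, powFact]
  split_ifs with h
  · obtain ⟨m, hm⟩ : ∃ m, n - k = m := ⟨_, rfl⟩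
    have h1 : n + 1 - k = m + 1 := by omega
    have h2 : ∀ s ∈ Finset.range (m + 1), η ^ s * η ^ (m - s) = η ^ m := fun s hs => by
      rw [← pow_add]; congr 1; have := Finset.mem_range.1 hs; omega
    rw [h1, hm, Finset.sum_congr rfl h2, Finset.sum_const, Finset.card_range, ← Nat.cast_smul_eq_nsmul ℂ,
      smul_smul, Nat.factorial_succ]
    congr 1
    have : (m.factorial : ℂ) ≠ 0 := by exact_mod_cast m.factorial_ne_zero
    have : (m + 1 : ℂ) ≠ 0 := by exact_mod_cast m.succ_ne_zero
    push_cast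
    field_simp
  · have h1 : n + 1 - k = 0 := by omega
    simp [h1]

/-- With m = n - (k + 1), the summand with index s contributes s η' η^m, and 0 + 1 + ⋯ + (m + 1) =
(m + 2)(m + 1)/2. Divided by (m + 2)! this is 1/(2 · m!), whence the factor 1/2. -/
theorem HasDerivF.geomPow {η : ℝ → Form n} {η' : Form n} {t : ℝ} (hη : HasDerivF η η' t)
    (hc : ∀ s, η s ∈ Subalgebra.center ℂ (Form n)) (k : ℕ) :
    HasDerivF (fun s => geomPow k (η t) (η s))
      ((1 / 2 : ℂ) • (η' * Kahler.powFact (η t) (k + 1))) t := by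
  unfold Kahler.geomPow
  refine ((HasDerivF.sum _ fun s _ => (hη.pow hc s).mul
    (HasDerivF.const (η t ^ (n - k - s)))).const_smul _).congr_deriv ?_
  simp only [mul_zero, add_zero]
  rw [Kahler.powFact]
  split_ifs with h
  · obtain ⟨m, hm⟩ : ∃ m, n - (k + 1) = m := ⟨_, rfl⟩
    have h1 : n + 1 - k = m + 2 := by omega
    have h3 : n - k = m + 1 := by omega
    have h2 : ∀ s ∈ Finset.range (m + 2), ((s : ℂ) • (η' * η t ^ (s - 1))) * η t ^ (m + 1 - s) =
        (s : ℂ) • (η' * η t ^ m) := fun s hs => by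
      rcases s with _ | s
      · simp
      · rw [smul_mul_assoc, mul_assoc, ← pow_add]
        congr 3; have := Finset.mem_range.1 hs; omega
    have h4 : (∑ s ∈ Finset.range (m + 2), (s : ℂ)) * 2 = (m + 2) * (m + 1) := by
      have := Finset.sum_range_id_mul_two (m + 2)
      have h5 : (((∑ s ∈ Finset.range (m + 2), s) * 2 : ℕ) : ℂ) = ((m + 2) * (m + 1) : ℕ) := by
        rw [this]; rfl
      push_cast at h5
      exact h5
    rw [h1, h3, hm, Finset.sum_congr rfl h2, ← Finset.sum_smul, mul_smul_comm, smul_smul, smul_smul,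
      Nat.factorial_succ, Nat.factorial_succ, eq_div_of_mul_eq two_ne_zero h4]
    congr 1
    have : (m.factorial : ℂ) ≠ 0 := by exact_mod_cast m.factorial_ne_zero
    have : (m + 1 : ℂ) ≠ 0 := by exact_mod_cast m.succ_ne_zero
    have : (m + 2 : ℂ) ≠ 0 := by exact_mod_cast (m + 1).succ_ne_zero
    push_cast
    field_simp
    ring
  · have h1 : n + 1 - k ≤ 1 := by omega
    interval_cases h2 : n + 1 - k <;> simp

theorem SmF.geomPow {X : Type*} [NormedAddCommGroup X] [NormedSpace ℝ X] {Ω : Set X}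
    {η₀ η : X → Form n} (h₀ : SmF η₀ Ω) (h : SmF η Ω) (k : ℕ) :
    SmF (fun x => geomPow k (η₀ x) (η x)) Ω :=
  SmF.const_smul _ (SmF.sum _ fun s _ => (h.pow s).mul (h₀.pow _))

theorem HasDerivAt.td2Polar {A B : ℝ → Matrix (Fin n) (Fin n) ℂ} {A' B' : Matrix (Fin n) (Fin n) ℂ}
    {t : ℝ} (hA : HasDerivM A A' t) (hB : HasDerivM B B' t) :
    HasDerivAt (fun s => td2Polar (A s) (B s)) (td2Polar A' (B t) + td2Polar (A t) B') t := by
  simp only [td2Polar_eq]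
  refine (((hA.trace.mul hB.trace).const_mul _).add ((hA.mul hB).trace.const_mul _)).congr_deriv ?_
  rw [Matrix.trace_add]
  ring

theorem ContDiffOn.td2Polar {X : Type*} [NormedAddCommGroup X] [NormedSpace ℝ X] {Ω : Set X}
    {A B : X → Matrix (Fin n) (Fin n) ℂ} (hA : SmM A Ω) (hB : SmM B Ω) :
    ContDiffOn ℝ ∞ (fun x => td2Polar (A x) (B x)) Ω := by
  simp only [td2Polar_eq]
  exact (contDiffOn_const.mul (hA.trace.mul hB.trace)).add (contDiffOn_const.mul (hA.mul hB).trace)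

/-- The two terms of the product rule define the same form, because Td₂ is symmetric and 2-forms
commute. -/
theorem hasDerivF_chernWeil {R : ℝ → Fin n → Fin n → Matrix (Fin n) (Fin n) ℂ}
    {R' : Fin n → Fin n → Matrix (Fin n) (Fin n) ℂ} {t : ℝ}
    (h : ∀ j k, HasDerivM (fun x => R x j k) (R' j k) t) :
    HasDerivF (fun x => form22 fun j k r s => td2Polar (R x j k) (R x r s))
      (form22 fun j k r s => 2 * td2Polar (R' j k) (R t r s)) t := by
  refine (HasDerivF.form22 fun j k r s => HasDerivAt.td2Polar (h j k) (h r s)).congr_deriv ?_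
  have e : (form22 fun j k r s => td2Polar (R t j k) (R' r s)) =
      form22 fun j k r s => td2Polar (R' j k) (R t r s) := by
    rw [form22_swap]
    simp only [td2Polar_comm]
  have e2 := form22_add (fun j k r s => td2Polar (R' j k) (R t r s))
    (fun j k r s => td2Polar (R t j k) (R' r s))
  have e3 := form22_smul 2 (fun j k r s => td2Polar (R' j k) (R t r s))
  rw [e, ← two_smul ℂ, ← e3] at e2
  exact e2

theorem smM_curv_slice {P : Type*} [NormedAddCommGroup P] [NormedSpace ℝ P] {Ω : Set (P × Cn n)}
    (hΩ : IsOpen Ω) {A : P × Cn n → Matrix (Fin n) (Fin n) ℂ} (hA : SmM A Ω)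
    (hu : ∀ q ∈ Ω, IsUnit (A q).det) (j k : Fin n) :
    SmM (fun q => curv (fun w => A (q.1, w)) q.2 j k) Ω := by
  have h1 : SmM (fun q : P × Cn n => gam (fun w => A (q.1, w)) j q.2) Ω :=
    (SmM.wdM_slice hΩ hA 0 j).mul (hA.inv hu)
  exact (SmM.wdM_slice hΩ h1 1 k).neg.congr fun q _ => curv_eq _ _ _ _

section Hess

variable {Ω : Set (ℝ × Cn n)} (hΩ : IsOpen Ω) {p : ℝ × Cn n → ℂ} (hp : ContDiffOn ℝ ∞ p Ω)

include hΩ hp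

theorem contDiffOn_deriv_slice :
    ContDiffOn ℝ ∞ (fun q : ℝ × Cn n => deriv (fun s => p (s, q.2)) q.1) Ω := by
  refine (contDiffOn_fderiv_apply hΩ hp (1, 0)).congr fun q hq => ?_
  have h1 : HasFDerivAt p (fderiv ℝ p q) (q.1, q.2) :=
    ((hp.contDiffAt (hΩ.mem_nhds hq)).differentiableAt (by simp)).hasFDerivAt
  exact (h1.comp_hasDerivAt q.1 ((hasDerivAt_id q.1).prodMk (hasDerivAt_const q.1 q.2))).deriv

theorem smM_hess_slice : SmM (fun q : ℝ × Cn n => hess (fun w => p (q.1, w)) q.2) Ω := fun j k => by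
  simp only [hess_apply]
  exact contDiffOn_wd_slice hΩ (contDiffOn_wd_slice hΩ hp 1 k) 0 j

theorem hasDerivM_hess_slice {t : ℝ} {z : Cn n} (hq : (t, z) ∈ Ω) :
    HasDerivM (fun s => hess (fun w => p (s, w)) z)
      (hess (fun w => deriv (fun s => p (s, w)) t) z) t := fun j k => by
  simp only [hess_apply]
  refine (hasDerivAt_wd_slice hΩ (contDiffOn_wd_slice hΩ hp 1 k) hq 0 j).congr_deriv ?_
  refine wd_congr_on (hΩ.preimage (by fun_prop : Continuous fun w : Cn n => (t, w))) hq fun w hw => ?_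
  exact (hasDerivAt_wd_slice hΩ hp hw 1 k).deriv

end Hess

theorem hess_congr_on {U : Set (Cn n)} (hU : IsOpen U) {f g : Cn n → ℂ} (h : ∀ w ∈ U, f w = g w)
    {z : Cn n} (hz : z ∈ U) : hess f z = hess g z := by
  ext j k
  rw [hess_apply, hess_apply]
  exact wd_congr_on hU hz fun w hw => wd_congr_on hU hw h

/-- A path of Kähler potentials in a coordinate domain, with first and second derivatives `u` and
`f` at the time `0`. -/
structure PotPath (I : Set ℝ) (U : Set (Cn n)) (G : Cn n → Matrix (Fin n) (Fin n) ℂ)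
    (p : ℝ × Cn n → ℂ) (u f : Cn n → ℂ) : Prop where
  openI : IsOpen I
  zero_mem : (0 : ℝ) ∈ I
  openU : IsOpen U
  smG : SmM G U
  smp : ContDiffOn ℝ ∞ p (I ×ˢ U)
  zero : ∀ z ∈ U, p (0, z) = 0
  deriv1 : ∀ z ∈ U, deriv (fun t => p (t, z)) 0 = u z
  deriv2 : ∀ z ∈ U, deriv (deriv fun t => p (t, z)) 0 = f z
  unit : ∀ t ∈ I, ∀ s ∈ Set.Icc (0 : ℝ) 1, ∀ z ∈ U,
    IsUnit (G z + (s : ℂ) • hess (fun w => p (t, w)) z).det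

namespace PotPath

variable {I : Set ℝ} {U : Set (Cn n)} {G : Cn n → Matrix (Fin n) (Fin n) ℂ} {p : ℝ × Cn n → ℂ}
  {u f : Cn n → ℂ} (h : PotPath I U G p u f)

include h

theorem isOpen : IsOpen (I ×ˢ U) := h.openI.prod h.openU

theorem mem {z : Cn n} (hz : z ∈ U) : ((0 : ℝ), z) ∈ I ×ˢ U := ⟨h.zero_mem, hz⟩

theorem hess_zero {z : Cn n} (hz : z ∈ U) : hess (fun w => p (0, w)) z = 0 := by
  rw [hess_congr_on h.openU h.zero hz]
  ext j k
  rw [hess_apply]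
  have : wd 1 k (fun _ : Cn n => (0 : ℂ)) = fun _ => 0 := funext fun w => wd_const 0
  rw [this, wd_const]
  rfl

theorem unit_zero {z : Cn n} (hz : z ∈ U) : IsUnit (G z).det := by
  have := h.unit 0 h.zero_mem 0 (by simp) z hz
  simpa using this

theorem contDiffAt {z : Cn n} (hz : z ∈ U) : ContDiffAt ℝ ∞ (fun t => p (t, z)) 0 :=
  contDiffAt_slice h.isOpen h.smp (h.mem hz)

theorem hasDerivAt {z : Cn n} (hz : z ∈ U) : HasDerivAt (fun t => p (t, z)) (u z) 0 := by
  rw [← h.deriv1 z hz]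
  exact ((h.contDiffAt hz).differentiableAt (by simp)).hasDerivAt

theorem hasSecondDeriv {z : Cn n} (hz : z ∈ U) : HasSecondDeriv (fun t => p (t, z)) (f z) :=
  (HasSecondDeriv.of_contDiffAt (h.contDiffAt hz)).congr_deriv (h.deriv2 z hz)

theorem smu : ContDiffOn ℝ ∞ u U := by
  refine ((contDiffOn_deriv_slice h.isOpen h.smp).comp
    (contDiffOn_const.prodMk contDiffOn_id) fun z hz => h.mem hz).congr fun z hz => ?_
  exact (h.deriv1 z hz).symm

theorem smf : ContDiffOn ℝ ∞ f U := by
  refine ((contDiffOn_deriv_slice h.isOpen (contDiffOn_deriv_slice h.isOpen h.smp)).comp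
    (contDiffOn_const.prodMk contDiffOn_id) fun z hz => h.mem hz).congr fun z hz => ?_
  exact (h.deriv2 z hz).symm

theorem hasDerivM_hess {z : Cn n} (hz : z ∈ U) :
    HasDerivM (fun t => hess (fun w => p (t, w)) z) (hess u z) 0 := by
  rw [← hess_congr_on h.openU h.deriv1 hz]
  exact hasDerivM_hess_slice h.isOpen h.smp (h.mem hz)

theorem hasSecondDeriv_hess {z : Cn n} (hz : z ∈ U) (j k : Fin n) :
    HasSecondDeriv (fun t => hess (fun w => p (t, w)) z j k) (hess f z j k) := by
  rw [← hess_congr_on h.openU h.deriv2 hz]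
  exact HasSecondDeriv.of_hasDerivAt
    (Filter.eventually_of_mem (h.openI.mem_nhds h.zero_mem) fun t ht =>
      hasDerivM_hess_slice h.isOpen h.smp ⟨ht, hz⟩ j k)
    (hasDerivM_hess_slice h.isOpen (contDiffOn_deriv_slice h.isOpen h.smp) (h.mem hz) j k)

end PotPath

/-! ### Second derivatives of the integrands -/

/-- The expression is linear in H and H(0) = 0, so entrywise `HasSecondDeriv.mul` applies. The
second derivatives of M and R do not enter. -/
theorem hasSecondDeriv_td2Polar {H M R : ℝ → Matrix (Fin n) (Fin n) ℂ}
    {H1 H2 M1 R1 : Matrix (Fin n) (Fin n) ℂ}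
    (hH2 : ∀ a b, HasSecondDeriv (fun t => H t a b) (H2 a b)) (hH1 : HasDerivM H H1 0)
    (hH0 : H 0 = 0) (sM : ∀ a b, ContDiffAt ℝ ∞ (fun t => M t a b) 0)
    (sR : ∀ a b, ContDiffAt ℝ ∞ (fun t => R t a b) 0) (hM : HasDerivM M M1 0)
    (hR : HasDerivM R R1 0) :
    HasSecondDeriv (fun t => td2Polar (H t * M t) (R t))
      (td2Polar (H2 * M 0) (R 0) + 2 * (td2Polar (H1 * M1) (R 0) + td2Polar (H1 * M 0) R1)) := by
  have e : ∀ H M R : Matrix (Fin n) (Fin n) ℂ, td2Polar (H * M) R = ∑ a, ∑ b, H a b *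
      (-(1 / 8) * (M b a * R.trace) + (1 / 24) * (M * R) b a) := fun H M R => by
    have t : ∀ X : Matrix (Fin n) (Fin n) ℂ, (H * X).trace = ∑ a, ∑ b, H a b * X b a := fun X => by
      simp only [Matrix.trace, Matrix.diag, Matrix.mul_apply]
    rw [td2Polar_eq, Matrix.mul_assoc, t, t]
    simp only [Finset.sum_mul, Finset.mul_sum, ← Finset.sum_add_distrib]
    refine Finset.sum_congr rfl fun a _ => Finset.sum_congr rfl fun b _ => ?_
    ring
  simp only [e]
  refine (HasSecondDeriv.sum _ fun a _ => HasSecondDeriv.sum _ fun b _ =>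
    (hH2 a b).mul ?_ (by rw [hH0]; rfl) (hH1 a b)
      ((((hM b a).mul hR.trace).const_mul _).add (((hM.mul hR) b a).const_mul _))).congr_deriv ?_
  · have h1 : ContDiffAt ℝ ∞ (fun t => (R t).trace) 0 := ContDiffAt.sum fun c _ => sR c c
    have h2 : ContDiffAt ℝ ∞ (fun t => (M t * R t) b a) 0 := by
      simp only [Matrix.mul_apply]
      exact ContDiffAt.sum fun c _ => (sM b c).mul (sR c a)
    exact (contDiffAt_const.mul ((sM b a).mul h1)).add (contDiffAt_const.mul h2)
  · simp only [Finset.mul_sum, ← Finset.sum_add_distrib]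
    refine Finset.sum_congr rfl fun a _ => Finset.sum_congr rfl fun b _ => ?_
    rw [Matrix.add_apply]
    simp only [Pi.add_apply, Pi.mul_apply]
    ring

theorem integral_Icc_affine (a b : ℂ) : ∫ s in Set.Icc (0 : ℝ) 1, (a + (s : ℂ) * b) = a + b / 2 := by
  rw [MeasureTheory.integral_Icc_eq_integral_Ioc, ← intervalIntegral.integral_of_le zero_le_one,
    intervalIntegral.integral_add (by simp) (Continuous.intervalIntegrable (by fun_prop) _ _),
    intervalIntegral.integral_mul_const]
  have : ∫ s in (0 : ℝ)..1, (s : ℂ) = 1 / 2 := by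
    rw [intervalIntegral.integral_ofReal, integral_id]; norm_num
  rw [this]
  simp
  ring

namespace PotPath

variable {I : Set ℝ} {U : Set (Cn n)} {G : Cn n → Matrix (Fin n) (Fin n) ℂ} {p : ℝ × Cn n → ℂ}
  {u f : Cn n → ℂ} (h : PotPath I U G p u f)

include h

/-- Since p vanishes at t = 0, only the first derivative of Q matters. This handles every integrand
with an explicit factor φ_t. -/
theorem mul {Q : ℝ × Cn n → ℂ} (hQ : ContDiffOn ℝ ∞ Q (I ×ˢ U)) {Q' : Cn n → ℂ}
    (hQ' : ∀ z ∈ U, HasDerivAt (fun t => Q (t, z)) (Q' z) 0) :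
    (∃ Y1 Y2, TwiceDiff I U (fun t z => p (t, z) * Q (t, z)) Y1 Y2) ∧
    ∀ z ∈ U, HasSecondDeriv (fun t => p (t, z) * Q (t, z))
      (f z * Q (0, z) + 2 * u z * Q' z) :=
  ⟨⟨_, _, TwiceDiff.of_contDiffOn h.isOpen (h.smp.mul hQ) subset_rfl⟩, fun z hz =>
    (h.hasSecondDeriv hz).mul (contDiffAt_slice h.isOpen hQ (h.mem hz)) (h.zero z hz)
      (h.hasDerivAt hz) (hQ' z hz)⟩

theorem smM_end : SmM (fun q : ℝ × Cn n => G q.2 + hess (fun w => p (q.1, w)) q.2) (I ×ˢ U) :=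
  SmM.add (fun a b => (h.smG a b).comp contDiffOn_snd fun _ hq => hq.2)
    (smM_hess_slice h.isOpen h.smp)

theorem unit_end : ∀ q ∈ I ×ˢ U, IsUnit (G q.2 + hess (fun w => p (q.1, w)) q.2).det :=
  fun q hq => by
    have := h.unit q.1 hq.1 1 (by simp) q.2 hq.2
    simpa using this

theorem hasDerivM_end {z : Cn n} (hz : z ∈ U) :
    HasDerivM (fun t => G z + hess (fun w => p (t, w)) z) (hess u z) 0 := by
  have := (HasDerivM.const (G z) (t := 0)).add (h.hasDerivM_hess hz)
  rwa [zero_add] at this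

theorem end_zero {z : Cn n} (hz : z ∈ U) : G z + hess (fun w => p (0, w)) z = G z := by
  rw [h.hess_zero hz, add_zero]

theorem curv_congr {A B : Cn n → Matrix (Fin n) (Fin n) ℂ} (hAB : ∀ w ∈ U, A w = B w) {z : Cn n}
    (hz : z ∈ U) (j k : Fin n) : curv A z j k = curv B z j k := by
  rw [curv_eq, curv_eq]
  congr 1
  refine wdM_congr_on h.openU hz fun w hw => ?_
  rw [gam, gam, hAB w hw, wdM_congr_on h.openU hw hAB]

theorem dcurv_congr {A B C : Cn n → Matrix (Fin n) (Fin n) ℂ} (hAB : ∀ w ∈ U, A w = B w) {z : Cn n}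
    (hz : z ∈ U) (j k : Fin n) : dcurv A C z j k = dcurv B C z j k := by
  rw [dcurv, dcurv]
  congr 1
  refine wdM_congr_on h.openU hz fun w hw => ?_
  rw [dgam, dgam, gam, gam, hAB w hw, wdM_congr_on h.openU hw hAB]

theorem energy :
    (∃ Y1 Y2, TwiceDiff I U (fun t z => p (t, z) * topL n (-Complex.I •
      geomPow 0 (kf (G z)) (kf (G z + hess (fun w => p (t, w)) z)))) Y1 Y2) ∧
    ∀ z ∈ U, HasSecondDeriv (fun t => p (t, z) * topL n (-Complex.I •
      geomPow 0 (kf (G z)) (kf (G z + hess (fun w => p (t, w)) z))))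
      (f z * topL n (-Complex.I • powFact (kf (G z)) 0) +
        2 * u z * topL n ((-Complex.I / 2) • (kf (hess u z) * powFact (kf (G z)) 1))) := by
  have s1 : SmF (fun q : ℝ × Cn n => -Complex.I •
      geomPow 0 (kf (G q.2)) (kf (G q.2 + hess (fun w => p (q.1, w)) q.2))) (I ×ˢ U) :=
    SmF.const_smul _ (SmF.geomPow (SmF.const_smul _ (SmF.form11
      (fun a b => (h.smG a b).comp contDiffOn_snd fun _ hq => hq.2)))
      (SmF.const_smul _ (SmF.form11 h.smM_end)) 0)
  have d1 : ∀ z ∈ U, HasDerivF (fun t => -Complex.I •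
      geomPow 0 (kf (G z)) (kf (G z + hess (fun w => p (t, w)) z)))
      ((-Complex.I / 2) • (kf (hess u z) * powFact (kf (G z)) 1)) 0 := fun z hz => by
    have := (((HasDerivF.kf (h.hasDerivM_end hz)).geomPow (fun _ => kf_mem_center _) 0).const_smul
      (-Complex.I))
    rw [h.end_zero hz, smul_smul, mul_one_div] at this
    exact this
  obtain ⟨h1, h2⟩ := h.mul (s1 (topL n)) fun z hz => d1 z hz (topL n)
  refine ⟨h1, fun z hz => (h2 z hz).congr_deriv ?_⟩
  beta_reduce
  rw [h.end_zero hz, geomPow_self]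

theorem todd :
    (∃ Y1 Y2, TwiceDiff I U (fun t z => p (t, z) * topL n (
      chernWeil td2Polar (fun w => G w + hess (fun w => p (t, w)) w) z * (-Complex.I •
      geomPow 2 (kf (G z)) (kf (G z + hess (fun w => p (t, w)) z))))) Y1 Y2) ∧
    ∀ z ∈ U, HasSecondDeriv (fun t => p (t, z) * topL n (
      chernWeil td2Polar (fun w => G w + hess (fun w => p (t, w)) w) z * (-Complex.I •
      geomPow 2 (kf (G z)) (kf (G z + hess (fun w => p (t, w)) z)))))
      (f z * topL n (chernWeil td2Polar G z * (-Complex.I • powFact (kf (G z)) 2)) +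
        2 * u z * topL n (dChernWeil G (hess u) z * (-Complex.I • powFact (kf (G z)) 2) +
          chernWeil td2Polar G z *
            ((-Complex.I / 2) • (kf (hess u z) * powFact (kf (G z)) 3)))) := by
  have s1 : SmF (fun q : ℝ × Cn n => -Complex.I •
      geomPow 2 (kf (G q.2)) (kf (G q.2 + hess (fun w => p (q.1, w)) q.2))) (I ×ˢ U) :=
    SmF.const_smul _ (SmF.geomPow (SmF.const_smul _ (SmF.form11
      (fun a b => (h.smG a b).comp contDiffOn_snd fun _ hq => hq.2)))
      (SmF.const_smul _ (SmF.form11 h.smM_end)) 2)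
  have sR := fun j k => smM_curv_slice h.isOpen h.smM_end h.unit_end j k
  have s2 : SmF (fun q : ℝ × Cn n => chernWeil td2Polar
      (fun w => G w + hess (fun w => p (q.1, w)) w) q.2) (I ×ˢ U) :=
    SmF.form22 fun j k r s => ContDiffOn.td2Polar (sR j k) (sR r s)
  have d1 : ∀ z ∈ U, HasDerivF (fun t => -Complex.I •
      geomPow 2 (kf (G z)) (kf (G z + hess (fun w => p (t, w)) z)))
      ((-Complex.I / 2) • (kf (hess u z) * powFact (kf (G z)) 3)) 0 := fun z hz => by
    have := (((HasDerivF.kf (h.hasDerivM_end hz)).geomPow (fun _ => kf_mem_center _) 2).const_smul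
      (-Complex.I))
    rw [h.end_zero hz, smul_smul, mul_one_div] at this
    exact this
  -- At t = 0 the family agrees with G only on U; openness of U makes the derivatives agree there as
  -- well.
  have hc : ∀ z ∈ U, ∀ j k, curv (fun w => G w + hess (fun w => p (0, w)) w) z j k = curv G z j k :=
    fun z hz j k => h.curv_congr (fun w hw => h.end_zero hw) hz j k
  have d2 : ∀ z ∈ U, HasDerivF (fun t => chernWeil td2Polar
      (fun w => G w + hess (fun w => p (t, w)) w) z) (dChernWeil G (hess u) z) 0 := fun z hz => by
    have h1 := fun j k => hasDerivM_curv h.isOpen h.smM_end h.unit_end (h.mem hz)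
      (fun w hw => h.hasDerivM_end hw.2) j k
    have h2 := hasDerivF_chernWeil h1
    have e : ∀ j k, dcurv (fun w => G w + hess (fun w => p (0, w)) w) (hess u) z j k =
      dcurv G (hess u) z j k := h.dcurv_congr (fun w hw => h.end_zero hw) hz
    refine h2.congr_deriv ?_
    simp only [dChernWeil, e, hc z hz]
  have e0 : ∀ z ∈ U, chernWeil td2Polar (fun w => G w + hess (fun w => p (0, w)) w) z =
      chernWeil td2Polar G z := fun z hz => by
    rw [chernWeil_eq, chernWeil_eq]
    simp only [hc z hz]
  obtain ⟨h1, h2⟩ := h.mul ((s2.mul s1) (topL n)) fun z hz => ((d2 z hz).mul (d1 z hz)) (topL n)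
  refine ⟨h1, fun z hz => (h2 z hz).congr_deriv ?_⟩
  beta_reduce
  rw [h.end_zero hz, geomPow_self, e0 z hz]

end PotPath

/-! ### The Bott–Chern form along the segment of metrics. -/

namespace PotPath

variable {I : Set ℝ} {U : Set (Cn n)} {G : Cn n → Matrix (Fin n) (Fin n) ℂ} {p : ℝ × Cn n → ℂ}
  {u f : Cn n → ℂ} (h : PotPath I U G p u f)

/-- The metrics `g + s i∂∂̄φ_t`, as functions of `((t, s), z)`. -/
def seg (G : Cn n → Matrix (Fin n) (Fin n) ℂ) (p : ℝ × Cn n → ℂ) (q : (ℝ × ℝ) × Cn n) :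
    Matrix (Fin n) (Fin n) ℂ :=
  G q.2 + (q.1.2 : ℂ) • hess (fun w => p (q.1.1, w)) q.2

/-- The domain of nondegeneracy of the metrics `seg`. -/
def segDomain (I : Set ℝ) (U : Set (Cn n)) (G : Cn n → Matrix (Fin n) (Fin n) ℂ)
    (p : ℝ × Cn n → ℂ) : Set ((ℝ × ℝ) × Cn n) :=
  ((I ×ˢ Set.univ) ×ˢ U) ∩ {q | (seg G p q).det ≠ 0}

/-- The integrand of the Bott-Chern form. -/
def bcEntry (G : Cn n → Matrix (Fin n) (Fin n) ℂ) (p : ℝ × Cn n → ℂ) (j k : Fin n)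
    (q : (ℝ × ℝ) × Cn n) : ℂ :=
  2 * td2Polar (hess (fun w => p (q.1.1, w)) q.2 * (seg G p q)⁻¹)
    (curv (fun w => seg G p (q.1, w)) q.2 j k)

include h

theorem smM_hess_seg : SmM (fun q : (ℝ × ℝ) × Cn n => hess (fun w => p (q.1.1, w)) q.2)
    ((I ×ˢ Set.univ) ×ˢ U) := fun a b =>
  ContDiffOn.comp (g := fun q : ℝ × Cn n => hess (fun w => p (q.1, w)) q.2 a b)
    (f := fun q : (ℝ × ℝ) × Cn n => (q.1.1, q.2)) (smM_hess_slice h.isOpen h.smp a b)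
    (contDiff_fst.fst.prodMk contDiff_snd).contDiffOn fun _ hq => ⟨hq.1.1, hq.2⟩

theorem smM_seg : SmM (seg G p) ((I ×ˢ Set.univ) ×ˢ U) :=
  SmM.add (fun a b => (h.smG a b).comp contDiffOn_snd fun _ hq => hq.2)
    (h.smM_hess_seg.smul
      (Complex.ofRealCLM.contDiff.comp_contDiffOn contDiff_fst.snd.contDiffOn))

theorem isOpen_segDomain : IsOpen (segDomain I U G p) :=
  h.smM_seg.det.continuousOn.isOpen_inter_preimage
    ((h.openI.prod isOpen_univ).prod h.openU) isOpen_ne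

omit h in
theorem unit_seg : ∀ q ∈ segDomain I U G p, IsUnit (seg G p q).det :=
  fun _ hq => isUnit_iff_ne_zero.2 hq.2

theorem mem_segDomain {t s : ℝ} {z : Cn n} (ht : t ∈ I) (hs : s ∈ Set.Icc (0 : ℝ) 1) (hz : z ∈ U) :
    ((t, s), z) ∈ segDomain I U G p :=
  ⟨⟨⟨ht, trivial⟩, hz⟩, (h.unit t ht s hs z hz).ne_zero⟩

theorem smM_curv_seg (j k : Fin n) :
    SmM (fun q => curv (fun w => seg G p (q.1, w)) q.2 j k) (segDomain I U G p) :=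
  smM_curv_slice h.isOpen_segDomain (h.smM_seg.mono Set.inter_subset_left) unit_seg j k

theorem contDiffOn_bcEntry (j k : Fin n) : ContDiffOn ℝ ∞ (bcEntry G p j k) (segDomain I U G p) :=
  contDiffOn_const.mul (ContDiffOn.td2Polar ((h.smM_hess_seg.mono Set.inter_subset_left).mul
    ((h.smM_seg.mono Set.inter_subset_left).inv unit_seg)) (h.smM_curv_seg j k))

theorem seg_zero {s : ℝ} {z : Cn n} (hz : z ∈ U) : seg G p ((0, s), z) = G z := by
  rw [seg]
  rw [h.hess_zero hz, smul_zero, add_zero]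

theorem hasDerivM_seg {s : ℝ} {z : Cn n} (hz : z ∈ U) :
    HasDerivM (fun t => seg G p ((t, s), z)) ((s : ℂ) • hess u z) 0 := by
  have := (HasDerivM.const (G z) (t := 0)).add ((h.hasDerivM_hess hz).const_smul (s : ℂ))
  rwa [zero_add] at this

theorem dcurv_smul {c : ℂ} {z : Cn n} (hz : z ∈ U) (j k : Fin n) :
    dcurv G (fun w => c • hess u w) z j k = c • dcurv G (hess u) z j k := by
  have sH := (closed11_hess h.openU h.smu).smooth
  have w1 : ∀ {A : Cn n → Matrix (Fin n) (Fin n) ℂ} (_ : SmM A U) (τ : Fin 2) (j : Fin n) {z},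
      z ∈ U → wdM τ j (fun w => c • A w) z = c • wdM τ j A z := fun {A} hA τ j z hz => by
    ext a b
    exact wd_const_mul c (hA.diff h.openU hz a b)
  have e : ∀ w ∈ U, dgam G (fun w => c • hess u w) j w = c • dgam G (hess u) j w := fun w hw => by
    rw [dgam, dgam, w1 sH 0 j hw]
    simp only [smul_sub, Matrix.smul_mul, Matrix.mul_smul]
  rw [dcurv, dcurv, wdM_congr_on h.openU hz e,
    w1 (smM_dgam h.openU h.smG (fun w hw => h.unit_zero hw) sH j) 1 k hz, smul_neg]

theorem hasDerivM_curv_seg {s : ℝ} (hs : s ∈ Set.Icc (0 : ℝ) 1) {z : Cn n} (hz : z ∈ U)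
    (j k : Fin n) :
    HasDerivM (fun t => curv (fun w => seg G p ((t, s), w)) z j k)
      ((s : ℂ) • dcurv G (hess u) z j k) 0 := by
  have c : Continuous fun q : ℝ × Cn n => ((q.1, s), q.2) := by fun_prop
  have sm : SmM (fun q : ℝ × Cn n => seg G p ((q.1, s), q.2))
      ((fun q : ℝ × Cn n => ((q.1, s), q.2)) ⁻¹' segDomain I U G p) := fun a b =>
    ContDiffOn.comp (g := fun q => seg G p q a b) (f := fun q : ℝ × Cn n => ((q.1, s), q.2))
      (h.smM_seg.mono Set.inter_subset_left a b) (((contDiff_fst.prodMk contDiff_const).prodMk contDiff_snd).contDiffOn) fun _ hq => hq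
  have := hasDerivM_curv (h.isOpen_segDomain.preimage c) sm (fun q hq => unit_seg _ hq)
    (h.mem_segDomain h.zero_mem hs hz) (fun w hw => h.hasDerivM_seg hw.1.2) j k
  rw [h.dcurv_congr (fun w hw => h.seg_zero hw) hz, h.dcurv_smul hz] at this
  exact this

/-- The first factor has t-derivative ∂∂̄u independent of s, whereas the inverse metric and the
curvature vary along s∂∂̄u. The doubled first-order terms are thus proportional to s, and the term
with f is constant in s. -/
theorem hasSecondDeriv_bcEntry (j k : Fin n) {s : ℝ} (hs : s ∈ Set.Icc (0 : ℝ) 1) {z : Cn n}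
    (hz : z ∈ U) :
    HasSecondDeriv (fun t => bcEntry G p j k ((t, s), z))
      (2 * td2Polar (hess f z * (G z)⁻¹) (curv G z j k) + s *
        (4 * td2Polar (hess u z * (G z)⁻¹) (dcurv G (hess u) z j k) -
          4 * td2Polar (hess u z * (G z)⁻¹ * (hess u z * (G z)⁻¹)) (curv G z j k))) := by
  have hm := h.mem_segDomain h.zero_mem hs hz
  have sl : ∀ {F : (ℝ × ℝ) × Cn n → ℂ}, ContDiffOn ℝ ∞ F (segDomain I U G p) →
      ContDiffAt ℝ ∞ (fun t => F ((t, s), z)) 0 := fun hF =>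
    (hF.contDiffAt (h.isOpen_segDomain.mem_nhds hm)).comp (0 : ℝ)
      ((contDiffAt_id.prodMk contDiffAt_const).prodMk contDiffAt_const)
  have hM := (h.hasDerivM_seg (s := s) hz).inv (by rw [h.seg_zero hz]; exact h.unit_zero hz)
  have key := (hasSecondDeriv_td2Polar (M := fun t => (seg G p ((t, s), z))⁻¹)
    (R := fun t => curv (fun w => seg G p ((t, s), w)) z j k) (h.hasSecondDeriv_hess hz) (h.hasDerivM_hess hz)
    (h.hess_zero hz)
    (fun a b => sl ((h.smM_seg.mono Set.inter_subset_left).inv unit_seg a b))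
    (fun a b => sl (h.smM_curv_seg j k a b)) hM (h.hasDerivM_curv_seg hs hz j k)).const_mul 2
  refine key.congr_deriv ?_
  rw [h.seg_zero hz, h.curv_congr (fun w hw => h.seg_zero hw) hz]
  simp only [td2Polar_eq, Matrix.mul_neg, Matrix.neg_mul, Matrix.smul_mul, Matrix.mul_smul,
    Matrix.trace_neg, Matrix.trace_smul, smul_eq_mul, Matrix.mul_assoc]
  ring

omit h in
theorem bottChern_eq {t : ℝ} (z : Cn n) :
    bottChern td2Polar (fun w => G w + hess (fun w => p (t, w)) w) G z =
      form11 (Matrix.of fun j k => ∫ s in Set.Icc (0 : ℝ) 1, bcEntry G p j k ((t, s), z)) := by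
  have e : ∀ (s : ℝ) (w : Cn n), (1 - s) • G w + s • (G w + hess (fun w => p (t, w)) w) =
      seg G p ((t, s), w) := fun s w => by
    ext a b
    simp only [seg, Matrix.add_apply, Matrix.smul_apply, Complex.real_smul, smul_eq_mul]
    push_cast
    ring
  rw [bottChern]
  congr 1
  ext j k
  rw [Matrix.of_apply, Matrix.of_apply, MeasureTheory.integral_Icc_eq_integral_Ioc,
    ← intervalIntegral.integral_of_le zero_le_one]
  refine intervalIntegral.integral_congr fun s _ => ?_
  simp only [e, add_sub_cancel_left, bcEntry]
  rw [td2Polar_comm (curv _ _ _ _), two_mul]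

/-- The second derivative is affine in s on [0,1], so integration halves the two coefficients 4 of
`hasSecondDeriv_bcEntry`. -/
theorem integral_bcEntry (j k : Fin n) :
    (∃ Y1 Y2, TwiceDiff I U
      (fun t z => ∫ s in Set.Icc (0 : ℝ) 1, bcEntry G p j k ((t, s), z)) Y1 Y2) ∧
    ∀ z ∈ U, HasSecondDeriv (fun t => ∫ s in Set.Icc (0 : ℝ) 1, bcEntry G p j k ((t, s), z))
      (2 * td2Polar (hess f z * (G z)⁻¹) (curv G z j k)
        + 2 * td2Polar (hess u z * (G z)⁻¹) (dcurv G (hess u) z j k)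
        - 2 * td2Polar (hess u z * (G z)⁻¹ * (hess u z * (G z)⁻¹)) (curv G z j k)) := by
  have c : Continuous fun q : ℝ × (Cn n × ℝ) => ((q.1, q.2.2), q.2.1) := by fun_prop
  have sm : ContDiffOn ℝ ∞ (fun q : ℝ × (Cn n × ℝ) => bcEntry G p j k ((q.1, q.2.2), q.2.1))
      ((fun q : ℝ × (Cn n × ℝ) => ((q.1, q.2.2), q.2.1)) ⁻¹' segDomain I U G p) :=
    ContDiffOn.comp (g := bcEntry G p j k)
      (f := fun q : ℝ × (Cn n × ℝ) => ((q.1, q.2.2), q.2.1)) (h.contDiffOn_bcEntry j k)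
      ((contDiff_fst.prodMk contDiff_snd.snd).prodMk contDiff_snd.fst).contDiffOn fun _ hq => hq
  have T := TwiceDiff.of_contDiffOn (I := I) (A := U ×ˢ Set.Icc (0 : ℝ) 1)
    (h.isOpen_segDomain.preimage c) sm fun q hq => h.mem_segDomain hq.1 hq.2.2 hq.2.1
  -- Only the existence and continuity of the two t-derivatives matter; the second one at t = 0 is
  -- identified by uniqueness.
  generalize (fun (t : ℝ) (z : Cn n × ℝ) => fderiv ℝ (fun q : ℝ × (Cn n × ℝ) =>
    bcEntry G p j k ((q.1, q.2.2), q.2.1)) (t, z) (1, 0)) = Y1 at T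
  generalize (fun (t : ℝ) (z : Cn n × ℝ) => fderiv ℝ (fun q => fderiv ℝ
    (fun q : ℝ × (Cn n × ℝ) => bcEntry G p j k ((q.1, q.2.2), q.2.1)) q (1, 0)) (t, z) (1, 0)) =
      Y2 at T
  have hI := h.openI.mem_nhds h.zero_mem
  have T2 := T.integral (μ := MeasureTheory.volume) isCompact_Icc h.openI h.openU
  refine ⟨⟨_, _, T2⟩, fun z hz => (T2.hasSecondDeriv hI hz).congr_deriv ?_⟩
  have e : ∀ s ∈ Set.Icc (0 : ℝ) 1, Y2 0 (z, s) = _ := fun s hs =>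
    (T.hasSecondDeriv hI ⟨hz, hs⟩).unique (h.hasSecondDeriv_bcEntry j k hs hz)
  rw [MeasureTheory.setIntegral_congr_fun measurableSet_Icc e, integral_Icc_affine]
  ring

theorem bottChern (Θ : Cn n → Form n) (hΘ : SmF Θ U) :
    (∃ Y1 Y2, TwiceDiff I U (fun t z => topL n (
      Kahler.bottChern td2Polar (fun w => G w + hess (fun w => p (t, w)) w) G z * Θ z)) Y1 Y2) ∧
    ∀ z ∈ U, HasSecondDeriv (fun t => topL n (
      Kahler.bottChern td2Polar (fun w => G w + hess (fun w => p (t, w)) w) G z * Θ z))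
      (topL n (ddBottChern G u f z * Θ z)) := by
  have exp : ∀ (A : Matrix (Fin n) (Fin n) ℂ) (z : Cn n), topL n (form11 A * Θ z) =
      ∑ j, ∑ k, topL n (dz j * dzb k * Θ z) * A j k := fun A z => by
    simp only [form11, Finset.sum_mul, map_sum, smul_mul_assoc, map_smul, smul_eq_mul, mul_comm]
  have hc : ∀ j k, ContinuousOn (fun z => topL n (dz j * dzb k * Θ z)) U := fun j k =>
    ((SmF.mul (SmF.const (dz j * dzb k)) hΘ) (topL n)).continuousOn
  choose Y1 Y2 T using fun j k => (h.integral_bcEntry j k).1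
  simp only [bottChern_eq, exp, ddBottChern, Matrix.of_apply]
  exact ⟨⟨_, _, TwiceDiff.sum _ fun j _ => TwiceDiff.sum _ fun k _ =>
    (T j k).const_mul (hc j k)⟩, fun z hz => HasSecondDeriv.sum _ fun j _ =>
      HasSecondDeriv.sum _ fun k _ => ((h.integral_bcEntry j k).2 z hz).const_mul _⟩

end PotPath

/-! ### Differentiation of the Liouville action -/

/-- Every point of the segment is a convex combination of two positive definite matrices. The end s
= 0 is separate, since there the second one has weight zero. -/
theorem isUnit_det_add_smul {A H : Matrix (Fin n) (Fin n) ℂ} (hA : A.PosDef) (hB : (A + H).PosDef)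
    {s : ℝ} (hs : s ∈ Set.Icc (0 : ℝ) 1) : IsUnit (A + (s : ℂ) • H).det := by
  rw [← Matrix.isUnit_iff_isUnit_det]
  rcases eq_or_lt_of_le hs.1 with h0 | h0
  · rw [← h0, Complex.ofReal_zero, zero_smul, add_zero]
    exact hA.isUnit
  · have e : A + (s : ℂ) • H = ((1 - s : ℝ) : ℂ) • A + (s : ℂ) • (A + H) := by
      push_cast
      module
    rw [e]
    exact (Matrix.PosDef.posSemidef_add (hA.posSemidef.smul (Complex.zero_le_real.2 (by linarith [hs.2])))
      (hB.smul (Complex.zero_lt_real.2 h0))).isUnit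

theorem deriv_ofReal {f : ℝ → ℝ} (hf : ContDiffAt ℝ ∞ f 0) :
    deriv (fun t => (f t : ℂ)) 0 = (deriv f 0 : ℝ) ∧
    deriv (deriv fun t => (f t : ℂ)) 0 = (deriv (deriv f) 0 : ℝ) := by
  have h1 : ∀ᶠ t in 𝓝 (0 : ℝ), deriv (fun t => (f t : ℂ)) t = (deriv f t : ℝ) := by
    filter_upwards [(hf.of_le (m := 1) ENat.LEInfty.out).eventually (by simp)] with t ht
    exact (ht.differentiableAt (by simp)).hasDerivAt.ofReal_comp.deriv
  have h2 : ContDiffAt ℝ 1 (deriv f) 0 :=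
    ((hf.of_le (m := 2) ENat.LEInfty.out).fderiv_right (m := 1) (by norm_num)).clm_apply
      contDiffAt_const
  refine ⟨h1.self_of_nhds, ?_⟩
  rw [Filter.EventuallyEq.deriv_eq h1]
  exact (h2.differentiableAt (by simp)).hasDerivAt.ofReal_comp.deriv

section Manifold

variable {M : Type*} [TopologicalSpace M] [ChartedSpace (Cn n) M] [IsManifold 𝓘(ℂ, Cn n) ω M]

theorem contDiffOn_read_path {I : Set ℝ} {φ : ℝ → M → ℝ}
    (hsmooth : ContMDiffOn (𝓘(ℝ, ℝ).prod 𝓘(ℝ, Cn n)) 𝓘(ℝ, ℝ) ∞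
      (fun q : ℝ × M => φ q.1 q.2) (I ×ˢ Set.univ))
    {e : OpenPartialHomeomorph M (Cn n)} (he : e ∈ atlas (Cn n) M) :
    ContDiffOn ℝ ∞ (fun q : ℝ × Cn n => φ q.1 (e.symm q.2)) (I ×ˢ e.target) := by
  have := isManifold_real (n := n) M
  have h1 : ContMDiffOn 𝓘(ℝ, Cn n) 𝓘(ℝ, Cn n) ∞ e.symm e.target :=
    contMDiffOn_symm_of_mem_maximalAtlas (IsManifold.subset_maximalAtlas he)
  have h2 : ContMDiffOn (𝓘(ℝ, ℝ).prod 𝓘(ℝ, Cn n)) (𝓘(ℝ, ℝ).prod 𝓘(ℝ, Cn n)) ∞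
      (fun q : ℝ × Cn n => (q.1, e.symm q.2)) (I ×ˢ e.target) :=
    contMDiffOn_fst.prodMk (h1.comp contMDiffOn_snd fun q hq => hq.2)
  have h3 := hsmooth.comp h2 fun q hq => ⟨hq.1, trivial⟩
  rw [← modelWithCornersSelf_prod, chartedSpaceSelf_prod] at h3
  exact contMDiffOn_iff_contDiffOn.1 h3

theorem Metric.potPath (g : Metric n M) {ε : ℝ} (hε : 0 < ε) {φ : ℝ → M → ℝ}
    (hsmooth : ContMDiffOn (𝓘(ℝ, ℝ).prod 𝓘(ℝ, Cn n)) 𝓘(ℝ, ℝ) ∞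
      (fun q : ℝ × M => φ q.1 q.2) (Set.Ioo (-ε) ε ×ˢ Set.univ))
    (hpot : ∀ t ∈ Set.Ioo (-ε) ε, g.IsPotential (φ t)) (hzero : ∀ p : M, φ 0 p = 0)
    {φ' φ'' : M → ℝ} (hφ' : ∀ p : M, φ' p = deriv (fun t => φ t p) 0)
    (hφ'' : ∀ p : M, φ'' p = deriv (deriv (fun t => φ t p)) 0)
    {e : OpenPartialHomeomorph M (Cn n)} (he : e ∈ atlas (Cn n) M) :
    PotPath (Set.Ioo (-ε) ε) e.target (g.mat e) (fun q => read (φ q.1) e q.2)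
      (read φ' e) (read φ'' e) := by
  have h0 : (0 : ℝ) ∈ Set.Ioo (-ε) ε := ⟨by linarith, hε⟩
  have r := contDiffOn_read_path hsmooth he
  have hO : IsOpen (Set.Ioo (-ε) ε ×ˢ e.target) := isOpen_Ioo.prod e.open_target
  have sl : ∀ z ∈ e.target, ContDiffAt ℝ ∞ (fun t => φ t (e.symm z)) 0 := fun z hz =>
    ContDiffAt.comp (0 : ℝ) (g := fun q : ℝ × Cn n => φ q.1 (e.symm q.2)) (f := fun t => (t, z))
      (r.contDiffAt (hO.mem_nhds ⟨h0, hz⟩)) (contDiffAt_id.prodMk contDiffAt_const)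
  have hG : ∀ z ∈ e.target, (g.mat e z).PosDef := fun z hz => by
    -- At t = 0 the potential vanishes, so positivity of ω_0 is positivity of the coefficient matrix
    -- of the background metric.
    have h1 := (hpot 0 h0).2 e he z hz
    have h2 : hess (read (φ 0) e) z = 0 := by
      have : (read (φ 0) e : Cn n → ℂ) = fun _ => 0 := funext fun w => by
        rw [read, hzero, Complex.ofReal_zero]
      rw [this]
      ext j k
      have h3 : wd 1 k (fun _ : Cn n => (0 : ℂ)) = fun _ => 0 := funext fun w => wd_const 0
      rw [hess_apply, h3, wd_const]
      rfl
    rwa [Metric.matPot, h2, add_zero] at h1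
  exact {
    openI := isOpen_Ioo
    zero_mem := h0
    openU := e.open_target
    smG := (g.closed11 he).smooth
    smp := Complex.ofRealCLM.contDiff.comp_contDiffOn r
    zero := fun z _ => by rw [read, hzero, Complex.ofReal_zero]
    deriv1 := fun z hz => by rw [read, hφ']; exact (deriv_ofReal (sl z hz)).1
    deriv2 := fun z hz => by rw [read, hφ'']; exact (deriv_ofReal (sl z hz)).2
    unit := fun t ht s hs z hz => isUnit_det_add_smul (hG z hz) ((hpot t ht).2 e he z hz) hs }

theorem geomPow_read (k : ℕ) (c : ℂ) (η₀ η : Form n) :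
    (-Complex.I / (Nat.factorial (n + 1 - k) : ℂ)) • ∑ s ∈ Finset.range (n + 1 - k),
        c • (η ^ s * η₀ ^ (n - k - s)) = c • (-Complex.I • geomPow k η₀ η) := by
  rw [geomPow, ← Finset.smul_sum, smul_comm, div_eq_mul_inv, mul_smul]

variable [CompactSpace M] [T2Space M]

theorem Metric.hasSecondDeriv_liouville (g : Metric n M) {I : Set ℝ} (hI : IsOpen I)
    (h0 : (0 : ℝ) ∈ I) {φ : ℝ → M → ℝ} {u f : OpenPartialHomeomorph M (Cn n) → Cn n → ℂ}
    (h : ∀ e ∈ atlas (Cn n) M,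
      PotPath I e.target (g.mat e) (fun q => read (φ q.1) e q.2) (u e) (f e)) :
    HasSecondDeriv (fun t => g.liouville (φ t)) (-Complex.I * integral (ddAction g u f) +
      (Complex.I / g.vol) *
        integral (fun e z => chernWeil td2Polar (g.mat e) z * powFact (omega (g.mat e) z) 2) *
        integral (ddEnergy g u f)) ∧ ContTop (ddAction g u f) := by
  have hP : ∀ e ∈ atlas (Cn n) M, SmF (fun z => powFact (omega (g.mat e) z) 1) e.target :=
    fun e he => (g.globC_omega.powFact 1).smooth e he
  -- The shape `n + 1 - 2` is that of `geomPow 2` and is definitionally the `n - 1` of the action.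
  -- Truncated subtraction makes the sum empty for n ≤ 1, so small dimensions need no separate
  -- treatment.
  have A := hasSecondDeriv_integral hI h0 (ξ := ddAction g u f) (η := fun t e z =>
      bottChern td2Polar (g.matPot (φ t) e) (g.mat e) z * powFact (omega (g.mat e) z) 1 +
      chernWeil td2Polar (g.matPot (φ t) e) z *
        ((-Complex.I / (Nat.factorial (n + 1 - 2) : ℂ)) • ∑ s ∈ Finset.range (n + 1 - 2),
          read (φ t) e z • (omega (g.matPot (φ t) e) z ^ s * omega (g.mat e) z ^ (n - 2 - s))))
    (fun e he => by
      obtain ⟨Y1, Y2, h1⟩ := ((h e he).bottChern _ (hP e he)).1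
      obtain ⟨X1, X2, h2⟩ := (h e he).todd.1
      refine ⟨_, _, (h1.add h2).congr hI fun t _ z _ => ?_⟩
      rw [map_add, geomPow_read, mul_smul_comm, map_smul, smul_eq_mul]
      rfl)
    (fun e he z hz => by
      refine ((((h e he).bottChern _ (hP e he)).2 z hz).add ((h e he).todd.2 z hz)).congr_deriv ?_
        |>.congr (Filter.Eventually.of_forall fun t => ?_)
      · simp only [ddAction, map_add, map_smul, smul_eq_mul, add_assoc]
        rfl
      · beta_reduce
        rw [map_add, geomPow_read, mul_smul_comm, map_smul, smul_eq_mul]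
        rfl)
  have B := hasSecondDeriv_integral hI h0 (ξ := ddEnergy g u f) (η := fun t e z =>
      (-Complex.I / (Nat.factorial (n + 1 - 0) : ℂ)) • ∑ s ∈ Finset.range (n + 1 - 0),
        read (φ t) e z • (omega (g.matPot (φ t) e) z ^ s * omega (g.mat e) z ^ (n - 0 - s)))
    (fun e he => by
      obtain ⟨Y1, Y2, h1⟩ := (h e he).energy.1
      refine ⟨_, _, h1.congr hI fun t _ z _ => ?_⟩
      rw [geomPow_read, map_smul, smul_eq_mul]
      rfl)
    (fun e he z hz => by
      refine ((h e he).energy.2 z hz).congr_deriv ?_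
        |>.congr (Filter.Eventually.of_forall fun t => ?_)
      · simp only [ddEnergy, map_add, map_smul, smul_eq_mul]
        rfl
      · beta_reduce
        rw [geomPow_read, map_smul, smul_eq_mul]
        rfl)
  exact ⟨(A.1.const_mul _).add (B.1.const_mul _), A.2⟩

end Manifold

end Kahler

end

theorem mainTheorem4 (n : ℕ) (M : Type*) [TopologicalSpace M] [T2Space M] [CompactSpace M]
    [ChartedSpace (Kahler.Cn n) M] [IsManifold 𝓘(ℂ, Kahler.Cn n) ω M]
    (g : Kahler.Metric n M) (ε : ℝ) (hε : 0 < ε) (φ : ℝ → M → ℝ)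
    (hsmooth : ContMDiffOn (𝓘(ℝ, ℝ).prod 𝓘(ℝ, Kahler.Cn n)) 𝓘(ℝ, ℝ) ∞
      (fun q : ℝ × M => φ q.1 q.2) (Set.Ioo (-ε) ε ×ˢ Set.univ))
    (hpot : ∀ t ∈ Set.Ioo (-ε) ε, g.IsPotential (φ t))
    (hzero : ∀ p : M, φ 0 p = 0)
    (φ' φ'' : M → ℝ)
    (hφ' : ∀ p : M, φ' p = deriv (fun t => φ t p) 0)
    (hφ'' : ∀ p : M, φ'' p = deriv (deriv (fun t => φ t p)) 0) :
    (∀ᶠ t in 𝓝 (0 : ℝ), DifferentiableAt ℝ (fun t : ℝ => g.liouville (φ t)) t) ∧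
    HasDerivAt (deriv (fun t : ℝ => g.liouville (φ t)))
      (Kahler.integral (M := M) (fun e z =>
        let G := g.mat e
        let W := Kahler.omega G z
        let u := Kahler.read φ' e
        let S := Kahler.scal G
        (Kahler.read φ'' e z *
            (g.a2Avg + (1 / 6) * Kahler.lap G S z - (1 / 24) * Kahler.quadCurv G z)) •
              Kahler.powFact W 0
        + (g.a2Avg * u z * Kahler.lap G u z) • Kahler.powFact W 0
        + (Complex.I / 6) • (Kahler.del (Kahler.lap G u) z * Kahler.delbar (Kahler.lap G u) z *
            Kahler.powFact W 1)
        - (Complex.I / 6) • (Kahler.del u z * Kahler.delbar u z * Kahler.iddbar S z *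
            Kahler.powFact W 2)
        + ((1 / 4) * Kahler.lap G u z ^ 2 * S z) • Kahler.powFact W 0
        + (Complex.I / 8) • (Kahler.del u z * Kahler.delbar u z * Kahler.ricForm G z ^ 2 *
            Kahler.powFact W 3)
        + (Complex.I / 24) • (Kahler.del u z * Kahler.delbar u z *
            Kahler.chernWeil Kahler.trace2 G z * Kahler.powFact W 3)
        - ((1 / 2) * Kahler.lap G u z *
            Kahler.inner11 G z (Kahler.hess u z) (Kahler.ric G z)) • Kahler.powFact W 0
        + ((1 / 12) * Kahler.riemHessHess G u z) • Kahler.powFact W 0)) 0 := by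
  have h0 : (0 : ℝ) ∈ Set.Ioo (-ε) ε := ⟨by linarith, hε⟩
  have h := fun e (he : e ∈ atlas (Kahler.Cn n) M) =>
    g.potPath hε hsmooth hpot hzero hφ' hφ'' he
  have hg : g.Regular := fun e he z hz => (h e he).unit_zero hz
  -- Smoothness in charts comes from the joint smoothness of the path; compatibility between charts
  -- holds because the derivatives are functions on M.
  have hu : Kahler.GlobS M (Kahler.read φ') := ⟨fun e he => (h e he).smu, fun e he e' he' z hz => by
    rw [Kahler.read, Kahler.read, Kahler.symm_trans hz]⟩
  have hf : Kahler.GlobS M (Kahler.read φ'') := ⟨fun e he => (h e he).smf, fun e he e' he' z hz => by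
    rw [Kahler.read, Kahler.read, Kahler.symm_trans hz]⟩
  obtain ⟨h1, h2⟩ := g.hasSecondDeriv_liouville isOpen_Ioo h0 h
  rw [Kahler.second_variation_eq hg hu hf h2] at h1
  exact h1
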